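/- **Setting.** Let $\mathcal H$ be a separable real reproducing kernel Hilbert space of functions on a measurable space $\mathcal X$, with (jointly) measurable kernel $k$ satisfying $k(x,x)\le\kappa$ for all $x$, where $\kappa>0$. Let $P$ be a probability distribution of a pair $(X,Y)\in\mathcal X\times\mathbb R$ with $Y=f^*(X)+\varepsilon$, $\mathbb E[\varepsilon\mid X]=0$, $f^*\in L_2(P_X)$, and let $\|\cdot\|_2$ be the norm of $L_2(P_X)$. Let $K:L_2(P_X)\to L_2(P_X)$, $Kg=\int k(\cdot,x)g(x)\,dP_X(x)$. Let $1\le n\le\tilde n$; the data are $\tilde n$ i.i.d. points $X_1,\dots,X_{\tilde n}$ of which only the first $n$ carry labels: $(X_1,Y_1),\dots,(X_n,Y_n)$ are i.i.d. from $P$. **Estimator.** Put $\tilde{\mathbf Y}=\frac{\tilde n}{n}(Y_1,\dots,Y_n,0,\dots,0)\in\mathbb R^{\tilde n}$ and $K_{\tilde n}=\frac1{\tilde n}(k(X_i,X_j))_{i,j\le\tilde n}$. For $\alpha\in\mathbb R^{\tilde n}$ let $f_\alpha=\frac1{\tilde n}\sum_i\alpha_ik(X_i,\cdot)$ and $\|\alpha\|_{K_{\tilde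 n}}^2=\frac1{\tilde n}\alpha^\top K_{\tilde n}\alpha$. For $m\ge0$ let $\alpha_m$ be a minimizer of $\|\tilde{\mathbf Y}-K_{\tilde n}\alpha\|_{K_{\tilde n}}$ over the Krylov space $\mathrm{span}\{\tilde{\mathbf Y},K_{\tilde n}\tilde{\mathbf Y},\dots,K_{\tilde n}^{m-1}\tilde{\mathbf Y}\}$ (which is $\{0\}$ for $m=0$), and put $f_m=f_{\alpha_m}$. With parameters $r,s\ge0$, $\tau'>3/2$, $0<\gamma<1$, $D\ge1$, $M$, $\rho$ with $\max(M,\rho)>0$, let $\hat m$ be the first $m\ge 0$ such that $$\big\|(f_m(X_1),\dots,f_m(X_{\tilde n}))^\top-\tilde{\mathbf Y}\big\|_{K_{\tilde n}}<\tau'\max(M,\rho)\sqrt\kappa\,\Big(\frac{4D}{\sqrt n}\log\frac6\gamma\Big)^{\frac{2r+1}{2r+s}} .$$ **Theorem.** For every $r\ge0$ and $\tau'>3/2$ there is a constant $c(r,\tau')>0$, depending only on $r$ and $\tau'$, such that the following holds. Suppose that * (Bounded) $|Y|\le M$ almost surely; * SC($r$): $f^*=K^ru$ for some $u\in L_2(P_X)$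 with $\|u\|_2\le\kappa^{-r}\rho$; * ID($s$): $\mathrm{tr}\big(K(K+\lambda I)^{-1}\big)\le D^2(\kappa^{-1}\lambda)^{-s}$ for all $\lambda\in(0,1]$ and, if $\kappa>1$ and $\lambda_*:=\kappa\big(\frac{16D^2}n\log^2\frac6\gamma\big)^{\frac1{2r+s}}>1$, also for all $\lambda\in(1,\min(\kappa,\lambda_*)]$; * $r+s\ge\frac12$; * $\displaystyle\frac{\tilde n}{n}\ge\Big(\frac{16D^2}{n}\log^2\frac6\gamma\Big)^{-\frac{(1-2r)_+}{2r+s}}$, where $(t)_+=\max(t,0)$. Then with probability at least $1-3\gamma$ the stopping index $\hat m$ exists and $$\|f_{\hat m}-f^*\|_2^2\le c(r,\tau')\,(M+\rho)^2\Big(\frac{16D^2}{n}\log^2\frac6\gamma\Big)^{\frac{2r}{2r+s}} .$$ (The outer case is $r<1/2$.) -/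

import Mathlib

open MeasureTheory
open scoped ENNReal Matrix

noncomputable section

namespace KernelCG

section Kernel

variable {X : Type*} (H : Type*) [NormedAddCommGroup H] [InnerProductSpace ℝ H]
  [CompleteSpace H] [RKHS ℝ H X ℝ]

/-- The real-valued reproducing kernel `k(x, x')` of the Hilbert function space `H`. -/
def ker (x x' : X) : ℝ := RKHS.kernel H x x' (1 : ℝ)

theorem ker_eq_inner (x x' : X) :
    ker H x x' = inner ℝ (RKHS.kerFun H x' (1 : ℝ)) (RKHS.kerFun H x (1 : ℝ)) := by
  have h := RKHS.kernel_inner (H := H) x x' (1 : ℝ) (1 : ℝ)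
  rw [← h]
  simp [ker]

theorem abs_ker_le {κ : ℝ} (hb : ∀ x : X, ker H x x ≤ κ) (x x' : X) : |ker H x x'| ≤ κ := by
  have hn : ∀ t : X, ‖RKHS.kerFun H t (1 : ℝ)‖ ^ 2 ≤ κ := fun t => by
    have := hb t
    rwa [ker_eq_inner, real_inner_self_eq_norm_sq] at this
  rw [ker_eq_inner]
  have h1 := abs_real_inner_le_norm (RKHS.kerFun H x' (1 : ℝ)) (RKHS.kerFun H x (1 : ℝ))
  nlinarith [hn x, hn x', sq_nonneg (‖RKHS.kerFun H x' (1 : ℝ)‖ - ‖RKHS.kerFun H x (1 : ℝ)‖)]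

/-- The normalized kernel matrix `K_N = (k(x_i, x_j) / N)`. -/
def gram {N : ℕ} (x : Fin N → X) : Matrix (Fin N) (Fin N) ℝ :=
  Matrix.of fun i j => ker H (x i) (x j) / N

/-- The normalized kernel expansion `f_α = (1/N) ∑ i, α_i k(x_i, ·)`. -/
def expansion {N : ℕ} (x : Fin N → X) (α : Fin N → ℝ) : X → ℝ :=
  fun t => (1 / (N : ℝ)) * ∑ i, α i * ker H (x i) t

end Kernel

section ConjugateGradient

variable {N : ℕ}

/-- The norm `‖v‖_A = ⟨v, A v⟩^{1/2}`, for the Euclidean scalar product rescaled by `1/N`. -/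
def matNorm (A : Matrix (Fin N) (Fin N) ℝ) (v : Fin N → ℝ) : ℝ :=
  Real.sqrt ((1 / (N : ℝ)) * (v ⬝ᵥ (A *ᵥ v)))

/-- The Krylov space `span {y, A y, …, A^(m-1) y}`. -/
def krylov (A : Matrix (Fin N) (Fin N) ℝ) (y : Fin N → ℝ) (m : ℕ) :
    Submodule ℝ (Fin N → ℝ) :=
  Submodule.span ℝ {v | ∃ j < m, v = (A ^ j) *ᵥ y}

/-- `α` is an output of `m` conjugate gradient iterations: it minimizes `‖y - A α‖_A` over the
`m`-th Krylov space. If `A` is a kernel matrix, all minimizers have the same expansion `f_α`. -/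
def IsCGIterate (A : Matrix (Fin N) (Fin N) ℝ) (y : Fin N → ℝ) (m : ℕ) (α : Fin N → ℝ) : Prop :=
  α ∈ krylov A y m ∧ ∀ β ∈ krylov A y m, matNorm A (y - A *ᵥ α) ≤ matNorm A (y - A *ᵥ β)

/-- The rescaled, zero-padded responses `(N/n) (y_1, …, y_n, 0, …, 0)`. -/
def paddedResponses (n : ℕ) (y : Fin N → ℝ) : Fin N → ℝ :=
  fun i => if (i : ℕ) < n then (N : ℝ) / n * y i else 0

variable {X : Type*} (H : Type*) [NormedAddCommGroup H] [InnerProductSpace ℝ H]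
  [CompleteSpace H] [RKHS ℝ H X ℝ]

/-- `m` is the first iteration at which the residual
`‖(f_{α_m}(x_1), …, f_{α_m}(x_N)) - y‖_{K_N}` falls below the threshold. -/
def IsStoppingIndex (x : Fin N → X) (y : Fin N → ℝ) (α : ℕ → Fin N → ℝ) (threshold : ℝ)
    (m : ℕ) : Prop :=
  IsLeast {j : ℕ | matNorm (gram H x) (fun i => expansion H x (α j) (x i) - y i) < threshold} m

theorem matNorm_gram (x : Fin N → X) (v : Fin N → ℝ) :
    matNorm (gram H x) v = ‖(1 / (N : ℝ)) • ∑ i, v i • RKHS.kerFun H (x i) (1 : ℝ)‖ := by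
  rw [matNorm, ← Real.sqrt_sq (norm_nonneg ((1 / (N : ℝ)) • ∑ i, _)),
    ← real_inner_self_eq_norm_sq]
  congr 1
  simp only [inner_smul_left, inner_smul_right, sum_inner, inner_sum, dotProduct, Matrix.mulVec,
    gram, Matrix.of_apply, ker_eq_inner, Finset.mul_sum]
  refine Finset.sum_congr rfl fun i _ => Finset.sum_congr rfl fun j _ => ?_
  simp only [RCLike.conj_to_real, real_inner_comm]
  ring

/-- Conjugate gradient iterates for a kernel matrix exist at every step. -/
theorem exists_isCGIterate (x : Fin N → X) (y : Fin N → ℝ) (m : ℕ) :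
    ∃ α, IsCGIterate (gram H x) y m α := by
  let L : (Fin N → ℝ) →ₗ[ℝ] H :=
    (1 / (N : ℝ)) • ∑ i, (LinearMap.proj i : (Fin N → ℝ) →ₗ[ℝ] ℝ).smulRight
      (RKHS.kerFun H (x i) (1 : ℝ))
  have hL : ∀ v, matNorm (gram H x) v = ‖L v‖ := fun v => by
    rw [matNorm_gram]; simp [L]
  let V : Submodule ℝ H := (krylov (gram H x) y m).map (L ∘ₗ (gram H x).mulVecLin)
  obtain ⟨w, hw, hmin⟩ := V.exists_norm_eq_iInf_of_complete_subspace
    (Submodule.complete_of_finiteDimensional V) (L y)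
  obtain ⟨α, hα, rfl⟩ := hw
  refine ⟨α, hα, fun β hβ => ?_⟩
  rw [hL, hL, map_sub, map_sub]
  have hb : BddBelow (Set.range fun w : V => ‖L y - w‖) :=
    ⟨0, by rintro _ ⟨w, rfl⟩; exact norm_nonneg _⟩
  have h2 := hmin.trans_le
    (ciInf_le hb ⟨_, Submodule.mem_map_of_mem (f := L ∘ₗ (gram H x).mulVecLin) hβ⟩)
  simpa using h2

end ConjugateGradient

section Operators

variable {X : Type*} [MeasurableSpace X] (H : Type*) [NormedAddCommGroup H]
  [InnerProductSpace ℝ H] [CompleteSpace H] [RKHS ℝ H X ℝ]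

/-- The function `y ↦ ∫ k(y, x) g(x) dν(x)`. -/
def integralFun (ν : Measure X) (g : X → ℝ) : X → ℝ := fun y => ∫ x, ker H y x * g x ∂ν

theorem integrable_ker_mul {κ : ℝ} (hk : Measurable (Function.uncurry (ker (X := X) H)))
    (hb : ∀ x : X, ker H x x ≤ κ) (ν : Measure X) [IsProbabilityMeasure ν] (g : Lp ℝ 2 ν) (y : X) :
    Integrable (fun x => ker H y x * g x) ν := by
  have hg : Integrable g ν := (Lp.memLp g).integrable (by norm_num)
  refine Integrable.bdd_mul (c := κ) hg ?_ ?_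
  · exact (hk.comp (measurable_const.prodMk measurable_id)).aestronglyMeasurable
  · exact Filter.Eventually.of_forall fun x => by
      simpa [Real.norm_eq_abs] using abs_ker_le H hb y x

theorem abs_integralFun_le {κ : ℝ} (hb : ∀ x : X, ker H x x ≤ κ)
    (ν : Measure X) [IsProbabilityMeasure ν] (g : Lp ℝ 2 ν) (y : X) :
    |integralFun H ν g y| ≤ κ * ‖g‖ := by
  have hκ : 0 ≤ κ := (abs_nonneg _).trans (abs_ker_le H hb y y)
  have hg : Integrable g ν := (Lp.memLp g).integrable (by norm_num)
  have h1 : |integralFun H ν g y| ≤ ∫ x, κ * ‖g x‖ ∂ν := by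
    rw [← Real.norm_eq_abs]
    refine norm_integral_le_of_norm_le (hg.norm.const_mul κ) (Filter.Eventually.of_forall ?_)
    intro x
    rw [norm_mul]
    exact mul_le_mul_of_nonneg_right (abs_ker_le H hb y x) (norm_nonneg _)
  refine h1.trans ?_
  rw [integral_const_mul]
  refine mul_le_mul_of_nonneg_left ?_ hκ
  rw [integral_norm_eq_lintegral_enorm hg.aestronglyMeasurable, Lp.norm_def,
    ← eLpNorm_one_eq_lintegral_enorm]
  refine ENNReal.toReal_mono (Lp.eLpNorm_ne_top g) ?_
  exact eLpNorm_le_eLpNorm_of_exponent_le (by norm_num) hg.aestronglyMeasurable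

theorem memLp_integralFun {κ : ℝ} (hk : Measurable (Function.uncurry (ker (X := X) H)))
    (hb : ∀ x : X, ker H x x ≤ κ) (ν : Measure X) [IsProbabilityMeasure ν] (g : Lp ℝ 2 ν) :
    MemLp (integralFun H ν g) 2 ν := by
  refine MemLp.of_bound ?_ (κ * ‖g‖) (Filter.Eventually.of_forall fun y => ?_)
  · have h : StronglyMeasurable (fun p : X × X => ker H p.1 p.2 * g p.2) :=
      hk.stronglyMeasurable.mul ((Lp.stronglyMeasurable g).comp_measurable measurable_snd)
    exact (h.integral_prod_right' (ν := ν)).aestronglyMeasurable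
  · exact abs_integralFun_le H hb ν g y

/-- The kernel integral operator `g ↦ ∫ k(·, x) g(x) dν(x)` on `L²(ν)`, for a measurable kernel
bounded by `κ` and a probability measure `ν`. -/
def kernelOp {κ : ℝ} (hk : Measurable (Function.uncurry (ker (X := X) H)))
    (hb : ∀ x : X, ker H x x ≤ κ) (ν : Measure X) [IsProbabilityMeasure ν] :
    Lp ℝ 2 ν →L[ℝ] Lp ℝ 2 ν :=
  LinearMap.mkContinuous
    { toFun := fun g => (memLp_integralFun H hk hb ν g).toLp
      map_add' := fun f g => by
        rw [← MemLp.toLp_add]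
        refine MemLp.toLp_congr _ _ (Filter.Eventually.of_forall fun y => ?_)
        simp only [integralFun, Pi.add_apply]
        rw [← integral_add (integrable_ker_mul H hk hb ν f y) (integrable_ker_mul H hk hb ν g y)]
        refine integral_congr_ae ?_
        filter_upwards [Lp.coeFn_add f g] with x hx
        rw [hx, Pi.add_apply, mul_add]
      map_smul' := fun a g => by
        rw [RingHom.id_apply, ← MemLp.toLp_const_smul]
        refine MemLp.toLp_congr _ _ (Filter.Eventually.of_forall fun y => ?_)
        simp only [integralFun, Pi.smul_apply, smul_eq_mul]
        rw [← integral_const_mul]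
        refine integral_congr_ae ?_
        filter_upwards [Lp.coeFn_smul a g] with x hx
        rw [hx, Pi.smul_apply, smul_eq_mul]
        ring }
    κ fun g => by
      have hκ : 0 ≤ κ := by
        obtain ⟨y⟩ : Nonempty X := ν.nonempty_of_neZero
        exact (abs_nonneg _).trans (abs_ker_le H hb y y)
      refine (Lp.norm_le_of_ae_bound (C := κ * ‖g‖) (by positivity) ?_).trans
        (by simp [measureUnivNNReal])
      filter_upwards [(memLp_integralFun H hk hb ν g).coeFn_toLp] with y hy
      simp only [LinearMap.coe_mk, AddHom.coe_mk]
      rw [hy]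
      exact abs_integralFun_le H hb ν g y

theorem kernelOp_ae_eq {κ : ℝ} (hk : Measurable (Function.uncurry (ker (X := X) H)))
    (hb : ∀ x : X, ker H x x ≤ κ) (ν : Measure X) [IsProbabilityMeasure ν] (g : Lp ℝ 2 ν) :
    kernelOp H hk hb ν g =ᵐ[ν] fun y => ∫ x, ker H y x * g x ∂ν :=
  (memLp_integralFun H hk hb ν g).coeFn_toLp

variable {E : Type*} [NormedAddCommGroup E] [InnerProductSpace ℝ E]

/-- `f = A^r u`, where `A` is a positive self-adjoint operator with an orthonormal basis of
eigenvectors (such as a kernel integral operator, which is compact): in such a basis the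
coordinates of `f` are those of `u` multiplied by the `r`-th powers of the eigenvalues.
Here `0 ^ 0 = 1`, so that `A^0` is the identity. -/
def IsPowerImage (A : E →L[ℝ] E) (r : ℝ) (u f : E) : Prop :=
  ∃ (w : Set E) (b : HilbertBasis w ℝ E) (ξ : w → ℝ),
    (∀ i, A (b i) = ξ i • b i) ∧ ∀ i, inner ℝ (b i) f = ξ i ^ r * inner ℝ (b i) u

/-- The trace in `[0, ∞]` of a positive operator, as the supremum of `∑ ⟨e, A e⟩` over all finite
orthonormal families. -/
def posTrace (A : E →L[ℝ] E) : ℝ≥0∞ :=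
  ⨆ (t : Finset E) (_ : Orthonormal ℝ ((↑) : t → E)),
    ENNReal.ofReal (∑ e ∈ t, inner ℝ e (A e))

/-- Intrinsic dimensionality on the range `(0, lmax]`:
`tr (A (A + l I)⁻¹) ≤ D² (l / κ)^(-s)` for all `l ∈ (0, lmax]`. -/
def IntrinsicDim (A : E →L[ℝ] E) (κ s D lmax : ℝ) : Prop :=
  ∀ l : ℝ, 0 < l → l ≤ lmax →
    posTrace (A * Ring.inverse (A + l • (1 : E →L[ℝ] E))) ≤
      ENNReal.ofReal (D ^ 2 * (κ⁻¹ * l) ^ (-s))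

/-- The source condition: `f = A^r u` almost everywhere, for some `u` with `‖u‖ ≤ κ^(-r) ρ`. -/
def SourceCondition {ν : Measure X} (A : Lp ℝ 2 ν →L[ℝ] Lp ℝ 2 ν) (κ r ρ : ℝ) (f : X → ℝ) : Prop :=
  ∃ u g : Lp ℝ 2 ν, f =ᵐ[ν] g ∧ IsPowerImage A r u g ∧ ‖u‖ ≤ κ ^ (-r) * ρ

/-- `f` is the regression function of the law `P` of `(X, Y)`: it is square integrable and
`Y = f(X) + ε` with `E[ε | X] = 0`. -/
def IsRegressionFunction (P : Measure (X × ℝ)) (f : X → ℝ) : Prop :=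
  MemLp f 2 P.fst ∧ Integrable (fun z : X × ℝ => z.2) P ∧
    P[fun z : X × ℝ => z.2 - f z.1 | MeasurableSpace.comap Prod.fst inferInstance] =ᵐ[P] 0

end Operators

/-- The quantity `(16 D² / n) log² (6 / γ)`. -/
def rateBase (D γ : ℝ) (n : ℕ) : ℝ := 16 * D ^ 2 / n * Real.log (6 / γ) ^ 2

/-- The stopping threshold `τ' max(M, ρ) √κ ((4 D / √n) log (6 / γ))^((2r+1)/(2r+s))`. -/
def stopThreshold (τ' M ρ κ D γ r s : ℝ) (n : ℕ) : ℝ :=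
  τ' * max M ρ * Real.sqrt κ *
    (4 * D / Real.sqrt n * Real.log (6 / γ)) ^ ((2 * r + 1) / (2 * r + s))

end KernelCG

end

/-!
Write `S = J† J` for the covariance operator, where `J` is the inclusion of `H` into `L²`, so that
the kernel integral operator is `J J†`; write `A` for the empirical covariance operator of all `N`
points, `d` for the kernel expansion of the padded responses, and `q` for the spectral cut-off
relative to `κ`, given by `q ^ (2 r + s) = rateBase D γ n`, with `l = κ q`. The kernel expansions of
the conjugate gradient iterates are `p(A) d`, with polynomials `p` minimizing `‖A p(A) d - d‖`.

*Probability.* By Bernstein's inequality in a Hilbert space (`measure_norm_average_sub_ge_le`,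
proved through Pinelis' bound for `E cosh ‖∑ Z i‖`), applied to `Y (S + l)^(-1/2) k(X, ·)` and to
the Hilbert-Schmidt operators `k(X, ·) ⊗ (S + l)^(-1/2) k(X, ·)`, two events hold with probability
at least `1 - γ` each: `d` is close to `J† f*`, and `A` is close to `S`, both in the norm dual to
`y ↦ ‖(S + l)^(1/2) y‖` (`measure_not_dualBound_le`, `measure_not_empOp_sub_le_rate`). The variances
are bounded by the effective dimension `tr (S (S + l)⁻¹)`, that is, by the intrinsic dimensionality
(`sum_eigen_div_le`). For `r < 1/2` the second event needs the unlabeled points.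

*Source condition.* The part of `f*` above the spectral cut-off `l` is `J h` with `h = S ^ j y`,
`j = ⌈r⌉`, and the rest is negligible (`exists_source_vector`). Expanding `S ^ j` around `A` gives
`h = ∑ A ^ k (v k)` with `‖(A + l)^(-1/2) v k‖` of order `l ^ (-k - 1)`
(`pow_apply_eq_sum`, `exists_isLeast_norm_sub_le`), a substitute for a source condition with respect
to `A` which involves no fractional powers of operators.

*Conjugate gradients.* The residual polynomial of a step whose predecessor has a nonzero residual is
a product of factors `1 - x / z` with positive roots `z`. Dividing it by the factor of its smallest
root `x₁` gives a competitor at the previous step, where the residual still exceeds the threshold;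
with the orthogonality of residual polynomials this bounds the threshold by the part of the data on
`x ≤ 3 x₁ / 2`, damped by `exp (-R x / 4)`, `R` being the sum of the inverses of the other roots
(`exists_smallest_root`). Since the threshold exceeds the noise level by a factor larger than `3/2`,
the slope `1 / x₁ + R` of the residual polynomial at zero is at most of order `1 / l` (`slope_le`).
Below the level `1 / slope` the iterate therefore acts as a regularization of strength `l`, and
above it the small residual controls the error (`energyNorm_sub_le`). This gives the rate on good
samples (`exists_isLeast_energyNorm_le`, `exists_isStoppingIndex`).

If `rateBase D γ n ≥ 1`, then almost surely the responses are below the threshold, the iteration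
stops at once, and the bound only says that `‖f*‖` is at most of order `M + ρ`.
-/

namespace KernelCG


/-! ### Operators that are diagonal in a Hilbert basis -/

section Diagonal

variable {E : Type*} [NormedAddCommGroup E] [InnerProductSpace ℝ E] {ι : Type*}
  (e : HilbertBasis ι ℝ E)

theorem hasSum_inner_sq (x : E) : HasSum (fun i => inner ℝ (e i) x ^ 2) (‖x‖ ^ 2) := by
  have h := e.hasSum_inner_mul_inner x x
  rw [real_inner_self_eq_norm_sq] at h
  refine h.congr_fun fun i => ?_
  rw [real_inner_comm x, sq]

theorem norm_le_of_abs_inner_le {F : Type*} [NormedAddCommGroup F] [InnerProductSpace ℝ F]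
    (f : HilbertBasis ι ℝ F) {x : E} {y : F}
    (h : ∀ i, |inner ℝ (e i) x| ≤ |inner ℝ (f i) y|) : ‖x‖ ≤ ‖y‖ := by
  refine le_of_sq_le_sq ?_ (norm_nonneg _)
  exact hasSum_le (fun i => sq_le_sq.2 (h i)) (hasSum_inner_sq e x) (hasSum_inner_sq f y)

theorem ext_inner_basis {x y : E} (h : ∀ i, inner ℝ (e i) x = inner ℝ (e i) y) : x = y := by
  rw [← sub_eq_zero, ← norm_le_zero_iff, ← norm_zero (E := E)]
  refine norm_le_of_abs_inner_le e e fun i => ?_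
  simp [inner_sub_right, h i]

theorem exists_diagonal [CompleteSpace E] (φ : ι → ℝ) (C : ℝ) (h : ∀ i, |φ i| ≤ C) :
    ∃ D : E →L[ℝ] E, ∀ i x, inner ℝ (e i) (D x) = φ i * inner ℝ (e i) x := by
  have hmem : ∀ x : E, Memℓp (fun i => φ i * inner ℝ (e i) x) 2 := fun x => by
    refine memℓp_gen ?_
    refine Summable.of_nonneg_of_le (fun i => by positivity) (fun i => ?_)
      ((hasSum_inner_sq e x).summable.mul_left (C ^ 2))
    have h1 : (2 : ℝ≥0∞).toReal = ((2 : ℕ) : ℝ) := by norm_num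
    rw [h1, Real.rpow_natCast, Real.norm_eq_abs, sq_abs, mul_pow]
    refine mul_le_mul_of_nonneg_right ?_ (sq_nonneg _)
    exact sq_le_sq.2 ((h i).trans (le_abs_self C))
  have hco : ∀ (f : lp (fun _ : ι => ℝ) 2) (i : ι), inner ℝ (e i) (e.repr.symm f) = f i :=
    fun f i => by rw [← e.repr_apply_apply, LinearIsometryEquiv.apply_symm_apply]
  let D : E →ₗ[ℝ] E :=
    { toFun := fun x => e.repr.symm ⟨_, hmem x⟩
      map_add' := fun x y => ext_inner_basis e fun i => by
        rw [inner_add_right, hco, hco, hco]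
        simp only [inner_add_right, mul_add]
      map_smul' := fun a x => ext_inner_basis e fun i => by
        rw [RingHom.id_apply, inner_smul_right, hco, hco]
        simp only [inner_smul_right]
        ring }
  have hD : ∀ i x, inner ℝ (e i) (D x) = φ i * inner ℝ (e i) x := fun i x => hco _ i
  refine ⟨D.mkContinuous |C| fun x => ?_, hD⟩
  rw [← Real.norm_eq_abs, ← norm_smul]
  refine norm_le_of_abs_inner_le e e fun i => ?_
  rw [hD, inner_smul_right, abs_mul, abs_mul]
  exact mul_le_mul_of_nonneg_right ((h i).trans (le_abs_self C)) (abs_nonneg _)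

open Classical in
/-- The diagonal operator with entries `φ i` in a Hilbert basis; it is the zero operator when no
bounded diagonal operator with these entries exists, that is, when `φ` is unbounded. -/
noncomputable def diagOp [CompleteSpace E] (φ : ι → ℝ) : E →L[ℝ] E :=
  if h : ∃ D : E →L[ℝ] E, ∀ i x, inner ℝ (e i) (D x) = φ i * inner ℝ (e i) x then h.choose else 0

theorem inner_diagOp [CompleteSpace E] {φ : ι → ℝ} {C : ℝ} (h : ∀ i, |φ i| ≤ C) (i : ι) (x : E) :
    inner ℝ (e i) (diagOp e φ x) = φ i * inner ℝ (e i) x := by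
  have hex := exists_diagonal e φ C h
  rw [diagOp, dif_pos hex]
  exact hex.choose_spec i x

theorem norm_diagOp_le [CompleteSpace E] {φ : ι → ℝ} {C : ℝ} (h : ∀ i, |φ i| ≤ C) (x : E) :
    ‖diagOp e φ x‖ ≤ |C| * ‖x‖ := by
  rw [← Real.norm_eq_abs, ← norm_smul]
  refine norm_le_of_abs_inner_le e e fun i => ?_
  rw [inner_diagOp e h, inner_smul_right, abs_mul, abs_mul]
  exact mul_le_mul_of_nonneg_right ((h i).trans (le_abs_self C)) (abs_nonneg _)

theorem inner_diagOp_comm [CompleteSpace E] {φ : ι → ℝ} {C : ℝ} (h : ∀ i, |φ i| ≤ C) (x y : E) :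
    inner ℝ (diagOp e φ x) y = inner ℝ x (diagOp e φ y) := by
  rw [← (e.hasSum_inner_mul_inner (diagOp e φ x) y).tsum_eq,
    ← (e.hasSum_inner_mul_inner x (diagOp e φ y)).tsum_eq]
  refine tsum_congr fun i => ?_
  rw [inner_diagOp e h, real_inner_comm, inner_diagOp e h, real_inner_comm x]
  ring

/-- A symmetric operator acts on the coordinates in a basis of eigenvectors by multiplication with
the eigenvalues. -/
theorem inner_eigen {A : E →L[ℝ] E} (hA : ∀ x y, inner ℝ (A x) y = inner ℝ x (A y)) {a : ι → ℝ}
    (ha : ∀ i, A (e i) = a i • e i) (i : ι) (x : E) :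
    inner ℝ (e i) (A x) = a i * inner ℝ (e i) x := by
  rw [← hA, ha, real_inner_smul_left]

theorem inner_eigen_pow {A : E →L[ℝ] E} (hA : ∀ x y, inner ℝ (A x) y = inner ℝ x (A y))
    {a : ι → ℝ} (ha : ∀ i, A (e i) = a i • e i) (k : ℕ) (i : ι) (x : E) :
    inner ℝ (e i) ((A ^ k) x) = a i ^ k * inner ℝ (e i) x := by
  induction k with
  | zero => simp
  | succ k ih =>
    rw [pow_succ', mul_apply_eq_comp, inner_eigen e hA ha, ih]
    ring

theorem inner_eigen_aeval {A : E →L[ℝ] E} (hA : ∀ x y, inner ℝ (A x) y = inner ℝ x (A y))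
    {a : ι → ℝ} (ha : ∀ i, A (e i) = a i • e i) (p : Polynomial ℝ) (i : ι) (x : E) :
    inner ℝ (e i) (Polynomial.aeval A p x) = p.eval (a i) * inner ℝ (e i) x := by
  induction p using Polynomial.induction_on' with
  | add p q hp hq => simp [inner_add_right, hp, hq, add_mul]
  | monomial n c =>
    rw [Polynomial.aeval_monomial, Polynomial.eval_monomial, mul_apply_eq_comp,
      ContinuousLinearMap.algebraMap_apply, inner_smul_right, inner_eigen_pow e hA ha]
    ring

theorem eigenvalue_le_norm {A : E →L[ℝ] E} {a : ι → ℝ}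
    (ha : ∀ i, A (e i) = a i • e i) (i : ι) : |a i| ≤ ‖A‖ := by
  have h := A.le_opNorm (e i)
  rwa [ha, norm_smul, e.orthonormal.1 i, mul_one, mul_one, Real.norm_eq_abs] at h

/-- The energy `⟪A x, x⟫ + l ‖x‖²` in a basis of eigenvectors. -/
theorem hasSum_energy {A : E →L[ℝ] E} (hA : ∀ x y, inner ℝ (A x) y = inner ℝ x (A y))
    {a : ι → ℝ} (ha : ∀ i, A (e i) = a i • e i) (l : ℝ) (x : E) :
    HasSum (fun i => (a i + l) * inner ℝ (e i) x ^ 2) (inner ℝ (A x) x + l * ‖x‖ ^ 2) := by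
  have h1 := (e.hasSum_inner_mul_inner (A x) x).add ((hasSum_inner_sq e x).mul_left l)
  refine h1.congr_fun fun i => ?_
  rw [real_inner_comm (e i) (A x), inner_eigen e hA ha]
  ring

end Diagonal

/-! ### Eigenbases of `T† T` and `T T†` -/

section Adjoint

variable {E H : Type*} [NormedAddCommGroup E] [InnerProductSpace ℝ E] [CompleteSpace E]
  [NormedAddCommGroup H] [InnerProductSpace ℝ H] [CompleteSpace H] {ι : Type*}

open ContinuousLinearMap in
/-- If `T† T` is diagonal in a Hilbert basis `b`, then `T T†` is diagonal in a Hilbert basis: the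
normalized nonzero vectors `T (b i)` are orthonormal eigenvectors, and `T†` vanishes on everything
orthogonal to them. -/
theorem exists_hilbertBasis_eigen (b : HilbertBasis ι ℝ E) (ξ : ι → ℝ) (T : E →L[ℝ] H)
    (hT : ∀ i, adjoint T (T (b i)) = ξ i • b i) :
    ∃ (w : Set H) (e : HilbertBasis w ℝ H) (σ : w → ℝ),
      ∀ j, T (adjoint T (e j)) = σ j • e j := by
  classical
  have hin : ∀ i j, inner ℝ (T (b i)) (T (b j)) = if i = j then ξ i else 0 := fun i j => by
    rw [← adjoint_inner_left, hT, real_inner_smul_left, orthonormal_iff_ite.1 b.orthonormal]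
    simp
  have hξ : ∀ i, 0 ≤ ξ i := fun i => by
    have := hin i i
    rw [real_inner_self_eq_norm_sq, if_pos rfl] at this
    rw [← this]; positivity
  let v : {i // ξ i ≠ 0} → H := fun i => (Real.sqrt (ξ i))⁻¹ • T (b i)
  have hv : Orthonormal ℝ v := by
    rw [orthonormal_iff_ite]
    intro i j
    simp only [v, real_inner_smul_left, real_inner_smul_right, hin]
    by_cases h : i = j
    · subst h
      have hs : Real.sqrt (ξ i) ≠ 0 := (Real.sqrt_pos.2 ((hξ i).lt_of_ne' i.2)).ne'
      rw [if_pos rfl, if_pos rfl]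
      nth_rw 3 [← Real.mul_self_sqrt (hξ i)]
      field_simp
    · rw [if_neg (fun h' => h (Subtype.ext h')), if_neg h]
      simp
  obtain ⟨w, e, hsub, he⟩ := hv.toSubtypeRange.exists_hilbertBasis_extension
  refine ⟨w, e, fun j => if h : ∃ i, v i = j then ξ h.choose else 0, fun j => ?_⟩
  by_cases h : ∃ i, v i = (j : H)
  · simp only [dif_pos h]
    have h1 : e j = v h.choose := by rw [he, h.choose_spec]
    rw [h1]
    simp only [v, map_smul, hT]
    rw [smul_comm]
  · simp only [dif_neg h, zero_smul]
    have h0 : adjoint T (e j) = 0 := by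
      refine ext_inner_basis b fun i => ?_
      rw [adjoint_inner_right, inner_zero_right]
      by_cases hi : ξ i = 0
      · have := hin i i
        rw [real_inner_self_eq_norm_sq, if_pos rfl, hi] at this
        rw [norm_eq_zero.1 (pow_eq_zero_iff two_ne_zero |>.1 this), inner_zero_left]
      · have hmem : v ⟨i, hi⟩ ∈ w := hsub ⟨_, rfl⟩
        have hne : (⟨v ⟨i, hi⟩, hmem⟩ : w) ≠ j := fun h' => h ⟨⟨i, hi⟩, by rw [← h']⟩
        have h2 := e.orthonormal.2 hne
        rw [he] at h2 ⊢
        simp only [v, real_inner_smul_left] at h2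
        have hs : Real.sqrt (ξ i) ≠ 0 := (Real.sqrt_pos.2 ((hξ i).lt_of_ne' hi)).ne'
        exact (mul_eq_zero.1 h2).resolve_left (inv_ne_zero hs)
    rw [h0, map_zero]

open ContinuousLinearMap in
theorem finite_eigen_ne_zero [FiniteDimensional ℝ E] (e : HilbertBasis ι ℝ H) (σ : ι → ℝ)
    (T : E →L[ℝ] H) (hT : ∀ i, T (adjoint T (e i)) = σ i • e i) : {i | σ i ≠ 0}.Finite := by
  classical
  have hin : ∀ i j, inner ℝ (adjoint T (e i)) (adjoint T (e j)) = if i = j then σ i else 0 :=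
    fun i j => by
      rw [adjoint_inner_right, hT, real_inner_smul_left, orthonormal_iff_ite.1 e.orthonormal]
      simp
  have hli : LinearIndependent ℝ fun i : {i | σ i ≠ 0} => adjoint T (e i) := by
    refine linearIndependent_of_ne_zero_of_inner_eq_zero (𝕜 := ℝ) (fun i h => i.2 ?_)
      fun i j hij => ?_
    · have := hin i i
      rw [if_pos rfl, h, inner_zero_left] at this
      exact this.symm
    · exact (hin i j).trans (if_neg fun h => hij (Subtype.ext h))
  exact Set.finite_coe_iff.1 hli.finite

end Adjoint


/-! ### Bernstein's inequality in a Hilbert space -/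

section Concentration

variable {E : Type*} [NormedAddCommGroup E] [InnerProductSpace ℝ E]

/-- The function `t ↦ cosh √t` is convex, having a power series with nonnegative coefficients. -/
theorem cosh_le_of_sq_eq {θ p q w : ℝ} (h0 : 0 ≤ θ) (h1 : θ ≤ 1)
    (hw : w ^ 2 = θ * p ^ 2 + (1 - θ) * q ^ 2) :
    Real.cosh w ≤ θ * Real.cosh p + (1 - θ) * Real.cosh q := by
  refine hasSum_le (fun k => ?_) (Real.hasSum_cosh w)
    (((Real.hasSum_cosh p).mul_left θ).add ((Real.hasSum_cosh q).mul_left (1 - θ)))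
  have hc := (convexOn_pow (𝕜 := ℝ) k).2 (x := p ^ 2) (sq_nonneg p) (y := q ^ 2) (sq_nonneg q) h0
    (sub_nonneg.2 h1) (by ring)
  simp only [smul_eq_mul] at hc
  rw [pow_mul, pow_mul, pow_mul, hw, mul_div_assoc', mul_div_assoc', ← add_div]
  exact div_le_div_of_nonneg_right hc (by positivity)

/-- For a given angle between `x` and `v`, `‖x + v‖ ^ 2` is a convex combination of
`(‖x‖ ± ‖v‖) ^ 2`; convexity of `cosh √t` reduces the bound to parallel vectors. -/
theorem cosh_norm_add_le (x v : E) :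
    Real.cosh ‖x + v‖ ≤ Real.cosh ‖x‖ + Real.sinh ‖x‖ / ‖x‖ * inner ℝ x v +
      Real.cosh ‖x‖ * (Real.exp ‖v‖ - 1 - ‖v‖) := by
  obtain ⟨c, hc1, hc2, hc⟩ : ∃ c : ℝ, -1 ≤ c ∧ c ≤ 1 ∧ inner ℝ x v = c * (‖x‖ * ‖v‖) := by
    by_cases h : ‖x‖ * ‖v‖ = 0
    · refine ⟨0, by norm_num, by norm_num, ?_⟩
      have := abs_real_inner_le_norm x v
      rw [h, abs_nonpos_iff] at this
      simpa using this
    · refine ⟨inner ℝ x v / (‖x‖ * ‖v‖), ?_, ?_, (div_mul_cancel₀ _ h).symm⟩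
      · exact (abs_le.1 (abs_real_inner_div_norm_mul_norm_le_one x v)).1
      · exact (abs_le.1 (abs_real_inner_div_norm_mul_norm_le_one x v)).2
  set a := ‖x‖ with ha
  set b := ‖v‖ with hb
  have ha0 : 0 ≤ a := norm_nonneg _
  have hb0 : 0 ≤ b := norm_nonneg _
  have h1 : Real.cosh ‖x + v‖ ≤ (1 + c) / 2 * Real.cosh (a + b) +
      (1 - (1 + c) / 2) * Real.cosh (a - b) := by
    refine cosh_le_of_sq_eq (by linarith) (by linarith) ?_
    rw [norm_add_sq_real, hc]
    ring
  have h2 : Real.sinh a / a * inner ℝ x v = c * (Real.sinh a * b) := by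
    rw [hc]
    by_cases h : a = 0
    · simp [h]
    · field_simp
  rw [h2]
  refine h1.trans ?_
  rw [Real.cosh_add, Real.cosh_sub]
  have h3 : Real.exp b = Real.cosh b + Real.sinh b := (Real.cosh_add_sinh b).symm
  rw [h3]
  have h4 : b ≤ Real.sinh b := Real.self_le_sinh_iff.2 hb0
  have h5 : |c * Real.sinh a| ≤ Real.cosh a := by
    rw [abs_mul, abs_of_nonneg (Real.sinh_nonneg_iff.2 ha0)]
    have := Real.sinh_lt_cosh a
    have := Real.sinh_nonneg_iff.2 ha0
    nlinarith [abs_le.2 ⟨hc1, hc2⟩, abs_nonneg c]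
  nlinarith [mul_nonneg (sub_nonneg.2 h4) (sub_nonneg.2 ((le_abs_self _).trans h5))]

theorem exp_sub_one_sub_le {x : ℝ} (h0 : 0 ≤ x) (h1 : x ≤ 2 / 5) :
    Real.exp x - 1 - x ≤ 3 / 5 * x ^ 2 := by
  have h := Real.exp_bound' h0 (by linarith) (n := 3) (by norm_num)
  norm_num [Finset.sum_range_succ, Nat.factorial] at h
  nlinarith [mul_nonneg (sq_nonneg x) (sub_nonneg.2 h1)]

variable [CompleteSpace E] {Ω : Type*} [MeasurableSpace Ω] {μ : Measure Ω} [IsProbabilityMeasure μ]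

theorem integrable_of_bounded {F α : Type*} [NormedAddCommGroup F] [MeasurableSpace α]
    {ν : Measure α} [IsFiniteMeasure ν] {f : α → F} (hf : StronglyMeasurable f) {C : ℝ}
    (hC : ∀ x, ‖f x‖ ≤ C) : Integrable f ν :=
  Integrable.of_bound hf.aestronglyMeasurable C (Filter.Eventually.of_forall hC)

theorem integral_cosh_norm_add_le {Z : Ω → E} (hZ : StronglyMeasurable Z) {C : ℝ}
    (hC : ∀ ω, ‖Z ω‖ ≤ C) (h0 : ∫ ω, Z ω ∂μ = 0) (x : E) :
    ∫ ω, Real.cosh ‖x + Z ω‖ ∂μ ≤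
      Real.cosh ‖x‖ * (1 + ∫ ω, (Real.exp ‖Z ω‖ - 1 - ‖Z ω‖) ∂μ) := by
  have hZi : Integrable Z μ := integrable_of_bounded hZ hC
  have hei : Integrable (fun ω => Real.exp ‖Z ω‖ - 1 - ‖Z ω‖) μ := by
    refine (Integrable.sub ?_ (integrable_const _)).sub hZi.norm
    refine integrable_of_bounded (C := Real.exp C)
      (Real.continuous_exp.comp_stronglyMeasurable hZ.norm) fun ω => ?_
    rw [Real.norm_eq_abs, abs_of_nonneg (Real.exp_pos _).le]
    exact Real.exp_le_exp.2 (hC ω)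
  have hii : Integrable (fun ω => inner ℝ x (Z ω)) μ := hZi.const_inner x
  have h1 : ∫ ω, Real.cosh ‖x + Z ω‖ ∂μ ≤ ∫ ω, (Real.cosh ‖x‖ +
      Real.sinh ‖x‖ / ‖x‖ * inner ℝ x (Z ω) +
      Real.cosh ‖x‖ * (Real.exp ‖Z ω‖ - 1 - ‖Z ω‖)) ∂μ := by
    refine integral_mono_of_nonneg (Filter.Eventually.of_forall fun ω => (Real.cosh_pos _).le)
      (((integrable_const _).add (hii.const_mul _)).add (hei.const_mul _))
      (Filter.Eventually.of_forall fun ω => cosh_norm_add_le x (Z ω))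
  refine h1.trans_eq ?_
  have hi2 : Integrable (fun ω => Real.cosh ‖x‖ + Real.sinh ‖x‖ / ‖x‖ * inner ℝ x (Z ω)) μ :=
    (integrable_const _).add (hii.const_mul _)
  rw [integral_add hi2 (hei.const_mul _), integral_add (integrable_const _) (hii.const_mul _),
    integral_const_mul, integral_const_mul, integral_inner hZi, h0]
  simp
  ring

/-- Pinelis' exponential moment bound for sums of independent centred random vectors in a Hilbert
space. -/
theorem integral_cosh_norm_sum_le (N : ℕ) (Z : Fin N → Ω → E)
    (hZ : ∀ i, StronglyMeasurable (Z i)) {C : ℝ} (hC : ∀ i ω, ‖Z i ω‖ ≤ C)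
    (h0 : ∀ i, ∫ ω, Z i ω ∂μ = 0) (x : E) :
    ∫ z, Real.cosh ‖x + ∑ i, Z i (z i)‖ ∂(Measure.pi fun _ : Fin N => μ) ≤
      Real.cosh ‖x‖ * ∏ i, (1 + ∫ ω, (Real.exp ‖Z i ω‖ - 1 - ‖Z i ω‖) ∂μ) := by
  induction N generalizing x with
  | zero => simp
  | succ N ih =>
    have hmp := measurePreserving_piFinSuccAbove (fun _ : Fin (N + 1) => μ) 0
    have hmeas : ∀ x : E, StronglyMeasurable
        (fun p : Ω × (Fin N → Ω) => Real.cosh ‖x + (Z 0 p.1 + ∑ i, Z (Fin.succ i) (p.2 i))‖) := by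
      intro x
      refine Real.continuous_cosh.comp_stronglyMeasurable (StronglyMeasurable.norm ?_)
      refine stronglyMeasurable_const.add (((hZ 0).comp_measurable measurable_fst).add ?_)
      refine Finset.stronglyMeasurable_fun_sum _ fun i _ => ?_
      exact (hZ i.succ).comp_measurable ((measurable_pi_apply i).comp measurable_snd)
    have hbd : ∀ (x : E) (p : Ω × (Fin N → Ω)),
        ‖Real.cosh ‖x + (Z 0 p.1 + ∑ i, Z (Fin.succ i) (p.2 i))‖‖ ≤
          Real.cosh (‖x‖ + (C + N * C)) := by
      intro x p
      rw [Real.norm_eq_abs, abs_of_nonneg (Real.cosh_pos _).le, Real.cosh_le_cosh, abs_norm]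
      refine le_trans ?_ (le_abs_self _)
      refine (norm_add_le _ _).trans (add_le_add_right ((norm_add_le _ _).trans
        (add_le_add (hC _ _) ((norm_sum_le _ _).trans ?_))) _)
      refine (Finset.sum_le_sum fun i _ => hC i.succ (p.2 i)).trans ?_
      simp
    have hint : ∀ x : E, Integrable
        (fun p : Ω × (Fin N → Ω) => Real.cosh ‖x + (Z 0 p.1 + ∑ i, Z (Fin.succ i) (p.2 i))‖)
        (μ.prod (Measure.pi fun _ : Fin N => μ)) :=
      fun x => integrable_of_bounded (hmeas x) (hbd x)
    have h1 : ∫ z, Real.cosh ‖x + ∑ i, Z i (z i)‖ ∂(Measure.pi fun _ : Fin (N + 1) => μ) =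
        ∫ p, Real.cosh ‖x + (Z 0 p.1 + ∑ i, Z (Fin.succ i) (p.2 i))‖
          ∂(μ.prod (Measure.pi fun _ : Fin N => μ)) := by
      rw [← hmp.integral_comp' (g := fun p : Ω × (Fin N → Ω) =>
        Real.cosh ‖x + (Z 0 p.1 + ∑ i, Z (Fin.succ i) (p.2 i))‖)]
      refine integral_congr_ae (Filter.Eventually.of_forall fun z => ?_)
      simp only [Fin.sum_univ_succ]
      rfl
    rw [h1, integral_prod _ (hint x), Fin.prod_univ_succ]
    set G := ∏ i : Fin N, (1 + ∫ ω, (Real.exp ‖Z i.succ ω‖ - 1 - ‖Z i.succ ω‖) ∂μ) with hG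
    have hG0 : 0 ≤ G := Finset.prod_nonneg fun i _ => by
      have : 0 ≤ ∫ ω, (Real.exp ‖Z i.succ ω‖ - 1 - ‖Z i.succ ω‖) ∂μ :=
        integral_nonneg fun ω => by
          have := Real.add_one_le_exp ‖Z i.succ ω‖
          simp only [Pi.zero_apply]; linarith
      linarith
    have h2 : ∫ ω, ∫ z, Real.cosh ‖x + (Z 0 ω + ∑ i, Z (Fin.succ i) (z i))‖
        ∂(Measure.pi fun _ : Fin N => μ) ∂μ ≤ ∫ ω, Real.cosh ‖x + Z 0 ω‖ * G ∂μ := by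
      refine integral_mono_of_nonneg (Filter.Eventually.of_forall fun ω =>
        integral_nonneg fun z => (Real.cosh_pos _).le) ?_
        (Filter.Eventually.of_forall fun ω => ?_)
      · refine Integrable.mul_const ?_ _
        refine integrable_of_bounded (C := Real.cosh (‖x‖ + C))
          (Real.continuous_cosh.comp_stronglyMeasurable
            (stronglyMeasurable_const.add (hZ 0)).norm) fun ω => ?_
        rw [Real.norm_eq_abs, abs_of_nonneg (Real.cosh_pos _).le, Real.cosh_le_cosh, abs_norm]
        exact ((norm_add_le _ _).trans (add_le_add_right (hC _ _) _)).trans (le_abs_self _)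
      · have := ih (fun i => Z i.succ) (fun i => hZ _) (fun i => hC _) (fun i => h0 _) (x + Z 0 ω)
        simpa only [add_assoc] using this
    refine h2.trans ?_
    rw [integral_mul_const, ← mul_assoc]
    exact mul_le_mul_of_nonneg_right (integral_cosh_norm_add_le (hZ 0) (hC 0) (h0 0) x) hG0

/-- Bernstein's inequality for the mean of the first `n` of `N` independent copies of a bounded
random vector in a Hilbert space, in the range where the variance term dominates. -/
theorem measure_norm_average_sub_ge_le {ξ : Ω → E} (hξ : StronglyMeasurable ξ) {R V t : ℝ}
    (hR : ∀ ω, ‖ξ ω‖ ≤ R) (hV : ∫ ω, ‖ξ ω‖ ^ 2 ∂μ ≤ V) (hV0 : 0 < V) (ht : 0 ≤ t)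
    (hRt : R * t ≤ V / 5) {n N : ℕ} (hn : 0 < n) (hnN : n ≤ N) :
    Measure.pi (fun _ : Fin N => μ)
      {z | t ≤ ‖(1 / (n : ℝ)) • ∑ i : Fin N, (if (i : ℕ) < n then ξ (z i) else 0) - ∫ ω, ξ ω ∂μ‖} ≤
      ENNReal.ofReal (2 * Real.exp (-(5 / 12 * (n * t ^ 2 / V)))) := by
  set m := ∫ ω, ξ ω ∂μ with hm
  have hξi : Integrable ξ μ := integrable_of_bounded hξ hR
  have hmR : ‖m‖ ≤ R := by
    have := norm_integral_le_of_norm_le_const (μ := μ) (Filter.Eventually.of_forall hR)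
    simpa using this
  -- `s` minimizes the exponent `n (3 / 5 s² V) - s n t`.
  set s := t / (6 / 5 * V) with hs
  have hs0 : 0 ≤ s := by positivity
  let Z : Fin N → Ω → E := fun i ω => if (i : ℕ) < n then s • (ξ ω - m) else 0
  have hZm : ∀ i, StronglyMeasurable (Z i) := fun i => by
    by_cases h : (i : ℕ) < n
    · simp only [Z, h, if_true]
      exact (hξ.sub stronglyMeasurable_const).const_smul s
    · simpa [Z, h] using stronglyMeasurable_const
  have hsR : s * (2 * R) ≤ 1 / 3 := by
    rw [hs, div_mul_eq_mul_div, div_le_iff₀ (by positivity)]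
    linarith
  have hdiff : ∀ ω, ‖s • (ξ ω - m)‖ ≤ 1 / 3 := fun ω => by
    rw [norm_smul, Real.norm_eq_abs, abs_of_nonneg hs0]
    refine le_trans (mul_le_mul_of_nonneg_left ?_ hs0) hsR
    linarith [norm_sub_le (ξ ω) m, hR ω]
  have hZb : ∀ i ω, ‖Z i ω‖ ≤ 1 / 3 := fun i ω => by
    by_cases h : (i : ℕ) < n
    · simp only [Z, h, if_true]; exact hdiff ω
    · simp [Z, h]
  have hZ0 : ∀ i, ∫ ω, Z i ω ∂μ = 0 := fun i => by
    by_cases h : (i : ℕ) < n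
    · simp only [Z, h, if_true]
      rw [integral_smul, integral_sub hξi (integrable_const _)]
      simp [hm]
    · simp [Z, h]
  have hsq : Integrable (fun ω => ‖ξ ω‖ ^ 2) μ := by
    refine integrable_of_bounded (C := R ^ 2) (hξ.norm.pow 2) fun ω => ?_
    rw [norm_pow, norm_norm]
    exact pow_le_pow_left₀ (norm_nonneg _) (hR ω) 2
  have hvar : ∫ ω, ‖ξ ω - m‖ ^ 2 ∂μ ≤ V := by
    have h1 : ∀ ω, ‖ξ ω - m‖ ^ 2 = ‖ξ ω‖ ^ 2 - 2 * inner ℝ m (ξ ω) + ‖m‖ ^ 2 := fun ω => by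
      rw [norm_sub_sq_real, real_inner_comm]
    simp_rw [h1]
    have hii : Integrable (fun ω => 2 * inner ℝ m (ξ ω)) μ := (hξi.const_inner m).const_mul 2
    have hi2 : Integrable (fun ω => ‖ξ ω‖ ^ 2 - 2 * inner ℝ m (ξ ω)) μ := hsq.sub hii
    rw [integral_add hi2 (integrable_const _), integral_sub hsq hii,
      integral_const_mul, integral_inner hξi, ← hm, real_inner_self_eq_norm_sq]
    simp
    nlinarith [sq_nonneg ‖m‖]
  have hdm : StronglyMeasurable fun ω => ξ ω - m := hξ.sub stronglyMeasurable_const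
  have hmom : ∀ i, ∫ ω, (Real.exp ‖Z i ω‖ - 1 - ‖Z i ω‖) ∂μ ≤
      if (i : ℕ) < n then 3 / 5 * s ^ 2 * V else 0 := fun i => by
    by_cases h : (i : ℕ) < n
    · simp only [Z, h, if_true]
      have hi : Integrable (fun ω => 3 / 5 * ‖s • (ξ ω - m)‖ ^ 2) μ := by
        refine Integrable.const_mul ?_ _
        refine integrable_of_bounded (C := (1 / 3) ^ 2) ((hdm.const_smul s).norm.pow 2)
          fun ω => ?_
        rw [norm_pow, norm_norm]
        exact pow_le_pow_left₀ (norm_nonneg _) (hdiff ω) 2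
      have h1 : ∫ ω, (Real.exp ‖s • (ξ ω - m)‖ - 1 - ‖s • (ξ ω - m)‖) ∂μ ≤
          ∫ ω, 3 / 5 * ‖s • (ξ ω - m)‖ ^ 2 ∂μ := by
        refine integral_mono_of_nonneg (Filter.Eventually.of_forall fun ω => ?_) hi
          (Filter.Eventually.of_forall fun ω => ?_)
        · have := Real.add_one_le_exp ‖s • (ξ ω - m)‖
          simp only [Pi.zero_apply]; linarith
        · exact exp_sub_one_sub_le (norm_nonneg _) ((hdiff ω).trans (by norm_num))
      refine h1.trans ?_
      simp_rw [norm_smul, mul_pow, Real.norm_eq_abs, sq_abs]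
      rw [integral_const_mul, integral_const_mul, mul_assoc]
      gcongr
    · simp [Z, h]
  have hprod : ∏ i, (1 + ∫ ω, (Real.exp ‖Z i ω‖ - 1 - ‖Z i ω‖) ∂μ) ≤
      Real.exp (n * (3 / 5 * s ^ 2 * V)) := by
    have h1 : ∏ i, (1 + ∫ ω, (Real.exp ‖Z i ω‖ - 1 - ‖Z i ω‖) ∂μ) ≤
        ∏ i : Fin N, Real.exp (if (i : ℕ) < n then 3 / 5 * s ^ 2 * V else 0) := by
      refine Finset.prod_le_prod (fun i _ => ?_) fun i _ => ?_
      · have : 0 ≤ ∫ ω, (Real.exp ‖Z i ω‖ - 1 - ‖Z i ω‖) ∂μ := integral_nonneg fun ω => by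
          have := Real.add_one_le_exp ‖Z i ω‖
          simp only [Pi.zero_apply]; linarith
        linarith
      · have := Real.add_one_le_exp (if (i : ℕ) < n then 3 / 5 * s ^ 2 * V else 0)
        linarith [hmom i]
    refine h1.trans_eq ?_
    rw [← Real.exp_sum, Finset.sum_ite, Finset.sum_const, Finset.sum_const_zero, add_zero,
      nsmul_eq_mul]
    congr 3
    have := Fin.card_filter_val_lt (n := N) (m := n)
    rw [this, min_eq_right hnN]
  have hpin := (integral_cosh_norm_sum_le N Z hZm hZb hZ0 0).trans
    (mul_le_mul_of_nonneg_left hprod (Real.cosh_pos _).le)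
  simp only [norm_zero, Real.cosh_zero, one_mul, zero_add] at hpin
  have hn0 : (0 : ℝ) < n := by exact_mod_cast hn
  have hsum : ∀ z : Fin N → Ω, ∑ i, Z i (z i) = (s * n) •
      ((1 / (n : ℝ)) • ∑ i : Fin N, (if (i : ℕ) < n then ξ (z i) else 0) - m) := fun z => by
    have h1 : ∑ i : Fin N, (if (i : ℕ) < n then m else 0) = (n : ℝ) • m := by
      rw [Finset.sum_ite, Finset.sum_const, Finset.sum_const_zero, add_zero,
        Fin.card_filter_val_lt (n := N) (m := n), min_eq_right hnN, Nat.cast_smul_eq_nsmul]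
    have h2 : ∀ i : Fin N, Z i (z i) =
        s • ((if (i : ℕ) < n then ξ (z i) else 0) - (if (i : ℕ) < n then m else 0)) := fun i => by
      by_cases h : (i : ℕ) < n <;> simp [Z, h]
    simp_rw [h2]
    rw [← Finset.smul_sum, Finset.sum_sub_distrib, h1, smul_sub, smul_sub, smul_smul, smul_smul]
    congr 2
    field_simp
  have hint : Integrable (fun z : Fin N → Ω => Real.cosh ‖∑ i, Z i (z i)‖)
      (Measure.pi fun _ : Fin N => μ) := by
    refine integrable_of_bounded (C := Real.cosh (N * (1 / 3))) ?_ fun z => ?_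
    · refine Real.continuous_cosh.comp_stronglyMeasurable (StronglyMeasurable.norm ?_)
      refine Finset.stronglyMeasurable_fun_sum _ fun i _ => ?_
      exact (hZm i).comp_measurable (measurable_pi_apply i)
    · rw [Real.norm_eq_abs, abs_of_nonneg (Real.cosh_pos _).le, Real.cosh_le_cosh, abs_norm]
      refine le_trans ((norm_sum_le _ _).trans ?_) (le_abs_self _)
      refine (Finset.sum_le_sum fun i _ => hZb i (z i)).trans ?_
      simp
  have hmarkov := mul_meas_ge_le_integral_of_nonneg
    (Filter.Eventually.of_forall fun z => (Real.cosh_pos _).le) hint (Real.exp (s * n * t) / 2)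
  have hsub : {z : Fin N → Ω | t ≤
      ‖(1 / (n : ℝ)) • ∑ i : Fin N, (if (i : ℕ) < n then ξ (z i) else 0) - m‖} ⊆
      {z | Real.exp (s * n * t) / 2 ≤ Real.cosh ‖∑ i, Z i (z i)‖} := fun z hz => by
    simp only [Set.mem_ofPred_eq] at hz ⊢
    rw [hsum, norm_smul, Real.norm_eq_abs, abs_of_nonneg (by positivity : 0 ≤ s * n), Real.cosh_eq]
    have h1 := Real.exp_le_exp.2 (mul_le_mul_of_nonneg_left hz (by positivity : 0 ≤ s * n))
    have h2 := Real.exp_pos (-(s * n * ‖(1 / (n : ℝ)) • ∑ i : Fin N,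
      (if (i : ℕ) < n then ξ (z i) else 0) - m‖))
    linarith
  refine (measure_mono hsub).trans ?_
  rw [← ofReal_measureReal]
  refine ENNReal.ofReal_le_ofReal ?_
  have h3 := hmarkov.trans hpin
  have h4 : -(5 / 12 * (n * t ^ 2 / V)) = n * (3 / 5 * s ^ 2 * V) - s * n * t := by
    rw [hs]; field_simp; ring
  rw [h4, Real.exp_sub, mul_div_assoc', le_div_iff₀ (Real.exp_pos _)]
  linarith

end Concentration


/-! ### The feature map of the reproducing kernel Hilbert space -/

section Features

variable {X : Type*} (H : Type*) [NormedAddCommGroup H] [InnerProductSpace ℝ H]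
  [CompleteSpace H] [RKHS ℝ H X ℝ]

/-- The feature map `x ↦ k(x, ·)` of the reproducing kernel Hilbert space `H`. -/
noncomputable def feat (x : X) : H := RKHS.kerFun H x (1 : ℝ)

variable {H}

theorem inner_feat (x : X) (h : H) : inner ℝ (feat H x) h = h x := by
  simp [feat]

theorem inner_feat' (x : X) (h : H) : inner ℝ h (feat H x) = h x := by
  rw [real_inner_comm, inner_feat]

theorem ker_eq_inner_feat (x y : X) : ker H x y = inner ℝ (feat H x) (feat H y) := by
  rw [ker_eq_inner, real_inner_comm]
  rfl

theorem norm_feat_sq_le {κ : ℝ} (hb : ∀ x : X, ker H x x ≤ κ) (x : X) : ‖feat H x‖ ^ 2 ≤ κ := by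
  rw [← real_inner_self_eq_norm_sq, ← ker_eq_inner_feat]
  exact hb x

theorem norm_feat_le {κ : ℝ} (hb : ∀ x : X, ker H x x ≤ κ) (x : X) :
    ‖feat H x‖ ≤ Real.sqrt κ :=
  Real.le_sqrt_of_sq_le (norm_feat_sq_le hb x)

theorem abs_apply_le {κ : ℝ} (hb : ∀ x : X, ker H x x ≤ κ) (h : H) (x : X) :
    |h x| ≤ Real.sqrt κ * ‖h‖ := by
  rw [← inner_feat]
  exact (abs_real_inner_le_norm _ _).trans
    (mul_le_mul_of_nonneg_right (norm_feat_le hb x) (norm_nonneg _))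

variable [MeasurableSpace X]

theorem measurable_apply (hk : Measurable (Function.uncurry (ker (X := X) H))) (h : H) :
    Measurable (h : X → ℝ) := by
  have hspan : ∀ g ∈ Submodule.span ℝ {RKHS.kerFun H x v | (x : X) (v : ℝ)},
      Measurable (g : X → ℝ) := by
    intro g hg
    induction hg using Submodule.span_induction with
    | mem g hg =>
      obtain ⟨x, v, rfl⟩ := hg
      have h1 : ((RKHS.kerFun H x v : H) : X → ℝ) = fun y => v * ker H y x := by
        funext y
        have h2 : RKHS.kerFun H x v = v • feat H x := by
          rw [feat, ← map_smul, smul_eq_mul, mul_one]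
        rw [h2, ker_eq_inner_feat, inner_feat, RKHS.coe_smul]
        rfl
      rw [h1]
      exact (hk.comp (measurable_id.prodMk measurable_const)).const_mul v
    | zero => rw [RKHS.coe_zero]; exact measurable_zero
    | add f g _ _ hf hg => rw [RKHS.coe_add]; exact hf.add hg
    | smul c f _ hf => rw [RKHS.coe_smul]; exact hf.const_smul c
  have hmem : h ∈ (Submodule.span ℝ {RKHS.kerFun H x v | (x : X) (v : ℝ)}).topologicalClosure := by
    rw [RKHS.kerFun_dense]; trivial
  obtain ⟨u, hu, hlim⟩ := mem_closure_iff_seq_limit.1 hmem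
  refine measurable_of_tendsto_metrizable (fun n => hspan _ (hu n)) (tendsto_pi_nhds.2 fun x => ?_)
  exact ((RKHS.continuous_eval x).tendsto h).comp hlim

theorem countable_of_hilbertBasis {E ι : Type*} [NormedAddCommGroup E] [InnerProductSpace ℝ E]
    [TopologicalSpace.SeparableSpace E] (e : HilbertBasis ι ℝ E) : Countable ι := by
  refine Pairwise.countable_of_isOpen_disjoint (s := fun i => Metric.ball (e i) (1 / 2))
    (fun i j hij => ?_) (fun i => Metric.isOpen_ball)
    fun i => ⟨e i, Metric.mem_ball_self (by norm_num)⟩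
  refine Metric.ball_disjoint_ball ?_
  have h1 : dist (e i) (e j) ^ 2 = 2 := by
    rw [dist_eq_norm, norm_sub_sq_real, e.orthonormal.1 i, e.orthonormal.1 j, e.orthonormal.2 hij]
    norm_num
  nlinarith [dist_nonneg (x := e i) (y := e j)]

theorem stronglyMeasurable_feat [TopologicalSpace.SeparableSpace H]
    (hk : Measurable (Function.uncurry (ker (X := X) H))) :
    StronglyMeasurable (feat H : X → H) := by
  obtain ⟨w, e, -⟩ := exists_hilbertBasis ℝ H
  have := countable_of_hilbertBasis e
  refine stronglyMeasurable_of_tendsto (Filter.atTop : Filter (Finset w))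
    (f := fun s x => ∑ i ∈ s, e.repr (feat H x) i • e i) (fun s => ?_)
    (tendsto_pi_nhds.2 fun x => e.hasSum_repr (feat H x))
  refine Finset.stronglyMeasurable_fun_sum _ fun i _ => ?_
  simp_rw [HilbertBasis.repr_apply_apply, inner_feat']
  exact (measurable_apply hk (e i)).stronglyMeasurable.smul_const _

end Features

/-! ### The inclusion of the reproducing kernel Hilbert space into `L²` -/

section Inclusion

variable {X : Type*} [MeasurableSpace X] (H : Type*) [NormedAddCommGroup H]
  [InnerProductSpace ℝ H] [CompleteSpace H] [RKHS ℝ H X ℝ]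

theorem memLp_apply {κ : ℝ} (hk : Measurable (Function.uncurry (ker (X := X) H)))
    (hb : ∀ x : X, ker H x x ≤ κ) (ν : Measure X) [IsProbabilityMeasure ν] (h : H) :
    MemLp (h : X → ℝ) 2 ν :=
  MemLp.of_bound (measurable_apply hk h).aestronglyMeasurable (Real.sqrt κ * ‖h‖)
    (Filter.Eventually.of_forall fun x => abs_apply_le hb h x)

/-- The inclusion of the reproducing kernel Hilbert space `H` into `L²(ν)`. -/
noncomputable def inclusion {κ : ℝ} (hk : Measurable (Function.uncurry (ker (X := X) H)))
    (hb : ∀ x : X, ker H x x ≤ κ) (ν : Measure X) [IsProbabilityMeasure ν] :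
    H →L[ℝ] Lp ℝ 2 ν :=
  LinearMap.mkContinuous
    { toFun := fun h => (memLp_apply H hk hb ν h).toLp
      map_add' := fun f g => by
        rw [← MemLp.toLp_add]
        exact MemLp.toLp_congr _ _ (by rw [RKHS.coe_add])
      map_smul' := fun a g => by
        rw [RingHom.id_apply, ← MemLp.toLp_const_smul]
        exact MemLp.toLp_congr _ _ (by rw [RKHS.coe_smul]) }
    (Real.sqrt κ) fun h => by
      refine (Lp.norm_le_of_ae_bound (C := Real.sqrt κ * ‖h‖) (by positivity) ?_).trans
        (by simp [measureUnivNNReal])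
      filter_upwards [(memLp_apply H hk hb ν h).coeFn_toLp] with y hy
      simp only [LinearMap.coe_mk, AddHom.coe_mk]
      rw [hy]
      exact abs_apply_le hb h y

variable {H} {κ : ℝ} (hk : Measurable (Function.uncurry (ker (X := X) H)))
    (hb : ∀ x : X, ker H x x ≤ κ) (ν : Measure X) [IsProbabilityMeasure ν]

theorem inclusion_ae_eq (h : H) : inclusion H hk hb ν h =ᵐ[ν] h :=
  (memLp_apply H hk hb ν h).coeFn_toLp

theorem norm_inclusion_le (h : H) : ‖inclusion H hk hb ν h‖ ≤ Real.sqrt κ * ‖h‖ :=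
  LinearMap.mkContinuous_norm_le' _ _ |> fun hle =>
    (ContinuousLinearMap.le_opNorm _ h).trans
      (by
        refine mul_le_mul_of_nonneg_right (hle.trans ?_) (norm_nonneg _)
        exact (max_eq_left (Real.sqrt_nonneg κ)).le)

theorem inner_inclusion (g : Lp ℝ 2 ν) (h : H) :
    inner ℝ g (inclusion H hk hb ν h) = ∫ x, g x * h x ∂ν := by
  rw [L2.inner_def]
  refine integral_congr_ae ?_
  filter_upwards [inclusion_ae_eq hk hb ν h] with x hx
  rw [hx]
  simp [mul_comm]

theorem inner_inclusion_inclusion (h h' : H) :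
    inner ℝ (inclusion H hk hb ν h) (inclusion H hk hb ν h') = ∫ x, h x * h' x ∂ν := by
  rw [inner_inclusion]
  refine integral_congr_ae ?_
  filter_upwards [inclusion_ae_eq hk hb ν h] with x hx
  rw [hx]

open ContinuousLinearMap in
theorem inclusion_adjoint (g : Lp ℝ 2 ν) :
    inclusion H hk hb ν (adjoint (inclusion H hk hb ν) g) = kernelOp H hk hb ν g := by
  refine Lp.ext ?_
  filter_upwards [inclusion_ae_eq hk hb ν (adjoint (inclusion H hk hb ν) g),
    kernelOp_ae_eq H hk hb ν g] with y h1 h2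
  rw [h1, h2, ← inner_feat', adjoint_inner_left, inner_inclusion]
  refine integral_congr_ae (Filter.Eventually.of_forall fun x => ?_)
  simp only
  rw [ker_eq_inner_feat, inner_feat', mul_comm]

end Inclusion

/-! ### The empirical covariance operator -/

section Empirical

variable {X : Type*} (H : Type*) [NormedAddCommGroup H]
  [InnerProductSpace ℝ H] [CompleteSpace H] [RKHS ℝ H X ℝ] {N : ℕ}

/-- The kernel expansion `(1/N) ∑ i, α i k(x i, ·)` as an element of `H`. -/
noncomputable def synth (x : Fin N → X) : (Fin N → ℝ) →ₗ[ℝ] H where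
  toFun α := (1 / (N : ℝ)) • ∑ i, α i • feat H (x i)
  map_add' α β := by
    simp only [Pi.add_apply, add_smul, Finset.sum_add_distrib, smul_add]
  map_smul' c α := by
    simp only [Pi.smul_apply, smul_eq_mul, mul_smul, ← Finset.smul_sum, RingHom.id_apply]
    rw [smul_comm]

/-- The empirical covariance operator `h ↦ (1/N) ∑ i, h(x i) k(x i, ·)`. -/
noncomputable def empOp (x : Fin N → X) : H →L[ℝ] H :=
  (1 / (N : ℝ)) • ∑ i, (innerSL ℝ (feat H (x i))).smulRight (feat H (x i))

variable {H}

theorem synth_apply (x : Fin N → X) (α : Fin N → ℝ) :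
    synth H x α = (1 / (N : ℝ)) • ∑ i, α i • feat H (x i) := rfl

theorem empOp_apply (x : Fin N → X) (h : H) : empOp H x h = synth H x fun i => h (x i) := by
  simp [empOp, synth_apply, inner_feat]

theorem inner_synth (x : Fin N → X) (α : Fin N → ℝ) (h : H) :
    inner ℝ (synth H x α) h = (1 / (N : ℝ)) * ∑ i, α i * h (x i) := by
  simp [synth_apply, real_inner_smul_left, sum_inner, inner_feat]

theorem inner_empOp (x : Fin N → X) (h h' : H) :
    inner ℝ (empOp H x h) h' = (1 / (N : ℝ)) * ∑ i, h (x i) * h' (x i) := by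
  rw [empOp_apply, inner_synth]

theorem empOp_symm (x : Fin N → X) (h h' : H) :
    inner ℝ (empOp H x h) h' = inner ℝ h (empOp H x h') := by
  rw [inner_empOp, real_inner_comm, inner_empOp]
  congr 1
  exact Finset.sum_congr rfl fun i _ => mul_comm _ _

theorem synth_coe (x : Fin N → X) (α : Fin N → ℝ) : ⇑(synth H x α) = expansion H x α := by
  funext t
  rw [← inner_feat', inner_synth, expansion]
  congr 1
  refine Finset.sum_congr rfl fun i _ => ?_
  rw [ker_eq_inner_feat, inner_feat]

theorem gram_mulVec (x : Fin N → X) (α : Fin N → ℝ) :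
    gram H x *ᵥ α = fun i => (synth H x α) (x i) := by
  funext i
  rw [synth_coe, expansion, Matrix.mulVec, dotProduct, Finset.mul_sum]
  refine Finset.sum_congr rfl fun j _ => ?_
  rw [gram, Matrix.of_apply, ker_eq_inner_feat, ker_eq_inner_feat, real_inner_comm]
  ring

theorem synth_gram (x : Fin N → X) (α : Fin N → ℝ) :
    synth H x (gram H x *ᵥ α) = empOp H x (synth H x α) := by
  rw [gram_mulVec, empOp_apply]

theorem synth_gram_pow (x : Fin N → X) (α : Fin N → ℝ) (j : ℕ) :
    synth H x ((gram H x ^ j) *ᵥ α) = (empOp H x ^ j) (synth H x α) := by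
  induction j with
  | zero => simp
  | succ j ih =>
    rw [pow_succ', ← Matrix.mulVec_mulVec, synth_gram, ih, pow_succ', mul_apply_eq_comp]

theorem matNorm_gram_eq (x : Fin N → X) (α : Fin N → ℝ) :
    matNorm (gram H x) α = ‖synth H x α‖ := by
  rw [matNorm_gram]; rfl

/-- Under the kernel expansion, the Krylov space of the kernel matrix becomes the space of the
vectors `q(A) b` with polynomials `q` of degree less than `m`. -/
theorem exists_polynomial_of_mem_krylov (x : Fin N → X) (y : Fin N → ℝ) (m : ℕ) {α : Fin N → ℝ}
    (hα : α ∈ krylov (gram H x) y m) :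
    ∃ q ∈ Polynomial.degreeLT ℝ m,
      synth H x α = Polynomial.aeval (empOp H x) q (synth H x y) := by
  induction hα using Submodule.span_induction with
  | mem v hv =>
    obtain ⟨j, hj, rfl⟩ := hv
    refine ⟨Polynomial.X ^ j, ?_, ?_⟩
    · rw [Polynomial.mem_degreeLT, Polynomial.degree_X_pow]
      exact_mod_cast hj
    · rw [synth_gram_pow]; simp
  | zero => exact ⟨0, zero_mem _, by simp⟩
  | add a b _ _ ha hb =>
    obtain ⟨p, hp, hp'⟩ := ha
    obtain ⟨q, hq, hq'⟩ := hb
    exact ⟨p + q, add_mem hp hq, by rw [map_add, hp', hq', map_add]; rfl⟩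
  | smul c a _ ha =>
    obtain ⟨p, hp, hp'⟩ := ha
    exact ⟨c • p, Submodule.smul_mem _ c hp, by rw [map_smul, hp', map_smul]; rfl⟩

theorem exists_mem_krylov_of_polynomial (x : Fin N → X) (y : Fin N → ℝ) (m : ℕ)
    {q : Polynomial ℝ} (hq : q ∈ Polynomial.degreeLT ℝ m) :
    ∃ α ∈ krylov (gram H x) y m,
      synth H x α = Polynomial.aeval (empOp H x) q (synth H x y) := by
  rw [Polynomial.degreeLT_eq_span_X_pow] at hq
  induction hq using Submodule.span_induction with
  | mem v hv =>
    obtain ⟨j, hj, rfl⟩ := by simpa using hv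
    exact ⟨(gram H x ^ j) *ᵥ y, Submodule.subset_span ⟨j, hj, rfl⟩, by rw [synth_gram_pow]; simp⟩
  | zero => exact ⟨0, zero_mem _, by simp⟩
  | add a b _ _ ha hb =>
    obtain ⟨p, hp, hp'⟩ := ha
    obtain ⟨q, hq, hq'⟩ := hb
    exact ⟨p + q, add_mem hp hq, by rw [map_add, hp', hq', map_add]; rfl⟩
  | smul c a _ ha =>
    obtain ⟨p, hp, hp'⟩ := ha
    exact ⟨c • p, Submodule.smul_mem _ c hp, by rw [map_smul, hp', map_smul]; rfl⟩

open ContinuousLinearMap in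
/-- The empirical covariance operator is diagonal in a Hilbert basis, with finitely many nonzero
eigenvalues. -/
theorem exists_eigenbasis_empOp (x : Fin N → X) :
    ∃ (w : Set H) (e : HilbertBasis w ℝ H) (a : w → ℝ),
      (∀ i, empOp H x (e i) = a i • e i) ∧ {i | a i ≠ 0}.Finite := by
  let T : EuclideanSpace ℝ (Fin N) →L[ℝ] H :=
    LinearMap.toContinuousLinearMap
      ((Real.sqrt N • synth H x) ∘ₗ (WithLp.linearEquiv 2 ℝ (Fin N → ℝ)).toLinearMap)
  have hT : ∀ α, T α = Real.sqrt N • synth H x (WithLp.ofLp α) := fun α => rfl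
  have hTa : ∀ h : H, adjoint T h = WithLp.toLp 2 fun i => (Real.sqrt N / N) * h (x i) := by
    intro h
    refine ext_inner_left ℝ fun v => ?_
    rw [adjoint_inner_right, hT, real_inner_smul_left, inner_synth]
    simp only [PiLp.inner_apply, RCLike.inner_apply, conj_trivial]
    rw [Finset.mul_sum, Finset.mul_sum]
    refine Finset.sum_congr rfl fun i _ => ?_
    ring
  have hTT : ∀ h : H, T (adjoint T h) = empOp H x h := by
    intro h
    rw [hT, hTa, empOp_apply]
    have h1 : (fun i => (Real.sqrt N / N) * h (x i)) = (Real.sqrt N / N) • fun i => h (x i) := rfl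
    simp only
    rw [h1, map_smul, smul_smul]
    rcases Nat.eq_zero_or_pos N with h0 | h0
    · subst h0; simp [synth_apply]
    · rw [mul_div_assoc', Real.mul_self_sqrt (Nat.cast_nonneg N), div_self (by positivity),
        one_smul]
  have hsym : (adjoint T ∘L T : EuclideanSpace ℝ (Fin N) →L[ℝ] _).toLinearMap.IsSymmetric :=
    fun u v => by
      simp [adjoint_inner_left, adjoint_inner_right]
  obtain ⟨w, e, a, he⟩ := exists_hilbertBasis_eigen
    (hsym.eigenvectorBasis (finrank_euclideanSpace_fin (𝕜 := ℝ))).toHilbertBasis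
    (hsym.eigenvalues (finrank_euclideanSpace_fin (𝕜 := ℝ))) T
    (fun i => by
      rw [OrthonormalBasis.coe_toHilbertBasis]
      exact hsym.apply_eigenvectorBasis (finrank_euclideanSpace_fin (𝕜 := ℝ)) i)
  exact ⟨w, e, a, fun i => by rw [← hTT, he], finite_eigen_ne_zero e a T he⟩

end Empirical


/-! ### Residual polynomials of the conjugate gradient iteration -/

section ResidualPolynomial

open Polynomial

variable {ι : Type*} {t : Finset ι} {a c : ι → ℝ} {m : ℕ} {r : ℝ[X]}

/-- Orthogonality of the minimal residual polynomial, the first-order condition of optimality. -/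
theorem sum_residual_mul_eq_zero (hr0 : r.eval 0 = 1) (hrm : r.natDegree ≤ m)
    (hmin : ∀ p : ℝ[X], p.natDegree ≤ m → p.eval 0 = 1 →
      ∑ i ∈ t, c i * r.eval (a i) ^ 2 ≤ ∑ i ∈ t, c i * p.eval (a i) ^ 2)
    {p : ℝ[X]} (hp : p.natDegree < m) :
    ∑ i ∈ t, c i * (a i * r.eval (a i) * p.eval (a i)) = 0 := by
  set B := ∑ i ∈ t, c i * (a i * r.eval (a i) * p.eval (a i)) with hB
  set G := ∑ i ∈ t, c i * (a i * p.eval (a i)) ^ 2 with hG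
  have h1 : ∀ u : ℝ, 0 ≤ G * (u * u) + (2 * B) * u + 0 := fun u => by
    have h2 := hmin (r + C u * (X * p)) ?_ ?_
    · have h3 : ∑ i ∈ t, c i * (r + C u * (X * p)).eval (a i) ^ 2 =
          ∑ i ∈ t, c i * r.eval (a i) ^ 2 + (2 * B) * u + G * (u * u) := by
        rw [hB, hG, Finset.mul_sum, Finset.sum_mul, Finset.sum_mul, ← Finset.sum_add_distrib,
          ← Finset.sum_add_distrib]
        refine Finset.sum_congr rfl fun i _ => ?_
        simp only [eval_add, eval_mul, eval_C, eval_X]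
        ring
      linarith
    · refine (natDegree_add_le _ _).trans (max_le hrm ?_)
      refine (natDegree_C_mul_le _ _).trans (natDegree_mul_le.trans ?_)
      have := natDegree_X_le (R := ℝ)
      omega
    · simp [hr0]
  have h2 := discrim_le_zero h1
  rw [discrim] at h2
  nlinarith [sq_nonneg B]

/-- A factor of the minimal residual polynomial that keeps its sign on `[0, ∞)` would allow to
lower the degree without changing the residual. -/
theorem false_of_factor (ha : ∀ i ∈ t, 0 < a i) (hc : ∀ i ∈ t, 0 ≤ c i)
    (hr0 : r.eval 0 = 1) (hrm : r.natDegree ≤ m)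
    (hmin : ∀ p : ℝ[X], p.natDegree ≤ m → p.eval 0 = 1 →
      ∑ i ∈ t, c i * r.eval (a i) ^ 2 ≤ ∑ i ∈ t, c i * p.eval (a i) ^ 2)
    (hres : ∀ p : ℝ[X], p.natDegree < m → p.eval 0 = 1 → 0 < ∑ i ∈ t, c i * p.eval (a i) ^ 2)
    {s p : ℝ[X]} (hsp : r = s * p) (hp : p.natDegree < m)
    (hs : ∀ x, 0 < x → 0 < s.eval 0 * s.eval x) : False := by
  have h1 := sum_residual_mul_eq_zero hr0 hrm hmin hp
  have h0 : s.eval 0 * p.eval 0 = 1 := by rw [← eval_mul, ← hsp, hr0]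
  have hp0 : p.eval 0 ≠ 0 := fun h => by simp [h] at h0
  have h2 : ∑ i ∈ t, c i * (a i * (s.eval 0 * s.eval (a i)) * p.eval (a i) ^ 2) = 0 := by
    refine Eq.trans ?_ ((congrArg (s.eval 0 * ·) h1).trans (mul_zero _))
    simp only [Finset.mul_sum]
    refine Finset.sum_congr rfl fun i _ => ?_
    rw [hsp, eval_mul]; ring
  have hpos : ∀ i ∈ t, 0 < a i * (s.eval 0 * s.eval (a i)) := fun i hi =>
    mul_pos (ha i hi) (hs _ (ha i hi))
  have h3 := (Finset.sum_eq_zero_iff_of_nonneg fun i hi =>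
    mul_nonneg (hc i hi) (mul_nonneg (hpos i hi).le (sq_nonneg _))).1 h2
  have h4 := hres (C (p.eval 0)⁻¹ * p) ((natDegree_C_mul_le _ _).trans_lt hp) (by simp [hp0])
  refine h4.ne' (Finset.sum_eq_zero fun i hi => ?_)
  have h5 := h3 i hi
  rw [← mul_assoc, mul_comm (c i), mul_assoc] at h5
  have h6 := (mul_eq_zero.1 h5).resolve_left (hpos i hi).ne'
  rw [eval_mul, eval_C, mul_pow, mul_left_comm, h6, mul_zero]

/-- As long as the previous residual does not vanish, the minimal residual polynomial is the product
of the factors `1 - x / z` over its roots `z`, and all these roots are positive. -/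
theorem exists_roots_residual (hm : 0 < m) (ha : ∀ i ∈ t, 0 < a i) (hc : ∀ i ∈ t, 0 ≤ c i)
    (hr0 : r.eval 0 = 1) (hrm : r.natDegree ≤ m)
    (hmin : ∀ p : ℝ[X], p.natDegree ≤ m → p.eval 0 = 1 →
      ∑ i ∈ t, c i * r.eval (a i) ^ 2 ≤ ∑ i ∈ t, c i * p.eval (a i) ^ 2)
    (hres : ∀ p : ℝ[X], p.natDegree < m → p.eval 0 = 1 → 0 < ∑ i ∈ t, c i * p.eval (a i) ^ 2) :
    ∃ Z : Multiset ℝ, (∀ z ∈ Z, 0 < z) ∧ Z ≠ 0 ∧ Z.card ≤ m ∧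
      r = (Z.map fun z => 1 - C z⁻¹ * X).prod := by
  have hfalse : ∀ {s p : ℝ[X]}, r = s * p → p.natDegree < m →
      (∀ x, 0 < x → 0 < s.eval 0 * s.eval x) → False :=
    fun h1 h2 h3 => false_of_factor ha hc hr0 hrm hmin hres h1 h2 h3
  have hrne : r ≠ 0 := fun h => by simp [h] at hr0
  obtain ⟨q, hq, hdeg, hqr⟩ := exists_prod_multiset_X_sub_C_mul r
  have hqne : q ≠ 0 := fun h => by rw [h, mul_zero] at hq; exact hrne hq.symm
  have hqd : q.natDegree = 0 := by
    by_contra hd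
    refine hfalse (s := q) (p := (r.roots.map fun a => X - C a).prod) (by rw [mul_comm, hq]) ?_ ?_
    · rw [natDegree_multiset_prod_X_sub_C_eq_card]; omega
    · intro x hx
      have hroot : ∀ y, q.eval y ≠ 0 := fun y hy => by
        have : y ∈ q.roots := (mem_roots hqne).2 hy
        simp [hqr] at this
      by_contra hneg
      push Not at hneg
      have hcont : ContinuousOn (fun y => q.eval y) (Set.uIcc 0 x) := q.continuous.continuousOn
      have h0mem : (0 : ℝ) ∈ Set.uIcc (q.eval 0) (q.eval x) := by
        rw [Set.mem_uIcc]
        rcases mul_nonpos_iff.1 hneg with h | h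
        · exact Or.inr ⟨h.2, h.1⟩
        · exact Or.inl ⟨h.1, h.2⟩
      obtain ⟨y, -, hy⟩ := intermediate_value_uIcc hcont h0mem
      exact hroot y hy
  have hpos : ∀ z ∈ r.roots, 0 < z := fun z hz => by
    by_contra hz0
    push Not at hz0
    have hroot := (mem_roots hrne).1 hz
    obtain ⟨p, hp⟩ := dvd_iff_isRoot.2 hroot
    have hz1 : z ≠ 0 := fun h => by rw [h, IsRoot.def, hr0] at hroot; norm_num at hroot
    refine hfalse hp ?_ fun x hx => ?_
    · have hpne : p ≠ 0 := fun h => by rw [h, mul_zero] at hp; exact hrne hp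
      have h1 : r.natDegree = (X - C z).natDegree + p.natDegree := by
        rw [← natDegree_mul (X_sub_C_ne_zero z) hpne, ← hp]
      rw [natDegree_X_sub_C] at h1
      omega
    · have : z < 0 := lt_of_le_of_ne hz0 hz1
      simp only [eval_sub, eval_X, eval_C]
      nlinarith
  have hprod : r = (r.roots.map fun z => 1 - C z⁻¹ * X).prod := by
    obtain ⟨k, rfl⟩ : ∃ k, q = C k := ⟨q.coeff 0, eq_C_of_natDegree_eq_zero hqd⟩
    have h1 : (r.roots.map fun z => X - C z).prod =
        (r.roots.map fun z => C (-z)).prod * (r.roots.map fun z => 1 - C z⁻¹ * X).prod := by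
      rw [← Multiset.prod_map_mul]
      congr 1
      refine Multiset.map_congr rfl fun z hz => ?_
      have h2 : C z * C z⁻¹ = (1 : ℝ[X]) := by
        rw [← C_mul, mul_inv_cancel₀ (hpos z hz).ne', C_1]
      rw [C_neg]
      linear_combination (-X) * h2
    obtain ⟨k', hk'⟩ : ∃ k' : ℝ, (r.roots.map fun z => C (-z)).prod = C k' := by
      refine ⟨(r.roots.map fun z => -z).prod, ?_⟩
      rw [map_multiset_prod, Multiset.map_map]
      rfl
    rw [h1, hk'] at hq
    have h3 : k' * k = 1 := by
      have := congrArg (eval 0) hq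
      rw [hr0] at this
      simp only [eval_mul, eval_C, eval_multiset_prod, Multiset.map_map, Function.comp_def,
        eval_sub, eval_one, eval_X, mul_zero, sub_zero, Multiset.map_const',
        Multiset.prod_replicate,
        one_pow, mul_one] at this
      exact this
    have h4 : C k' * C k = (1 : ℝ[X]) := by rw [← C_mul, h3, C_1]
    calc r = C k' * (r.roots.map fun z => 1 - C z⁻¹ * X).prod * C k := hq.symm
      _ = (C k' * C k) * (r.roots.map fun z => 1 - C z⁻¹ * X).prod := by ring
      _ = _ := by rw [h4, one_mul]
  refine ⟨r.roots, hpos, fun h => ?_, ?_, hprod⟩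
  · -- A constant residual polynomial is a product with the trivial factor.
    rw [h, Multiset.map_zero, Multiset.prod_zero] at hprod
    refine hfalse (s := 1) (p := 1) (by rw [hprod, one_mul]) (by simpa using hm) fun x _ => ?_
    simp
  · exact (card_roots' r).trans hrm

/-- On `x ≤ 3 z / 2`, each factor satisfies `(1 - x / z) ^ 2 ≤ exp (-x / (2 z))`. -/
theorem prod_one_sub_sq_le (Z : Multiset ℝ) {x : ℝ} (hx : 0 ≤ x)
    (hZ : ∀ z ∈ Z, 0 < z ∧ x ≤ 3 / 2 * z) :
    (Z.map fun z => 1 - z⁻¹ * x).prod ^ 2 ≤ Real.exp (-((Z.map fun z => z⁻¹).sum * x / 2)) := by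
  induction Z using Multiset.induction_on with
  | empty => simp
  | cons z Z ih =>
    have hz := hZ z (Multiset.mem_cons_self z Z)
    have ih' := ih fun y hy => hZ y (Multiset.mem_cons_of_mem hy)
    rw [Multiset.map_cons, Multiset.prod_cons, Multiset.map_cons, Multiset.sum_cons, mul_pow]
    have h1 : (1 - z⁻¹ * x) ^ 2 ≤ Real.exp (-(z⁻¹ * x / 2)) := by
      refine le_trans ?_ (Real.add_one_le_exp _)
      have h2 : 0 ≤ z⁻¹ * x := mul_nonneg (inv_nonneg.2 hz.1.le) hx
      have h3 : z⁻¹ * x ≤ 3 / 2 := by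
        rw [inv_mul_le_iff₀ hz.1]; linarith [hz.2]
      nlinarith
    have h2 : -((z⁻¹ + (Z.map fun z => z⁻¹).sum) * x / 2) =
        -(z⁻¹ * x / 2) + -((Z.map fun z => z⁻¹).sum * x / 2) := by ring
    rw [h2, Real.exp_add]
    exact mul_le_mul h1 ih' (sq_nonneg _) (Real.exp_pos _).le

theorem prod_one_sub_mem (Z : Multiset ℝ) {x : ℝ} (hx : 0 ≤ x)
    (hZ : ∀ z ∈ Z, 0 < z ∧ x ≤ z) :
    0 ≤ (Z.map fun z => 1 - z⁻¹ * x).prod ∧ (Z.map fun z => 1 - z⁻¹ * x).prod ≤ 1 ∧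
      1 - (Z.map fun z => 1 - z⁻¹ * x).prod ≤ (Z.map fun z => z⁻¹).sum * x := by
  induction Z using Multiset.induction_on with
  | empty => simp
  | cons z Z ih =>
    have hz := hZ z (Multiset.mem_cons_self z Z)
    obtain ⟨h1, h2, h3⟩ := ih fun y hy => hZ y (Multiset.mem_cons_of_mem hy)
    rw [Multiset.map_cons, Multiset.prod_cons, Multiset.map_cons, Multiset.sum_cons]
    have h4 : 0 ≤ z⁻¹ * x := mul_nonneg (inv_nonneg.2 hz.1.le) hx
    have h5 : z⁻¹ * x ≤ 1 := by rw [inv_mul_le_iff₀ hz.1]; linarith [hz.2]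
    refine ⟨mul_nonneg (by linarith) h1, by nlinarith, by nlinarith⟩

/-- The minimal residual polynomial `r` at the step `m`, when all residuals at the step `m - 1` are
at least `W`. With the smallest root `x₁` of `r` and the sum `R` of the inverses of the other roots,
the polynomial `r / (1 - x / x₁)` competes at the step `m - 1`, and orthogonality bounds its part on
`x > 3 x₁ / 2` by its part on `x < x₁`. -/
theorem exists_smallest_root (hm : 0 < m) (ha : ∀ i ∈ t, 0 < a i) (hc : ∀ i ∈ t, 0 ≤ c i)
    (hr0 : r.eval 0 = 1) (hrm : r.natDegree ≤ m)
    (hmin : ∀ p : ℝ[X], p.natDegree ≤ m → p.eval 0 = 1 →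
      ∑ i ∈ t, c i * r.eval (a i) ^ 2 ≤ ∑ i ∈ t, c i * p.eval (a i) ^ 2) {W : ℝ} (hW : 0 < W)
    (hres : ∀ p : ℝ[X], p.natDegree < m → p.eval 0 = 1 → W ≤ ∑ i ∈ t, c i * p.eval (a i) ^ 2) :
    ∃ x₁ R : ℝ, 0 < x₁ ∧ 0 ≤ R ∧
      (W ≤ 4 / 3 * ∑ i ∈ t with a i ≤ 3 / 2 * x₁, c i * Real.exp (-(R * a i / 2))) ∧
      ∀ x, 0 ≤ x → x ≤ x₁ → 0 ≤ r.eval x ∧ r.eval x ≤ 1 ∧ 1 - r.eval x ≤ (x₁⁻¹ + R) * x := by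
  classical
  obtain ⟨Z, hZpos, hZne, hZcard, hZ⟩ := exists_roots_residual hm ha hc hr0 hrm hmin
    fun p h1 h2 => hW.trans_le (hres p h1 h2)
  obtain ⟨x₁, hx₁, hx₁min⟩ : ∃ x₁ ∈ Z, ∀ z ∈ Z, x₁ ≤ z := by
    obtain ⟨x₁, h1, h2⟩ := Z.toFinset.exists_min_image id
      (by obtain ⟨z, hz⟩ := Multiset.exists_mem_of_ne_zero hZne
          exact ⟨z, Multiset.mem_toFinset.2 hz⟩)
    exact ⟨x₁, Multiset.mem_toFinset.1 h1, fun z hz => h2 z (Multiset.mem_toFinset.2 hz)⟩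
  obtain ⟨Y, rfl⟩ := Multiset.exists_cons_of_mem hx₁
  have hx0 := hZpos x₁ hx₁
  have hY : ∀ z ∈ Y, 0 < z ∧ x₁ ≤ z := fun z hz =>
    ⟨hZpos z (Multiset.mem_cons_of_mem hz), hx₁min z (Multiset.mem_cons_of_mem hz)⟩
  set R := (Y.map fun z => z⁻¹).sum with hR
  have hR0 : 0 ≤ R := Multiset.sum_nonneg fun y hy => by
    obtain ⟨z, hz, rfl⟩ := Multiset.mem_map.1 hy
    exact inv_nonneg.2 (hY z hz).1.le
  set p : ℝ[X] := (Y.map fun z => 1 - C z⁻¹ * X).prod with hp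
  have hrp : r = (1 - C x₁⁻¹ * X) * p := by rw [hZ, Multiset.map_cons, Multiset.prod_cons]
  have hpe : ∀ x, p.eval x = (Y.map fun z => 1 - z⁻¹ * x).prod := fun x => by
    simp [hp, eval_multiset_prod, Multiset.map_map]
  have hpd : p.natDegree < m := by
    have h1 : p.natDegree ≤ (Y.map fun z => 1).sum := by
      refine (natDegree_multiset_prod_le _).trans ?_
      rw [Multiset.map_map]
      refine Multiset.sum_map_le_sum_map _ _ fun z _ => ?_
      simp only [Function.comp_apply]
      refine (natDegree_sub_le _ _).trans (max_le (by simp) ?_)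
      exact (natDegree_C_mul_le _ _).trans natDegree_X_le
    rw [Multiset.card_cons] at hZcard
    simp only [Multiset.map_const', Multiset.sum_replicate, smul_eq_mul, mul_one] at h1
    omega
  have hp0 : p.eval 0 = 1 := by simp [hpe]
  have horth := sum_residual_mul_eq_zero hr0 hrm hmin hpd
  refine ⟨x₁, R, hx0, hR0, (hres p hpd hp0).trans ?_, fun x h0 h1 => ?_⟩
  · have hpt : ∀ i ∈ t, c i * p.eval (a i) ^ 2 ≤
        4 / 3 * (if a i ≤ 3 / 2 * x₁ then c i * Real.exp (-(R * a i / 2)) else 0) -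
          4 / (3 * x₁) * (c i * (a i * r.eval (a i) * p.eval (a i))) := fun i hi => by
      have hre : r.eval (a i) = (1 - x₁⁻¹ * a i) * p.eval (a i) := by rw [hrp]; simp
      have h1 : 4 / (3 * x₁) * (c i * (a i * r.eval (a i) * p.eval (a i))) =
          c i * p.eval (a i) ^ 2 * (4 / 3 * (a i / x₁) * (1 - a i / x₁)) := by
        rw [hre]; field_simp
      rw [h1]
      have hq : 0 ≤ c i * p.eval (a i) ^ 2 := mul_nonneg (hc i hi) (sq_nonneg _)
      have hu : 0 < a i / x₁ := div_pos (ha i hi) hx0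
      set u := a i / x₁ with hu'
      split_ifs with h
      · have h2 : p.eval (a i) ^ 2 ≤ Real.exp (-(R * a i / 2)) := by
          rw [hpe]
          refine prod_one_sub_sq_le Y (ha i hi).le fun z hz => ⟨(hY z hz).1, ?_⟩
          linarith [(hY z hz).2]
        have h3 := mul_le_mul_of_nonneg_left h2 (hc i hi)
        have h4 : 4 / 3 * u * (1 - u) ≤ 1 / 3 := by nlinarith [sq_nonneg (2 * u - 1)]
        nlinarith [mul_le_mul_of_nonneg_left h4 hq]
      · have h2 : 3 / 2 < u := by
          rw [hu', lt_div_iff₀ hx0]; linarith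
        have h4 : 4 / 3 * u * (1 - u) ≤ -1 := by nlinarith
        nlinarith [mul_le_mul_of_nonneg_left h4 hq]
    refine (Finset.sum_le_sum hpt).trans_eq ?_
    rw [Finset.sum_sub_distrib, ← Finset.mul_sum, ← Finset.mul_sum, horth, mul_zero, sub_zero,
      Finset.sum_filter]
  · have h2 : r.eval x = ((x₁ ::ₘ Y).map fun z => 1 - z⁻¹ * x).prod := by
      rw [hrp, eval_mul, hpe]; simp
    have h3 := prod_one_sub_mem (x₁ ::ₘ Y) h0 fun z hz => by
      refine ⟨hZpos z hz, h1.trans (hx₁min z hz)⟩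
    rw [Multiset.map_cons (fun z : ℝ => z⁻¹), Multiset.sum_cons] at h3
    rw [h2]
    exact h3

end ResidualPolynomial


/-! ### Energy norms and bounds by duality -/

section DualBound

variable {H : Type*} [NormedAddCommGroup H] [InnerProductSpace ℝ H]

/-- The norm `‖(A + l)^{1/2} y‖` of a positive operator `A`, written without the square root
of the operator. -/
noncomputable def energyNorm (A : H →L[ℝ] H) (l : ℝ) (y : H) : ℝ :=
  Real.sqrt (inner ℝ (A y) y + l * ‖y‖ ^ 2)

/-- The inequality `‖(A + l)^{-1/2} v‖ ≤ δ`, expressed by duality with the energy norm. -/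
def DualBound (A : H →L[ℝ] H) (l δ : ℝ) (v : H) : Prop :=
  ∀ y, inner ℝ v y ≤ δ * energyNorm A l y

theorem energyNorm_nonneg (A : H →L[ℝ] H) (l : ℝ) (y : H) : 0 ≤ energyNorm A l y :=
  Real.sqrt_nonneg _

theorem DualBound.add {A : H →L[ℝ] H} {l δ δ' : ℝ} {v v' : H} (h : DualBound A l δ v)
    (h' : DualBound A l δ' v') : DualBound A l (δ + δ') (v + v') := fun y => by
  rw [inner_add_left, add_mul]
  exact add_le_add (h y) (h' y)

theorem DualBound.mono {A : H →L[ℝ] H} {l δ δ' : ℝ} {v : H} (h : DualBound A l δ v)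
    (hδ : δ ≤ δ') : DualBound A l δ' v := fun y =>
  (h y).trans (mul_le_mul_of_nonneg_right hδ (energyNorm_nonneg A l y))

/-- A dual bound is preserved, up to a constant, when the energy norm increases up to a constant. -/
theorem DualBound.of_energyNorm_le {A S : H →L[ℝ] H} {l δ c : ℝ} {v : H} (h : DualBound S l δ v)
    (hδ : 0 ≤ δ) (hc : ∀ y, energyNorm S l y ≤ c * energyNorm A l y) :
    DualBound A l (c * δ) v := fun y => by
  refine (h y).trans ((mul_le_mul_of_nonneg_left (hc y) hδ).trans_eq ?_)
  ring

theorem dualBound_of_norm_le {A : H →L[ℝ] H} {l B : ℝ} {v : H} (hl : 0 < l)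
    (hA : ∀ y, 0 ≤ inner ℝ (A y) y) (hv : ‖v‖ ≤ B) :
    DualBound A l (B / Real.sqrt l) v := fun y => by
  have h1 : Real.sqrt l * ‖y‖ ≤ energyNorm A l y := by
    refine Real.le_sqrt_of_sq_le ?_
    rw [mul_pow, Real.sq_sqrt hl.le]
    linarith [hA y]
  have hs := Real.sqrt_pos.2 hl
  have h2 := (real_inner_le_norm v y).trans (mul_le_mul_of_nonneg_right hv (norm_nonneg y))
  refine h2.trans ?_
  rw [div_mul_eq_mul_div, le_div_iff₀ hs, mul_assoc, mul_comm ‖y‖]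
  exact mul_le_mul_of_nonneg_left h1 ((norm_nonneg v).trans hv)

end DualBound

/-! ### Spectral bounds on approximation errors -/

section SpectralBounds

variable {H : Type*} [NormedAddCommGroup H] [InnerProductSpace ℝ H] [CompleteSpace H]
  {ι : Type*} (e : HilbertBasis ι ℝ H) {A : H →L[ℝ] H} {a : ι → ℝ} {l : ℝ}

theorem abs_le_of_mul_sqrt_le (ha0 : ∀ i, 0 ≤ a i) (hl : 0 < l) {φ : ι → ℝ} {θ : ℝ}
    (hφ : ∀ i, |φ i| * Real.sqrt (a i + l) ≤ θ) (i : ι) : |φ i| ≤ θ / Real.sqrt l := by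
  rw [le_div_iff₀ (Real.sqrt_pos.2 hl)]
  refine le_trans ?_ (hφ i)
  exact mul_le_mul_of_nonneg_left (Real.sqrt_le_sqrt (by linarith [ha0 i])) (abs_nonneg _)

theorem norm_diagOp_le_of_dualBound (hA : ∀ x y, inner ℝ (A x) y = inner ℝ x (A y))
    (ha : ∀ i, A (e i) = a i • e i) (ha0 : ∀ i, 0 ≤ a i) (hl : 0 < l) {δ : ℝ} {v : H}
    (hv : DualBound A l δ v) (hδ : 0 ≤ δ) {φ : ι → ℝ} {θ : ℝ} (hθ : 0 ≤ θ)
    (hφ : ∀ i, |φ i| * Real.sqrt (a i + l) ≤ θ) : ‖diagOp e φ v‖ ≤ θ * δ := by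
  have hb := abs_le_of_mul_sqrt_le ha0 hl hφ
  set w := diagOp e φ v with hw
  have h1 : energyNorm A l (diagOp e φ w) ≤ θ * ‖w‖ := by
    refine Real.sqrt_le_iff.2 ⟨by positivity, ?_⟩
    rw [mul_pow]
    refine hasSum_le (fun i => ?_) (hasSum_energy e hA ha l (diagOp e φ w))
      ((hasSum_inner_sq e w).mul_left (θ ^ 2))
    rw [inner_diagOp e hb, mul_pow, ← mul_assoc]
    refine mul_le_mul_of_nonneg_right ?_ (sq_nonneg _)
    have h2 := pow_le_pow_left₀ (by positivity) (hφ i) 2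
    rw [mul_pow, sq_abs, Real.sq_sqrt (by linarith [ha0 i])] at h2
    linarith
  have h2 : ‖w‖ * ‖w‖ ≤ θ * δ * ‖w‖ := by
    rw [← sq, ← real_inner_self_eq_norm_sq]
    nth_rw 1 [hw]
    rw [inner_diagOp_comm e hb]
    refine (hv _).trans ((mul_le_mul_of_nonneg_left h1 hδ).trans_eq (by ring))
  by_cases h0 : ‖w‖ = 0
  · rw [h0]; positivity
  · exact le_of_mul_le_mul_right h2 (lt_of_le_of_ne (norm_nonneg _) (Ne.symm h0))

theorem diagOp_pow (hA : ∀ x y, inner ℝ (A x) y = inner ℝ x (A y))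
    (ha : ∀ i, A (e i) = a i • e i) {φ : ι → ℝ} {C : ℝ} (hφ : ∀ i, |φ i| ≤ C) (k : ℕ) (v : H) :
    diagOp e φ ((A ^ k) v) = diagOp e (fun i => φ i * a i ^ k) v := by
  refine ext_inner_basis e fun i => ?_
  have h1 : ∀ i, |φ i * a i ^ k| ≤ C * ‖A‖ ^ k := fun i => by
    rw [abs_mul, abs_pow]
    have := eigenvalue_le_norm e ha i
    have h0 := hφ i
    have hC : 0 ≤ C := (abs_nonneg _).trans h0
    gcongr
  rw [inner_diagOp e hφ, inner_diagOp e h1, inner_eigen_pow e hA ha, mul_assoc]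

/-- The bound on the approximation error: it only uses that `h` is a sum of vectors `A ^ k (v k)`
with `‖(A + l)^{-1/2} (v k)‖ ≤ β / l ^ (k + 1)`, which is a substitute for a source condition
`h = (A + l) ^ (r - 1/2) w` with a large real exponent. -/
theorem norm_diagOp_le_of_source (hA : ∀ x y, inner ℝ (A x) y = inner ℝ x (A y))
    (ha : ∀ i, A (e i) = a i • e i) (ha0 : ∀ i, 0 ≤ a i) (hl : 0 < l) {j : ℕ} {v : ℕ → H} {β : ℝ}
    (hβ : 0 ≤ β) (hv : ∀ k ≤ j, DualBound A l (β / l ^ (k + 1)) (v k)) {h : H}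
    (hh : h = ∑ k ∈ Finset.range (j + 1), (A ^ k) (v k)) {φ : ι → ℝ} {θ : ℝ} (hθ : 0 ≤ θ)
    (hφ : ∀ k ≤ j, ∀ i, |φ i| * (a i ^ k * Real.sqrt (a i + l)) ≤ θ * l ^ (k + 1)) :
    ‖diagOp e φ h‖ ≤ (j + 1) * (θ * β) := by
  have hb : ∀ i, |φ i| ≤ θ * l ^ (0 + 1) / Real.sqrt l :=
    abs_le_of_mul_sqrt_le ha0 hl fun i => by simpa using hφ 0 (Nat.zero_le _) i
  rw [hh, map_sum]
  refine (norm_sum_le _ _).trans ?_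
  refine (Finset.sum_le_card_nsmul _ _ (θ * β) fun k hk => ?_).trans_eq (by simp)
  have hkj : k ≤ j := Nat.lt_succ_iff.1 (Finset.mem_range.1 hk)
  rw [diagOp_pow e hA ha hb]
  refine (norm_diagOp_le_of_dualBound e hA ha ha0 hl (hv k hkj) (by positivity)
    (θ := θ * l ^ (k + 1)) (by positivity) fun i => ?_).trans_eq ?_
  · rw [abs_mul, abs_of_nonneg (pow_nonneg (ha0 i) k), mul_assoc]
    exact hφ k hkj i
  · have := pow_pos hl (k + 1)
    field_simp

end SpectralBounds

/-! ### Conjugate gradients stopped by the discrepancy principle -/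

section ConjugateGradientAnalysis

open Polynomial

variable {H : Type*} [NormedAddCommGroup H] [InnerProductSpace ℝ H]
  {ι : Type*} (e : HilbertBasis ι ℝ H) {A : H →L[ℝ] H} {a : ι → ℝ} {l : ℝ}

theorem norm_sq_aeval (hA : ∀ x y, inner ℝ (A x) y = inner ℝ x (A y))
    (ha : ∀ i, A (e i) = a i • e i) {t : Finset ι} {b : H}
    (hb : ∀ i ∉ t, inner ℝ (e i) b = 0) (p : ℝ[X]) :
    ‖aeval A p b‖ ^ 2 = ∑ i ∈ t, inner ℝ (e i) b ^ 2 * p.eval (a i) ^ 2 := by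
  refine (hasSum_inner_sq e (aeval A p b)).unique ?_
  have h1 : ∀ i ∉ t, inner ℝ (e i) (aeval A p b) ^ 2 = 0 := fun i hi => by
    rw [inner_eigen_aeval e hA ha, hb i hi]; simp
  have h2 : ∑ i ∈ t, inner ℝ (e i) b ^ 2 * p.eval (a i) ^ 2 =
      ∑ i ∈ t, inner ℝ (e i) (aeval A p b) ^ 2 := by
    refine Finset.sum_congr rfl fun i _ => ?_
    rw [inner_eigen_aeval e hA ha, mul_pow, mul_comm]
  rw [h2]
  exact hasSum_sum_of_ne_finset_zero h1

theorem exists_eq_one_sub_X_mul {p : ℝ[X]} {m : ℕ} (hp : p.natDegree ≤ m) (hp0 : p.eval 0 = 1) :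
    ∃ q ∈ degreeLT ℝ m, p = 1 - X * q := by
  have h1 : (X : ℝ[X]) ∣ 1 - p := by
    rw [X_dvd_iff, coeff_zero_eq_eval_zero]; simp [hp0]
  obtain ⟨q, hq⟩ := h1
  refine ⟨q, ?_, by rw [← hq]; ring⟩
  rw [mem_degreeLT]
  by_cases hq0 : q = 0
  · rw [hq0, degree_zero]; exact WithBot.bot_lt_coe m
  · have h2 : (X * q).natDegree ≤ m := by
      rw [← hq]
      exact (natDegree_sub_le _ _).trans (max_le (by simp) hp)
    rw [natDegree_X_mul hq0] at h2
    rw [degree_eq_natDegree hq0]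
    exact_mod_cast h2

theorem aeval_one_sub_X_mul (q : ℝ[X]) (b : H) :
    aeval A (1 - X * q) b = b - A (aeval A q b) := by
  simp [mul_apply_eq_comp]

theorem natDegree_one_sub_X_mul_le {q : ℝ[X]} {m : ℕ} (hq : q ∈ degreeLT ℝ m) :
    (1 - X * q).natDegree ≤ m := by
  refine (natDegree_sub_le _ _).trans (max_le (by simp) ?_)
  by_cases hq0 : q = 0
  · simp [hq0]
  · rw [mem_degreeLT, degree_eq_natDegree hq0] at hq
    rw [natDegree_X_mul hq0]
    exact_mod_cast hq

/-- If `b` has finitely many nonzero coordinates, all of them for nonzero eigenvalues, then some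
Krylov space contains an exact solution of `A f = b`. -/
theorem exists_aeval_eq (hA : ∀ x y, inner ℝ (A x) y = inner ℝ x (A y))
    (ha : ∀ i, A (e i) = a i • e i) {t : Finset ι} (ht : ∀ i ∈ t, a i ≠ 0) {b : H}
    (hb : ∀ i ∉ t, inner ℝ (e i) b = 0) :
    ∃ m, ∃ q ∈ degreeLT ℝ m, b - A (aeval A q b) = 0 := by
  set p : ℝ[X] := ∏ i ∈ t, (1 - C (a i)⁻¹ * X) with hp
  have hp0 : p.eval 0 = 1 := by simp [hp, eval_prod]
  obtain ⟨q, hq, hpq⟩ := exists_eq_one_sub_X_mul le_rfl hp0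
  refine ⟨_, q, hq, ?_⟩
  rw [← aeval_one_sub_X_mul, ← hpq, ← norm_eq_zero, ← sq_eq_zero_iff, norm_sq_aeval e hA ha hb]
  refine Finset.sum_eq_zero fun i hi => ?_
  have h1 : p.eval (a i) = 0 := by
    rw [hp, eval_prod]
    refine Finset.prod_eq_zero hi ?_
    simp [ht i hi]
  rw [h1]; simp

variable [CompleteSpace H]

/-- The error of `q(A) b` in the energy norm, for a polynomial `q` whose residual polynomial
`1 - x q(x)` stays in `[0, 1]` with slope at most `1 / (p l)` on the part `[0, p l]` of the
spectrum. Below `p l` the error is split into noise and approximation error; above `p l` the operator is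
inverted on the residual. -/
theorem energyNorm_sub_le (hA : ∀ x y, inner ℝ (A x) y = inner ℝ x (A y))
    (ha : ∀ i, A (e i) = a i • e i) (ha0 : ∀ i, 0 ≤ a i) (hl : 0 < l) {j : ℕ} {v : ℕ → H} {β : ℝ}
    (hβ : 0 ≤ β) (hv : ∀ k ≤ j, DualBound A l (β / l ^ (k + 1)) (v k)) {h : H}
    (hh : h = ∑ k ∈ Finset.range (j + 1), (A ^ k) (v k)) {b : H} {δ : ℝ} (hδ : 0 ≤ δ)
    (hn : DualBound A l δ (b - A h)) (hker : ∀ i, a i = 0 → inner ℝ (e i) b = 0)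
    {p W : ℝ} (hp : 0 < p) (hp1 : p ≤ 1) {q : ℝ[X]} (hW : ‖A (aeval A q b) - b‖ ≤ W)
    (hq : ∀ x, 0 ≤ x → x ≤ p * l → 0 ≤ (1 - X * q).eval x ∧ (1 - X * q).eval x ≤ 1 ∧
      1 - (1 - X * q).eval x ≤ (p * l)⁻¹ * x) :
    energyNorm A l (aeval A q b - h) ≤
      2 / p * δ + (j + 1) * (2 * β) + 2 / (p * Real.sqrt l) * W := by
  have hpl : 0 < p * l := mul_pos hp hl
  have hsl := Real.sqrt_pos.2 hl
  set f := aeval A q b with hf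
  set r : ℝ → ℝ := fun x => (1 - X * q).eval x with hr
  -- The filters for the noise, the approximation error and the residual.
  set φ₁ : ι → ℝ := fun i =>
    if a i ≤ p * l then Real.sqrt (a i + l) * ((1 - r (a i)) / a i)
    else Real.sqrt (a i + l) / a i with hφ₁
  set φ₂ : ι → ℝ := fun i => if a i ≤ p * l then Real.sqrt (a i + l) * r (a i) else 0 with hφ₂
  set φ₃ : ι → ℝ := fun i => if a i ≤ p * l then 0 else Real.sqrt (a i + l) / a i with hφ₃
  set φ₀ : ι → ℝ := fun i => Real.sqrt (a i + l) with hφ₀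
  have hsq : ∀ i, Real.sqrt (a i + l) * Real.sqrt (a i + l) = a i + l := fun i =>
    Real.mul_self_sqrt (by linarith [ha0 i])
  have hb₀ : ∀ i, |φ₀ i| ≤ Real.sqrt (‖A‖ + l) := fun i => by
    rw [hφ₀, abs_of_nonneg (Real.sqrt_nonneg _)]
    exact Real.sqrt_le_sqrt (by linarith [(le_abs_self _).trans (eigenvalue_le_norm e ha i)])
  have hθ₁ : ∀ i, |φ₁ i| * Real.sqrt (a i + l) ≤ 2 / p := fun i => by
    simp only [hφ₁]
    split_ifs with hi
    · obtain ⟨h1, h2, h3⟩ := hq (a i) (ha0 i) hi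
      have h4 : 0 ≤ (1 - r (a i)) / a i := div_nonneg (by simp only [hr]; linarith) (ha0 i)
      have h5 : (1 - r (a i)) / a i ≤ (p * l)⁻¹ := by
        rcases (ha0 i).eq_or_lt with h0 | h0
        · rw [← h0, div_zero]; positivity
        · rw [div_le_iff₀ h0]; exact h3
      rw [abs_of_nonneg (mul_nonneg (Real.sqrt_nonneg _) h4), mul_right_comm, hsq]
      calc (a i + l) * ((1 - r (a i)) / a i) ≤ (2 * l) * (p * l)⁻¹ := by
            refine mul_le_mul ?_ h5 h4 (by positivity)
            nlinarith
        _ = 2 / p := by field_simp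
    · push Not at hi
      have h0 : 0 < a i := hpl.trans hi
      rw [abs_of_nonneg (by positivity), div_mul_eq_mul_div, hsq, div_le_div_iff₀ h0 hp]
      nlinarith
  have hθ₂ : ∀ k ≤ j, ∀ i, |φ₂ i| * (a i ^ k * Real.sqrt (a i + l)) ≤ 2 * l ^ (k + 1) :=
    fun k _ i => by
      simp only [hφ₂]
      split_ifs with hi
      · obtain ⟨h1, h2, h3⟩ := hq (a i) (ha0 i) hi
        have h4 : 0 ≤ Real.sqrt (a i + l) * r (a i) := mul_nonneg (Real.sqrt_nonneg _) h1
        have hal : a i ≤ l := by nlinarith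
        rw [abs_of_nonneg h4]
        calc Real.sqrt (a i + l) * r (a i) * (a i ^ k * Real.sqrt (a i + l))
            = Real.sqrt (a i + l) * Real.sqrt (a i + l) * r (a i) * a i ^ k := by ring
          _ = (a i + l) * r (a i) * a i ^ k := by rw [hsq i]
          _ ≤ (2 * l) * 1 * l ^ k := by
              have := ha0 i
              refine mul_le_mul (mul_le_mul (by linarith) h2 h1 (by positivity))
                (pow_le_pow_left₀ this hal k) (by positivity) (by positivity)
          _ = _ := by ring
      · rw [abs_zero, zero_mul]; positivity
  have hb₃ : ∀ i, |φ₃ i| ≤ 2 / (p * Real.sqrt l) := fun i => by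
    simp only [hφ₃]
    split_ifs with hi
    · rw [abs_zero]; positivity
    · push Not at hi
      have h0 : 0 < a i := hpl.trans hi
      rw [abs_of_nonneg (by positivity), div_le_div_iff₀ h0 (by positivity)]
      refine abs_le_of_sq_le_sq' ?_ (by positivity) |>.2
      rw [mul_pow, mul_pow, mul_pow, Real.sq_sqrt hl.le, Real.sq_sqrt (by linarith)]
      have h1 : p * l * a i ≤ a i * a i := mul_le_mul_of_nonneg_right hi.le h0.le
      have h2 : p * l * (p * l) ≤ a i * a i := mul_le_mul hi.le hi.le hpl.le h0.le
      have h3 : p ^ 2 * l * a i ≤ p * l * a i := by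
        have : p ^ 2 ≤ p := by nlinarith
        exact mul_le_mul_of_nonneg_right (mul_le_mul_of_nonneg_right this hl.le) h0.le
      nlinarith
  have hb₁ := abs_le_of_mul_sqrt_le ha0 hl hθ₁
  have hb₂ : ∀ i, |φ₂ i| ≤ 2 * l ^ (0 + 1) / Real.sqrt l :=
    abs_le_of_mul_sqrt_le ha0 hl fun i => by simpa using hθ₂ 0 (Nat.zero_le _) i
  have hsplit : diagOp e φ₀ (f - h) =
      diagOp e φ₁ (b - A h) - diagOp e φ₂ h + diagOp e φ₃ (A f - b) := by
    refine ext_inner_basis e fun i => ?_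
    rw [inner_add_right, inner_sub_right, inner_diagOp e hb₀, inner_diagOp e hb₁,
      inner_diagOp e hb₂, inner_diagOp e hb₃, inner_sub_right, inner_sub_right, inner_sub_right,
      inner_eigen e hA ha, inner_eigen e hA ha, hf, inner_eigen_aeval e hA ha]
    have hre : r (a i) = 1 - a i * q.eval (a i) := by simp [hr]
    simp only [hφ₀, hφ₁, hφ₂, hφ₃, hre]
    by_cases h0 : a i = 0
    · rw [hker i h0]
      simp [h0, hpl.le]
    · split_ifs with hi
      · field_simp; ring
      · field_simp; ring
  have hen : energyNorm A l (f - h) = ‖diagOp e φ₀ (f - h)‖ := by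
    rw [energyNorm, ← Real.sqrt_sq (norm_nonneg (diagOp e φ₀ (f - h)))]
    congr 1
    refine (hasSum_energy e hA ha l (f - h)).unique ?_
    convert! hasSum_inner_sq e (diagOp e φ₀ (f - h)) using 2 with i
    rw [inner_diagOp e hb₀, mul_pow, hφ₀, Real.sq_sqrt (by linarith [ha0 i])]
  rw [hen, hsplit]
  refine (norm_add_le _ _).trans (add_le_add ((norm_sub_le _ _).trans (add_le_add ?_ ?_)) ?_)
  · exact norm_diagOp_le_of_dualBound e hA ha ha0 hl hn hδ (by positivity) hθ₁
  · exact norm_diagOp_le_of_source e hA ha ha0 hl hβ hv hh (by norm_num) hθ₂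
  · refine (norm_diagOp_le e hb₃ _).trans ?_
    rw [abs_of_nonneg (by positivity)]
    exact mul_le_mul_of_nonneg_left hW (by positivity)

/-- The constant `e^{3/8} k! 4^k` with `k = 2 j + 3`, rounded up. -/
noncomputable def decayConst (j : ℕ) : ℝ := 3 / 2 * ((2 * j + 3).factorial * 4 ^ (2 * j + 3))

theorem exp_mul_pow_le {x₁ R x : ℝ} (hx₁ : 0 < x₁) (hR : 0 ≤ R) (hx : 0 ≤ x)
    (hxx : x ≤ 3 / 2 * x₁) (k : ℕ) :
    Real.exp (-(R * x / 4)) * x ^ k ≤ 3 / 2 * (k.factorial * 4 ^ k) * ((x₁⁻¹ + R)⁻¹) ^ k := by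
  set Q := x₁⁻¹ + R with hQ
  have hQ0 : 0 < Q := by positivity
  have h1 : Real.exp (-(R * x / 4)) ≤ 3 / 2 * Real.exp (-(Q * x / 4)) := by
    have h2 : -(R * x / 4) = x₁⁻¹ * x / 4 + -(Q * x / 4) := by rw [hQ]; ring
    rw [h2, Real.exp_add]
    refine mul_le_mul_of_nonneg_right ?_ (Real.exp_pos _).le
    have h3 : x₁⁻¹ * x / 4 ≤ 3 / 8 := by
      have : x₁⁻¹ * x ≤ 3 / 2 := by rw [inv_mul_le_iff₀ hx₁]; linarith
      linarith
    have h4 : 0 ≤ x₁⁻¹ * x / 4 := by positivity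
    refine (Real.exp_le_exp.2 h3).trans ?_
    have := exp_sub_one_sub_le (x := 3 / 8) (by norm_num) (by norm_num)
    linarith
  have h5 : (Q * x / 4) ^ k * Real.exp (-(Q * x / 4)) ≤ k.factorial := by
    have h6 := Real.pow_div_factorial_le_exp (Q * x / 4) (by positivity) k
    rw [div_le_iff₀ (by positivity)] at h6
    rw [Real.exp_neg, ← div_eq_mul_inv, div_le_iff₀ (Real.exp_pos _)]
    linarith
  have h7 : x ^ k = (Q * x / 4) ^ k * (4 ^ k * Q⁻¹ ^ k) := by
    rw [← mul_pow, ← mul_pow]; congr 1; field_simp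
  rw [h7]
  calc Real.exp (-(R * x / 4)) * ((Q * x / 4) ^ k * (4 ^ k * Q⁻¹ ^ k))
      ≤ 3 / 2 * Real.exp (-(Q * x / 4)) * ((Q * x / 4) ^ k * (4 ^ k * Q⁻¹ ^ k)) :=
        mul_le_mul_of_nonneg_right h1 (by positivity)
    _ = 3 / 2 * ((Q * x / 4) ^ k * Real.exp (-(Q * x / 4))) * (4 ^ k * Q⁻¹ ^ k) := by ring
    _ ≤ 3 / 2 * k.factorial * (4 ^ k * Q⁻¹ ^ k) := by gcongr
    _ = _ := by ring

theorem le_decayConst {j k : ℕ} (hk : k ≤ 2 * j + 3) :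
    3 / 2 * ((k.factorial : ℝ) * 4 ^ k) ≤ decayConst j := by
  rw [decayConst]
  have h1 : (k.factorial : ℝ) ≤ (2 * j + 3).factorial := by exact_mod_cast Nat.factorial_le hk
  have h2 : (4 : ℝ) ^ k ≤ 4 ^ (2 * j + 3) := pow_le_pow_right₀ (by norm_num) hk
  gcongr

/-- As long as the previous residual was large compared to the noise, the slope
`Q = 1 / x₁ + R` of the minimal residual polynomial at zero is at most of order `1 / l`. -/
theorem slope_le (hA : ∀ x y, inner ℝ (A x) y = inner ℝ x (A y))
    (ha : ∀ i, A (e i) = a i • e i) (ha0 : ∀ i, 0 ≤ a i) (hl : 0 < l) {j : ℕ} {v : ℕ → H} {μ : ℝ}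
    (hμ : 0 < μ) (hv : ∀ k ≤ j, DualBound A l (μ / l ^ (k + 1)) (v k)) {h : H}
    (hh : h = ∑ k ∈ Finset.range (j + 1), (A ^ k) (v k)) {b : H}
    (hn : DualBound A l (31 / 25 * μ) (b - A h)) {t : Finset ι}
    (hb : ∀ i ∉ t, inner ℝ (e i) b = 0) {x₁ R : ℝ} (hx₁ : 0 < x₁) (hR : 0 ≤ R)
    (hW : (3 / 2 * μ * Real.sqrt l) ^ 2 ≤ 4 / 3 *
      ∑ i ∈ t with a i ≤ 3 / 2 * x₁, inner ℝ (e i) b ^ 2 * Real.exp (-(R * a i / 2))) :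
    x₁⁻¹ + R ≤ (1 / (20 * (4 + (j + 1) * (2 * decayConst j))) * l)⁻¹ := by
  set K := decayConst j with hK
  have hK1 : 1 ≤ K := by
    have := le_decayConst (Nat.zero_le (2 * j + 3))
    simp only [Nat.factorial_zero, pow_zero] at this
    norm_num at this
    linarith
  set L := (j + 1) * (2 * K) with hL
  have hL0 : 0 ≤ L := by positivity
  set Q := x₁⁻¹ + R with hQ
  have hQ0 : 0 < Q := by positivity
  set p := Q⁻¹ / l with hp
  have hp0 : 0 < p := by positivity
  have hpl : Q⁻¹ = p * l := by rw [hp]; field_simp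
  have hsl := Real.sqrt_pos.2 hl
  have hsll := Real.mul_self_sqrt hl.le
  suffices hmain : 1 / (20 * (4 + L)) ≤ p by
    have h1 := mul_le_mul_of_nonneg_right hmain hl.le
    rw [← hpl] at h1
    rw [← inv_inv Q]
    exact inv_anti₀ (by positivity) h1
  by_cases hp1 : 1 ≤ p
  · refine le_trans ?_ hp1
    rw [div_le_one (by positivity)]; linarith
  push Not at hp1
  -- The damping filter: `hW` is a lower bound for `‖g(A) b‖`.
  set g : ι → ℝ := fun i => if a i ≤ 3 / 2 * x₁ then Real.exp (-(R * a i / 4)) else 0 with hg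
  have hg0 : ∀ i, 0 ≤ g i := fun i => by
    simp only [hg]; split_ifs
    · exact (Real.exp_pos _).le
    · exact le_rfl
  have hg1 : ∀ i, g i ≤ 1 := fun i => by
    simp only [hg]; split_ifs
    · rw [Real.exp_le_one_iff]
      have := mul_nonneg hR (ha0 i)
      linarith
    · exact zero_le_one
  have hgk : ∀ k ≤ 2 * j + 3, ∀ i, g i * a i ^ k ≤ K * (p * l) ^ k := fun k hk i => by
    simp only [hg]; split_ifs with hi
    · refine (exp_mul_pow_le hx₁ hR (ha0 i) hi k).trans ?_
      rw [← hQ, hpl]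
      exact mul_le_mul_of_nonneg_right (le_decayConst hk) (by positivity)
    · rw [zero_mul]; positivity
  have hgb : ∀ i, |g i| ≤ 1 := fun i => by rw [abs_of_nonneg (hg0 i)]; exact hg1 i
  -- The noise needs the first moment of the filter with an explicit constant.
  have hgk1 : ∀ i, g i * a i ≤ 6 * (p * l) := fun i => by
    simp only [hg]; split_ifs with hi
    · have := exp_mul_pow_le hx₁ hR (ha0 i) hi 1
      rw [← hQ, hpl] at this
      norm_num at this
      linarith
    · rw [zero_mul]; positivity
  have hnoise : ‖diagOp e g (b - A h)‖ ≤ (1 + 3 * p) * Real.sqrt l * (31 / 25 * μ) := by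
    refine norm_diagOp_le_of_dualBound e hA ha ha0 hl hn (by positivity) (by positivity) fun i => ?_
    rw [abs_of_nonneg (hg0 i)]
    refine abs_le_of_sq_le_sq' ?_ (by positivity) |>.2
    rw [mul_pow, mul_pow, Real.sq_sqrt (by linarith [ha0 i]), Real.sq_sqrt hl.le]
    have h1 : g i ^ 2 * (a i + l) ≤ g i * a i + l := by
      have h2 : g i ^ 2 ≤ g i := by nlinarith [hg0 i, hg1 i]
      have h3 := mul_le_mul_of_nonneg_right h2 (ha0 i)
      have h4 := mul_le_mul_of_nonneg_right (h2.trans (hg1 i)) hl.le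
      linarith
    nlinarith [hgk1 i, mul_pos (mul_pos hp0 hp0) hl]
  have hbias : ‖diagOp e g (A h)‖ ≤ (j + 1) * (2 * K * p * Real.sqrt l * μ) := by
    have h1 := diagOp_pow e hA ha hgb 1 h
    rw [pow_one] at h1
    rw [h1]
    refine norm_diagOp_le_of_source e hA ha ha0 hl hμ.le hv hh (by positivity) fun k hk i => ?_
    rw [pow_one, abs_of_nonneg (mul_nonneg (hg0 i) (ha0 i))]
    have hpk : ∀ k : ℕ, p ^ (k + 2) ≤ p ^ 2 := fun k =>
      pow_le_pow_of_le_one hp0.le hp1.le (by omega)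
    refine abs_le_of_sq_le_sq' ?_ (by positivity) |>.2
    have h2 : (g i * a i * (a i ^ k * Real.sqrt (a i + l))) ^ 2 =
        g i ^ 2 * a i ^ (2 * k + 3) + g i ^ 2 * a i ^ (2 * k + 2) * l := by
      rw [mul_pow, mul_pow, mul_pow, Real.sq_sqrt (by linarith [ha0 i])]; ring
    have h3 : ∀ k' ≤ 2 * j + 3, g i ^ 2 * a i ^ k' ≤ K * (p * l) ^ k' := fun k' hk' => by
      refine le_trans ?_ (hgk k' hk' i)
      refine mul_le_mul_of_nonneg_right ?_ (pow_nonneg (ha0 i) _)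
      nlinarith [hg0 i, hg1 i]
    rw [h2]
    have h4 := h3 (2 * k + 3) (by omega)
    have h5 := mul_le_mul_of_nonneg_right (h3 (2 * k + 2) (by omega)) hl.le
    have h6 : (p * l) ^ (2 * k + 3) ≤ p ^ 2 * l ^ (2 * k + 3) := by
      rw [mul_pow]
      exact mul_le_mul_of_nonneg_right (hpk (2 * k + 1)) (by positivity)
    have h7 : (p * l) ^ (2 * k + 2) * l ≤ p ^ 2 * l ^ (2 * k + 3) := by
      rw [mul_pow, mul_assoc, ← pow_succ]
      exact mul_le_mul_of_nonneg_right (hpk (2 * k)) (by positivity)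
    have h8 : (2 * K * p * Real.sqrt l * l ^ (k + 1)) ^ 2 =
        4 * K ^ 2 * (p ^ 2 * l ^ (2 * k + 3)) := by
      rw [mul_pow, mul_pow, mul_pow, mul_pow, Real.sq_sqrt hl.le]; ring
    rw [h8]
    have h9 : 0 ≤ p ^ 2 * l ^ (2 * k + 3) := by positivity
    have h10 := mul_le_mul_of_nonneg_left h6 (by linarith : (0 : ℝ) ≤ K)
    have h11 := mul_le_mul_of_nonneg_left h7 (by linarith : (0 : ℝ) ≤ K)
    have h12 : 2 * K ≤ 4 * K ^ 2 := by nlinarith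
    have h13 := mul_le_mul_of_nonneg_right h12 h9
    linarith
  have hgb2 : ‖diagOp e g b‖ ^ 2 =
      ∑ i ∈ t with a i ≤ 3 / 2 * x₁, inner ℝ (e i) b ^ 2 * Real.exp (-(R * a i / 2)) := by
    refine (hasSum_inner_sq e (diagOp e g b)).unique ?_
    have h1 : ∀ i ∉ t, inner ℝ (e i) (diagOp e g b) ^ 2 = 0 := fun i hi => by
      rw [inner_diagOp e hgb, hb i hi]; simp
    have h2 : ∑ i ∈ t with a i ≤ 3 / 2 * x₁, inner ℝ (e i) b ^ 2 * Real.exp (-(R * a i / 2)) =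
        ∑ i ∈ t, inner ℝ (e i) (diagOp e g b) ^ 2 := by
      rw [Finset.sum_filter]
      refine Finset.sum_congr rfl fun i _ => ?_
      rw [inner_diagOp e hgb]
      simp only [hg]
      split_ifs with hi
      · have : Real.exp (-(R * a i / 2)) = Real.exp (-(R * a i / 4)) ^ 2 := by
          rw [← Real.exp_nat_mul]; congr 1; push_cast; ring
        rw [this]; ring
      · simp
    rw [h2]
    exact hasSum_sum_of_ne_finset_zero h1
  have hsum : ‖diagOp e g b‖ ≤ (1 + 3 * p) * Real.sqrt l * (31 / 25 * μ) +
      (j + 1) * (2 * K * p * Real.sqrt l * μ) := by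
    have h1 : diagOp e g b = diagOp e g (b - A h) + diagOp e g (A h) := by
      rw [← map_add, sub_add_cancel]
    rw [h1]
    exact (norm_add_le _ _).trans (add_le_add hnoise hbias)
  rw [← hgb2] at hW
  have h1 : (1 + 3 * p) * Real.sqrt l * (31 / 25 * μ) + (j + 1) * (2 * K * p * Real.sqrt l * μ) =
      (31 / 25 + (93 / 25 + L) * p) * (μ * Real.sqrt l) := by rw [hL]; ring
  rw [h1] at hsum
  have hμl : 0 < μ * Real.sqrt l := by positivity
  -- If `p` were small, then `4 / 3 * (129 / 100) ^ 2 < (3 / 2) ^ 2` would contradict `hW`.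
  by_contra hcon
  push Not at hcon
  have h2 : (4 + L) * p < 1 / 20 := by
    rw [lt_div_iff₀ (by positivity)] at hcon
    linarith
  have h3 : 31 / 25 + (93 / 25 + L) * p < 129 / 100 := by
    have : (93 / 25 + L) * p ≤ (4 + L) * p := mul_le_mul_of_nonneg_right (by linarith) hp0.le
    linarith
  have h4 : ‖diagOp e g b‖ ≤ 129 / 100 * (μ * Real.sqrt l) :=
    hsum.trans (mul_le_mul_of_nonneg_right h3.le hμl.le)
  have h5 := pow_le_pow_left₀ (norm_nonneg _) h4 2
  rw [mul_pow] at h5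
  rw [mul_assoc, mul_pow] at hW
  have h6 := pow_pos hμl 2
  linarith

/-- The constant in the error bound of the stopped conjugate gradient iterate. -/
noncomputable def errorConst (j : ℕ) (τ : ℝ) : ℝ :=
  (3 + 2 * τ) * (20 * (4 + (j + 1) * (2 * decayConst j))) + 2 * (j + 1)

/-- Deterministic analysis of conjugate gradients stopped by the discrepancy principle: for data
`b = A h + noise`, the iteration stops, and it stops with a small error. -/
theorem exists_isLeast_energyNorm_le (hA : ∀ x y, inner ℝ (A x) y = inner ℝ x (A y))
    (ha : ∀ i, A (e i) = a i • e i) (ha0 : ∀ i, 0 ≤ a i) (hfin : {i | a i ≠ 0}.Finite)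
    (hl : 0 < l) {j : ℕ} {v : ℕ → H} {μ : ℝ} (hμ : 0 < μ)
    (hv : ∀ k ≤ j, DualBound A l (μ / l ^ (k + 1)) (v k)) {h : H}
    (hh : h = ∑ k ∈ Finset.range (j + 1), (A ^ k) (v k)) {b : H}
    (hn : DualBound A l (31 / 25 * μ) (b - A h)) (hker : ∀ i, a i = 0 → inner ℝ (e i) b = 0)
    {τ : ℝ} (hτ : 3 / 2 < τ) {f : ℕ → H}
    (hf : ∀ m, ∃ q ∈ degreeLT ℝ m, f m = aeval A q b)
    (hmin : ∀ m, ∀ q ∈ degreeLT ℝ m, ‖A (f m) - b‖ ≤ ‖A (aeval A q b) - b‖) :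
    ∃ m, IsLeast {m | ‖A (f m) - b‖ < τ * μ * Real.sqrt l} m ∧
      energyNorm A l (f m - h) ≤ errorConst j τ * μ := by
  classical
  have hsl := Real.sqrt_pos.2 hl
  set Ω := τ * μ * Real.sqrt l with hΩ
  have hΩ0 : 0 < Ω := by positivity
  set t := hfin.toFinset with ht
  have hmem : ∀ i, i ∈ t ↔ a i ≠ 0 := fun i => by simp [ht]
  have hb : ∀ i ∉ t, inner ℝ (e i) b = 0 := fun i hi => hker i (by simpa [hmem] using hi)
  have hex : ∃ m, ‖A (f m) - b‖ < Ω := by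
    obtain ⟨m, q, hq, h0⟩ := exists_aeval_eq e hA ha (fun i hi => (hmem i).1 hi) hb
    refine ⟨m, (hmin m q hq).trans_lt ?_⟩
    rw [norm_sub_rev, h0, norm_zero]
    exact hΩ0
  set m := Nat.find hex with hm
  refine ⟨m, ⟨Nat.find_spec hex, fun k hk => Nat.find_min' hex hk⟩, ?_⟩
  set T := 20 * (4 + (j + 1) * (2 * decayConst j)) with hT
  have hT1 : 1 ≤ T := by
    have h1 : 0 ≤ decayConst j := by rw [decayConst]; positivity
    have h2 : 0 ≤ (j + 1) * (2 * decayConst j) := by positivity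
    rw [hT]; linarith
  have hp1 : 1 / T ≤ 1 := by rw [div_le_one (by linarith)]; exact hT1
  have hp0 : 0 < 1 / T := by positivity
  obtain ⟨q, hq, hfq⟩ := hf m
  have hqres : ∀ x, 0 ≤ x → x ≤ 1 / T * l → 0 ≤ (1 - X * q).eval x ∧ (1 - X * q).eval x ≤ 1 ∧
      1 - (1 - X * q).eval x ≤ (1 / T * l)⁻¹ * x := by
    rcases Nat.eq_zero_or_pos m with hm0 | hm0
    · have hq0 : q = 0 := by
        rw [hm0, mem_degreeLT] at hq
        by_contra hne
        rw [degree_eq_natDegree hne] at hq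
        exact absurd hq (by exact_mod_cast Nat.not_lt_zero _)
      intro x hx _
      have : 0 ≤ (1 / T * l)⁻¹ * x := by positivity
      simpa [hq0] using this
    have hprev : Ω ≤ ‖A (f (m - 1)) - b‖ := by
      have := Nat.find_min hex (m := m - 1) (by omega)
      exact not_lt.1 this
    have hnorm : ∀ q : ℝ[X], ‖A (aeval A q b) - b‖ ^ 2 =
        ∑ i ∈ t, inner ℝ (e i) b ^ 2 * (1 - X * q).eval (a i) ^ 2 := fun q => by
      rw [norm_sub_rev, ← aeval_one_sub_X_mul, norm_sq_aeval e hA ha hb]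
    obtain ⟨x₁, R, hx₁, hR, hW, hr⟩ := exists_smallest_root (t := t) (a := a)
      (c := fun i => inner ℝ (e i) b ^ 2) (r := 1 - X * q) (W := Ω ^ 2) hm0
      (fun i hi => (ha0 i).lt_of_ne' ((hmem i).1 hi)) (fun i _ => sq_nonneg _) (by simp)
      (natDegree_one_sub_X_mul_le hq)
      (fun p hpm hp0 => by
        obtain ⟨q', hq', rfl⟩ := exists_eq_one_sub_X_mul hpm hp0
        rw [← hnorm, ← hnorm, ← hfq]
        exact pow_le_pow_left₀ (norm_nonneg _) (hmin m q' hq') 2) (by positivity)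
      (fun p hpm hp0 => by
        obtain ⟨q', hq', rfl⟩ := exists_eq_one_sub_X_mul (m := m - 1) (by omega) hp0
        rw [← hnorm]
        exact pow_le_pow_left₀ hΩ0.le (hprev.trans (hmin (m - 1) q' hq')) 2)
    have hslope := slope_le e hA ha ha0 hl hμ hv hh hn hb hx₁ hR (le_trans (by
      refine pow_le_pow_left₀ (by positivity) ?_ 2
      rw [hΩ]
      gcongr) hW)
    rw [← hT] at hslope
    intro x hx hxT
    have hxx : x ≤ x₁ := by
      have h1 : x₁⁻¹ ≤ (1 / T * l)⁻¹ := by linarith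
      exact hxT.trans ((inv_le_inv₀ hx₁ (by positivity)).1 h1)
    obtain ⟨h1, h2, h3⟩ := hr x hx hxx
    exact ⟨h1, h2, h3.trans (mul_le_mul_of_nonneg_right hslope hx)⟩
  have hlt : ‖A (f m) - b‖ < Ω := Nat.find_spec hex
  rw [hfq] at hlt
  have hfinal := energyNorm_sub_le e hA ha ha0 hl hμ.le hv hh (by positivity) hn hker hp0 hp1
    hlt.le hqres
  rw [hfq]
  refine hfinal.trans ?_
  have h1 : 2 / (1 / T) = 2 * T := by field_simp
  have h2 : 2 / (1 / T * Real.sqrt l) * Ω = 2 * T * τ * μ := by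
    rw [hΩ]; field_simp
  rw [h1, h2, errorConst, ← hT]
  have h3 := mul_pos (lt_of_lt_of_le one_pos hT1) hμ
  linarith

end ConjugateGradientAnalysis


/-! ### The source condition -/

section Population

open ContinuousLinearMap

variable {E H : Type*} [NormedAddCommGroup E] [InnerProductSpace ℝ E] [CompleteSpace E]
  [NormedAddCommGroup H] [InnerProductSpace ℝ H] [CompleteSpace H] {ι : Type*}
  {J : H →L[ℝ] E} (b : HilbertBasis ι ℝ E) {ξ : ι → ℝ}

theorem inner_eigen_comp_adjoint (hJ : ∀ i, J (adjoint J (b i)) = ξ i • b i) (i : ι) (x : E) :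
    inner ℝ (b i) (J (adjoint J x)) = ξ i * inner ℝ (b i) x := by
  rw [← adjoint_inner_left, adjoint_inner_right, hJ, real_inner_smul_left]

theorem norm_adjoint_sq (hJ : ∀ i, J (adjoint J (b i)) = ξ i • b i) (x : E) :
    HasSum (fun i => ξ i * inner ℝ (b i) x ^ 2) (‖adjoint J x‖ ^ 2) := by
  have h1 : ‖adjoint J x‖ ^ 2 = inner ℝ (J (adjoint J x)) x := by
    rw [← real_inner_self_eq_norm_sq, adjoint_inner_right]
  rw [h1]
  refine (b.hasSum_inner_mul_inner (J (adjoint J x)) x).congr_fun fun i => ?_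
  rw [real_inner_comm (b i), inner_eigen_comp_adjoint b hJ]
  ring

theorem eigen_nonneg (hJ : ∀ i, J (adjoint J (b i)) = ξ i • b i) (i : ι) : 0 ≤ ξ i := by
  have h1 : inner ℝ (b i) (J (adjoint J (b i))) = ξ i := by
    rw [inner_eigen_comp_adjoint b hJ, real_inner_self_eq_norm_sq, b.orthonormal.1 i]; ring
  rw [← h1, ← adjoint_inner_left]
  exact real_inner_self_nonneg

theorem energyNorm_adjoint_comp_sq {l : ℝ} (hl : 0 ≤ l) (y : H) :
    energyNorm (adjoint J ∘L J) l y ^ 2 = ‖J y‖ ^ 2 + l * ‖y‖ ^ 2 := by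
  have h1 : inner ℝ ((adjoint J ∘L J) y) y = ‖J y‖ ^ 2 := by
    rw [comp_apply, adjoint_inner_left, real_inner_self_eq_norm_sq]
  rw [energyNorm, h1, Real.sq_sqrt (by positivity)]

theorem norm_le_energyNorm {l : ℝ} (hl : 0 ≤ l) (y : H) :
    ‖J y‖ ≤ energyNorm (adjoint J ∘L J) l y := by
  refine le_of_sq_le_sq ?_ (energyNorm_nonneg _ _ _)
  rw [energyNorm_adjoint_comp_sq hl]
  have : 0 ≤ l * ‖y‖ ^ 2 := by positivity
  linarith

/-- A vector supported on the eigenvalues below `l` gains the factor `1 / √2` in the dual bound,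
because `x / (x + l) ≤ 1 / 2` there. -/
theorem dualBound_adjoint_of_low (hJ : ∀ i, J (adjoint J (b i)) = ξ i • b i) {l B : ℝ} (hl : 0 < l)
    {d : E} (hd : ‖d‖ ≤ B) (hlow : ∀ i, l ≤ ξ i → inner ℝ (b i) d = 0) :
    DualBound (adjoint J ∘L J) l (Real.sqrt (1 / 2) * B) (adjoint J d) := fun y => by
  set P := diagOp b fun i => if ξ i < l then (1 : ℝ) else 0 with hP
  have hPb : ∀ i, |if ξ i < l then (1 : ℝ) else 0| ≤ 1 := fun i => by split_ifs <;> simp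
  set w := P (J y) with hw
  have hwi : ∀ i, inner ℝ (b i) w = (if ξ i < l then 1 else 0) * inner ℝ (b i) (J y) :=
    fun i => inner_diagOp b hPb i _
  have h1 : inner ℝ d (J y) = inner ℝ d w := by
    rw [← b.tsum_inner_mul_inner d (J y), ← b.tsum_inner_mul_inner d w]
    refine tsum_congr fun i => ?_
    rw [hwi]
    split_ifs with h
    · rw [one_mul]
    · rw [real_inner_comm, hlow i (not_lt.1 h)]; simp
  have h2 : ‖w‖ ≤ ‖J y‖ := norm_le_of_abs_inner_le b b fun i => by
    rw [hwi]; split_ifs <;> simp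
  have h3 : ‖adjoint J w‖ ≤ Real.sqrt l * ‖w‖ := by
    refine le_of_sq_le_sq ?_ (by positivity)
    rw [mul_pow, Real.sq_sqrt hl.le]
    refine hasSum_le (fun i => ?_) (norm_adjoint_sq b hJ w) ((hasSum_inner_sq b w).mul_left l)
    by_cases h : ξ i < l
    · exact mul_le_mul_of_nonneg_right h.le (sq_nonneg _)
    · rw [hwi, if_neg h]; simp
  have h4 : ‖w‖ * ‖w‖ ≤ Real.sqrt l * ‖y‖ * ‖w‖ := by
    have h5 : inner ℝ w w = inner ℝ w (J y) := by
      rw [← b.tsum_inner_mul_inner w w, ← b.tsum_inner_mul_inner w (J y)]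
      refine tsum_congr fun i => ?_
      rw [hwi, real_inner_comm, hwi]
      split_ifs <;> simp
    rw [← real_inner_self_eq_norm_mul_norm, h5, ← adjoint_inner_left]
    refine (real_inner_le_norm _ _).trans ?_
    have := mul_le_mul_of_nonneg_right h3 (norm_nonneg y)
    linarith
  have h6 : ‖w‖ ≤ Real.sqrt l * ‖y‖ := by
    by_cases h0 : ‖w‖ = 0
    · rw [h0]; positivity
    · exact le_of_mul_le_mul_right h4 (lt_of_le_of_ne (norm_nonneg _) (Ne.symm h0))
  have h7 : ‖w‖ ≤ Real.sqrt (1 / 2) * energyNorm (adjoint J ∘L J) l y := by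
    refine le_of_sq_le_sq ?_ (mul_nonneg (Real.sqrt_nonneg _) (energyNorm_nonneg _ _ _))
    rw [mul_pow, Real.sq_sqrt (by norm_num), energyNorm_adjoint_comp_sq hl.le]
    have h8 := pow_le_pow_left₀ (norm_nonneg w) h2 2
    have h9 := pow_le_pow_left₀ (norm_nonneg w) h6 2
    rw [mul_pow, Real.sq_sqrt hl.le] at h9
    linarith
  rw [adjoint_inner_left, h1]
  have hB : 0 ≤ B := (norm_nonneg d).trans hd
  calc inner ℝ d w ≤ ‖d‖ * ‖w‖ := real_inner_le_norm _ _
    _ ≤ B * (Real.sqrt (1 / 2) * energyNorm (adjoint J ∘L J) l y) :=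
        mul_le_mul hd h7 (norm_nonneg _) hB
    _ = _ := by ring

theorem pow_adjoint_comp_apply (k : ℕ) (x : E) :
    ((adjoint J ∘L J) ^ k) (adjoint J x) = adjoint J (((J ∘L adjoint J) ^ k) x) := by
  induction k with
  | zero => simp
  | succ k ih => rw [pow_succ', mul_apply_eq_comp, ih, pow_succ', mul_apply_eq_comp]; rfl

theorem rpow_mul_rpow_le {κ l x p q : ℝ} (hl : 0 < l) (hlx : l ≤ x) (hxκ : x ≤ κ) (hq : 0 ≤ q)
    (hpq : p ≤ q) : (l / κ) ^ q * x ^ p ≤ l ^ p := by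
  have hx := hl.trans_le hlx
  have hκ := hx.trans_le hxκ
  have hℓ1 : l / κ ≤ 1 := (div_le_one hκ).2 (hlx.trans hxκ)
  rcases le_total p 0 with hp | hp
  · calc (l / κ) ^ q * x ^ p ≤ 1 * l ^ p := by
          refine mul_le_mul (Real.rpow_le_one (by positivity) hℓ1 hq)
            (Real.rpow_le_rpow_of_nonpos hl hlx hp) (by positivity) zero_le_one
      _ = l ^ p := one_mul _
  · calc (l / κ) ^ q * x ^ p ≤ (l / x) ^ p * x ^ p := by
          refine mul_le_mul_of_nonneg_right ?_ (by positivity)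
          refine (Real.rpow_le_rpow_of_exponent_ge (by positivity) hℓ1 hpq).trans ?_
          exact Real.rpow_le_rpow (by positivity) (div_le_div_of_nonneg_left hl.le hx hxκ) hp
      _ = l ^ p := by rw [← Real.mul_rpow (by positivity) hx.le, div_mul_cancel₀ _ hx.ne']

/-- Spectral cut-off at the level `l` under a source condition: the part of `g` above the cut-off
is `J h` with `h = (J† J)^j y`, where `j` is a natural number at least `r`. -/
theorem exists_source_vector (hJ : ∀ i, J (adjoint J (b i)) = ξ i • b i) {κ l r ρ : ℝ} {j : ℕ}
    (hl : 0 < l) (hlκ : l ≤ κ) (hξκ : ∀ i, ξ i ≤ κ) (hr : 0 ≤ r) (hrj : r ≤ j) {u g : E}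
    (hug : ∀ i, inner ℝ (b i) g = ξ i ^ r * inner ℝ (b i) u) (hu : ‖u‖ ≤ κ ^ (-r) * ρ) :
    ∃ y : H,
      ‖g - J (((adjoint J ∘L J) ^ j) y)‖ ≤ (l / κ) ^ r * ρ ∧
      DualBound (adjoint J ∘L J) l (Real.sqrt (1 / 2) * ((l / κ) ^ r * ρ))
        (adjoint J (g - J (((adjoint J ∘L J) ^ j) y))) ∧
      (∀ k ≤ j, (l / κ) ^ max (r - 1 / 2) 0 * ‖((adjoint J ∘L J) ^ k) y‖ ≤
        l ^ ((k : ℝ) - j - 1 / 2) * ((l / κ) ^ r * ρ)) ∧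
      ‖y‖ ≤ l ^ (-(j : ℝ) - 1 / 2) * ((l / κ) ^ r * ρ) := by
  have hκ : 0 < κ := hl.trans_le hlκ
  have hξ0 := eigen_nonneg b hJ
  have hu' : l ^ r * ‖u‖ ≤ (l / κ) ^ r * ρ := by
    refine (mul_le_mul_of_nonneg_left hu (by positivity)).trans_eq ?_
    rw [Real.div_rpow hl.le hκ.le, Real.rpow_neg hκ.le]
    ring
  set ψ : ι → ℝ := fun i => if l ≤ ξ i then ξ i ^ (r - 1 - j) else 0 with hψ
  have hψb : ∀ i, |ψ i| ≤ l ^ (r - 1 - j) := fun i => by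
    simp only [hψ]; split_ifs with h
    · rw [abs_of_nonneg (Real.rpow_nonneg (hξ0 i) _)]
      exact Real.rpow_le_rpow_of_nonpos hl h (by linarith)
    · rw [abs_zero]; positivity
  have hKsym : ∀ x y : E, inner ℝ ((J ∘L adjoint J) x) y = inner ℝ x ((J ∘L adjoint J) y) :=
    fun x y => (adjoint_inner_right J _ _).symm.trans (adjoint_inner_left J _ _)
  have hKb : ∀ i, (J ∘L adjoint J) (b i) = ξ i • b i := hJ
  have hcoord : ∀ k i, inner ℝ (b i) (((J ∘L adjoint J) ^ k) (diagOp b ψ u)) =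
      ξ i ^ k * (ψ i * inner ℝ (b i) u) := fun k i => by
    rw [inner_eigen_pow b hKsym hKb, inner_diagOp b hψb]
  -- `‖(J† J)^k y‖` is governed by the powers `ξ ^ (r - 1/2 - j + k)` of the eigenvalues `ξ ≥ l`
  have hnorm : ∀ (k : ℕ) (B : ℝ), 0 ≤ B →
      (∀ x, l ≤ x → x ≤ κ → x ^ (r - 1 / 2 - j + k) ≤ B) →
      ‖((adjoint J ∘L J) ^ k) (adjoint J (diagOp b ψ u))‖ ≤ B * ‖u‖ := by
    intro k B hB hxB
    rw [pow_adjoint_comp_apply]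
    refine le_of_sq_le_sq ?_ (by positivity)
    rw [mul_pow]
    refine hasSum_le (fun i => ?_) (norm_adjoint_sq b hJ _) ((hasSum_inner_sq b u).mul_left (B ^ 2))
    rw [hcoord]
    simp only [hψ]
    split_ifs with h
    · have hpos : 0 < ξ i := hl.trans_le h
      have h1 : ξ i * (ξ i ^ k * (ξ i ^ (r - 1 - j) * inner ℝ (b i) u)) ^ 2 =
          (ξ i ^ (r - 1 / 2 - j + k)) ^ 2 * inner ℝ (b i) u ^ 2 := by
        have h2 : ξ i ^ (r - 1 / 2 - j + k) =
            Real.sqrt (ξ i) * (ξ i ^ k * ξ i ^ (r - 1 - j)) := by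
          rw [Real.sqrt_eq_rpow, ← Real.rpow_natCast, ← Real.rpow_add hpos, ← Real.rpow_add hpos]
          congr 1; ring
        rw [h2, mul_pow (Real.sqrt _), Real.sq_sqrt hpos.le]; ring
      rw [h1]
      refine mul_le_mul_of_nonneg_right ?_ (sq_nonneg _)
      exact pow_le_pow_left₀ (by positivity) (hxB _ h (hξκ i)) 2
    · simp only [zero_mul, mul_zero]
      rw [zero_pow two_ne_zero, mul_zero]
      positivity
  have hdiff : ∀ i, inner ℝ (b i)
      (g - J (((adjoint J ∘L J) ^ j) (adjoint J (diagOp b ψ u)))) =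
      if l ≤ ξ i then 0 else ξ i ^ r * inner ℝ (b i) u := fun i => by
    have h1 : J (((adjoint J ∘L J) ^ j) (adjoint J (diagOp b ψ u))) =
        ((J ∘L adjoint J) ^ (j + 1)) (diagOp b ψ u) := by
      rw [pow_adjoint_comp_apply, pow_succ', mul_apply_eq_comp]; rfl
    rw [h1, inner_sub_right, hcoord, hug]
    simp only [hψ]
    split_ifs with h
    · have hpos : 0 < ξ i := hl.trans_le h
      have h2 : ξ i ^ r = ξ i ^ (j + 1) * ξ i ^ (r - 1 - j) := by
        rw [← Real.rpow_natCast, ← Real.rpow_add hpos]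
        congr 1; push_cast; ring
      rw [h2]; ring
    · simp
  have ha : ‖g - J (((adjoint J ∘L J) ^ j) (adjoint J (diagOp b ψ u)))‖ ≤ (l / κ) ^ r * ρ := by
    refine le_trans ?_ hu'
    rw [← abs_of_nonneg (Real.rpow_nonneg hl.le r), ← Real.norm_eq_abs, ← norm_smul]
    refine norm_le_of_abs_inner_le b b fun i => ?_
    rw [hdiff, inner_smul_right]
    split_ifs with h
    · rw [abs_zero]; positivity
    · rw [abs_mul, abs_mul, abs_of_nonneg (Real.rpow_nonneg (hξ0 i) r),
        abs_of_nonneg (Real.rpow_nonneg hl.le r)]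
      exact mul_le_mul_of_nonneg_right (Real.rpow_le_rpow (hξ0 i) (not_le.1 h).le hr)
        (abs_nonneg _)
  refine ⟨adjoint J (diagOp b ψ u), ha, ?_, fun k hk => ?_, ?_⟩
  · exact dualBound_adjoint_of_low b hJ hl ha fun i hi => by rw [hdiff, if_pos hi]
  · have hkj : (k : ℝ) ≤ j := by exact_mod_cast hk
    have hℓ : 0 < (l / κ) ^ max (r - 1 / 2) 0 := by positivity
    have h1 := hnorm k (l ^ (r - 1 / 2 - j + k) / (l / κ) ^ max (r - 1 / 2) 0) (by positivity)
      fun x hx hx' => by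
        rw [le_div_iff₀ hℓ, mul_comm]
        exact rpow_mul_rpow_le hl hx hx' (le_max_right _ _) (by
          have := le_max_left (r - 1 / 2) 0; linarith)
    have h2 := mul_le_mul_of_nonneg_left h1 hℓ.le
    refine h2.trans ?_
    have h3 : (l / κ) ^ max (r - 1 / 2) 0 *
        (l ^ (r - 1 / 2 - j + k) / (l / κ) ^ max (r - 1 / 2) 0 * ‖u‖) =
        l ^ ((k : ℝ) - j - 1 / 2) * (l ^ r * ‖u‖) := by
      rw [← mul_assoc, mul_div_cancel₀ _ hℓ.ne', ← mul_assoc, ← Real.rpow_add hl]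
      congr 2; ring
    rw [h3]
    exact mul_le_mul_of_nonneg_left hu' (by positivity)
  · have h1 := hnorm 0 (l ^ (r - 1 / 2 - j)) (by positivity) fun x hx hx' => by
      have := Real.rpow_le_rpow_of_nonpos hl hx (z := r - 1 / 2 - j) (by linarith)
      simpa using this
    rw [pow_zero, one_apply_eq_self] at h1
    refine h1.trans ?_
    have h3 : l ^ (r - 1 / 2 - j) * ‖u‖ = l ^ (-(j : ℝ) - 1 / 2) * (l ^ r * ‖u‖) := by
      rw [← mul_assoc, ← Real.rpow_add hl]
      congr 2; ring
    rw [h3]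
    exact mul_le_mul_of_nonneg_left hu' (by positivity)

end Population

/-! ### Comparison of the population and the empirical covariance operators -/

section Comparison

variable {H : Type*} [NormedAddCommGroup H] [InnerProductSpace ℝ H]

theorem energyNorm_le_of_perturbation {S A : H →L[ℝ] H} {l ε : ℝ} (hl : 0 < l)
    (hS : ∀ y, 0 ≤ inner ℝ (S y) y) (hA : ∀ y, 0 ≤ inner ℝ (A y) y)
    (hε : ε ≤ Real.sqrt l / 5)
    (hSA : ∀ z y, inner ℝ ((S - A) z) y ≤ ε * ‖z‖ * energyNorm S l y) (y : H) :
    energyNorm S l y ≤ 1119 / 1000 * energyNorm A l y := by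
  have hsl := Real.sqrt_pos.2 hl
  set s := energyNorm S l y with hs
  have hs0 : 0 ≤ s := energyNorm_nonneg _ _ _
  have h1 : s ^ 2 = inner ℝ (S y) y + l * ‖y‖ ^ 2 := by
    rw [hs, energyNorm, Real.sq_sqrt]
    have := hS y
    positivity
  have h2 : energyNorm A l y ^ 2 = inner ℝ (A y) y + l * ‖y‖ ^ 2 := by
    rw [energyNorm, Real.sq_sqrt]
    have := hA y
    positivity
  have h3 := hSA y y
  rw [sub_apply, inner_sub_left] at h3
  have h4 : Real.sqrt l * ‖y‖ ≤ s := by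
    refine le_of_sq_le_sq ?_ hs0
    rw [mul_pow, Real.sq_sqrt hl.le, h1]
    linarith [hS y]
  have h5 : ε * ‖y‖ * s ≤ 1 / 5 * s ^ 2 := by
    have h6 : ε * ‖y‖ ≤ 1 / 5 * s := by
      have := mul_le_mul_of_nonneg_right hε (norm_nonneg y)
      linarith
    have := mul_le_mul_of_nonneg_right h6 hs0
    linarith
  refine le_of_sq_le_sq ?_ (mul_nonneg (by norm_num) (energyNorm_nonneg _ _ _))
  rw [mul_pow, h2]
  have h7 : 0 ≤ l * ‖y‖ ^ 2 := by positivity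
  have := hA y
  linarith

theorem pow_apply_eq_sum (S A : H →L[ℝ] H) (j : ℕ) (y : H) :
    (S ^ j) y = (A ^ j) y + ∑ k ∈ Finset.range j, (A ^ k) ((S - A) ((S ^ (j - 1 - k)) y)) := by
  induction j generalizing y with
  | zero => simp
  | succ j ih =>
    have h1 : ∀ (T : H →L[ℝ] H) (k : ℕ), (T ^ (k + 1)) y = (T ^ k) (T y) := fun T k => by
      rw [pow_succ, mul_apply_eq_comp]
    rw [h1 S, ih (S y), Finset.sum_range_succ, h1 A]
    have h2 : ∑ k ∈ Finset.range j, (A ^ k) ((S - A) ((S ^ (j - 1 - k)) (S y))) =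
        ∑ k ∈ Finset.range j, (A ^ k) ((S - A) ((S ^ (j + 1 - 1 - k)) y)) := by
      refine Finset.sum_congr rfl fun k hk => ?_
      have := Finset.mem_range.1 hk
      rw [← h1 S, show j - 1 - k + 1 = j + 1 - 1 - k by omega]
    rw [h2, show j + 1 - 1 - j = 0 by omega, pow_zero, one_apply_eq_self, sub_apply, map_sub]
    abel

end Comparison


/-! ### The effective dimension -/

section Trace

open ContinuousLinearMap

variable {ι ι' E H : Type*} [NormedAddCommGroup E] [InnerProductSpace ℝ E] [CompleteSpace E]
  [NormedAddCommGroup H] [InnerProductSpace ℝ H] [CompleteSpace H]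
  (b : HilbertBasis ι ℝ E) {ξ : ι → ℝ} {J : H →L[ℝ] E}

/-- The operator `J J† + l` is invertible, and its inverse is diagonal in `b`. -/
theorem inverse_comp_adjoint_add_apply (hJ : ∀ i, J (adjoint J (b i)) = ξ i • b i) {l : ℝ}
    (hl : 0 < l) {σ : ℝ} (hσ : 0 ≤ σ) {v : E} (hv : J (adjoint J v) = σ • v) :
    Ring.inverse (J ∘L adjoint J + l • (1 : E →L[ℝ] E)) v = (σ + l)⁻¹ • v := by
  have hξ := eigen_nonneg b hJ
  set K := J ∘L adjoint J + l • (1 : E →L[ℝ] E) with hK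
  set G := diagOp b fun i => (ξ i + l)⁻¹ with hG
  have hGb : ∀ i, |(ξ i + l)⁻¹| ≤ l⁻¹ := fun i => by
    have := hξ i
    rw [abs_of_pos (by positivity)]
    exact inv_anti₀ hl (by linarith)
  have hKi : ∀ i x, inner ℝ (b i) (K x) = (ξ i + l) * inner ℝ (b i) x := fun i x => by
    have h1 : K x = J (adjoint J x) + l • x := rfl
    rw [h1, inner_add_right, inner_eigen_comp_adjoint b hJ, inner_smul_right]
    ring
  have hne : ∀ i, ξ i + l ≠ 0 := fun i => by
    have := hξ i
    positivity
  have h1 : K * G = 1 := ContinuousLinearMap.ext fun x => ext_inner_basis b fun i => by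
    rw [mul_apply_eq_comp, hKi, inner_diagOp b hGb, one_apply_eq_self,
      mul_inv_cancel_left₀ (hne i)]
  have h2 : G * K = 1 := ContinuousLinearMap.ext fun x => ext_inner_basis b fun i => by
    rw [mul_apply_eq_comp, inner_diagOp b hGb, hKi, one_apply_eq_self,
      inv_mul_cancel_left₀ (hne i)]
  have h3 : Ring.inverse K = G := Ring.inverse_unit (⟨K, G, h1, h2⟩ : (E →L[ℝ] E)ˣ)
  have h4 : K v = (σ + l) • v := by
    have h1 : K v = J (adjoint J v) + l • v := rfl
    rw [h1, hv, add_smul]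
  rw [h3, eq_inv_smul_iff₀ (by positivity), ← map_smul, ← h4, ← mul_apply_eq_comp, h2,
    one_apply_eq_self]

/-- The intrinsic dimensionality of `J J†` bounds the effective dimension of `J† J`. -/
theorem sum_eigen_div_le (hJ : ∀ i, J (adjoint J (b i)) = ξ i • b i) {κ s D lmax : ℝ}
    (hID : IntrinsicDim (J ∘L adjoint J) κ s D lmax) {l : ℝ} (hl : 0 < l) (hlm : l ≤ lmax)
    (hκ : 0 < κ) (e : HilbertBasis ι' ℝ H) {σ : ι' → ℝ}
    (he : ∀ i, adjoint J (J (e i)) = σ i • e i) (t : Finset ι') :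
    ∑ i ∈ t, σ i / (σ i + l) ≤ D ^ 2 * (κ⁻¹ * l) ^ (-s) := by
  classical
  have hin : ∀ i j, inner ℝ (J (e i)) (J (e j)) = if i = j then σ i else 0 := fun i j => by
    rw [← adjoint_inner_left, he, real_inner_smul_left, orthonormal_iff_ite.1 e.orthonormal]
    simp
  have hσ : ∀ i, 0 ≤ σ i := fun i => by
    have := hin i i
    rw [if_pos rfl, real_inner_self_eq_norm_sq] at this
    rw [← this]
    positivity
  set t' := t.filter fun i => σ i ≠ 0 with ht'
  have hpos : ∀ i ∈ t', 0 < σ i := fun i hi =>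
    lt_of_le_of_ne (hσ i) (Ne.symm (Finset.mem_filter.1 hi).2)
  set v : ι' → E := fun i => (Real.sqrt (σ i))⁻¹ • J (e i) with hv
  have hvv : ∀ i ∈ t', ∀ j, inner ℝ (v i) (v j) = if i = j then 1 else 0 := fun i hi j => by
    have h0 := Real.sqrt_pos.2 (hpos i hi)
    simp only [hv, real_inner_smul_left, real_inner_smul_right, hin]
    split_ifs with hij
    · subst hij
      rw [← mul_assoc, ← mul_inv, Real.mul_self_sqrt (hσ i), inv_mul_cancel₀ (hpos i hi).ne']
    · simp
  have hinj : Set.InjOn v t' := fun i hi j hj hij => by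
    by_contra hne
    have h1 := hvv i hi j
    rw [if_neg hne, ← hij, hvv i hi i, if_pos rfl] at h1
    exact one_ne_zero h1
  have hon : Orthonormal ℝ ((↑) : t'.image v → E) := by
    constructor
    · rintro ⟨x, hx⟩
      obtain ⟨i, hi, rfl⟩ := Finset.mem_image.1 hx
      have h1 := hvv i hi i
      rw [if_pos rfl, real_inner_self_eq_norm_sq] at h1
      exact (pow_eq_one_iff_of_nonneg (norm_nonneg _) two_ne_zero).1 h1
    · rintro ⟨x, hx⟩ ⟨y, hy⟩ hxy
      obtain ⟨i, hi, rfl⟩ := Finset.mem_image.1 hx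
      obtain ⟨j, hj, rfl⟩ := Finset.mem_image.1 hy
      simp only
      rw [hvv i hi j, if_neg]
      rintro rfl
      exact hxy rfl
  have h1 := (le_iSup₂ (f := fun (t : Finset E) (_ : Orthonormal ℝ ((↑) : t → E)) =>
    ENNReal.ofReal (∑ x ∈ t, inner ℝ x (((J ∘L adjoint J) *
      Ring.inverse (J ∘L adjoint J + l • (1 : E →L[ℝ] E))) x))) _ hon).trans (hID l hl hlm)
  rw [ENNReal.ofReal_le_ofReal_iff (by positivity), Finset.sum_image hinj] at h1
  refine le_trans (le_of_eq ?_) h1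
  rw [← Finset.sum_filter_add_sum_filter_not t fun i => σ i ≠ 0]
  rw [Finset.sum_eq_zero (s := t.filter fun i => ¬ σ i ≠ 0), add_zero]
  · refine Finset.sum_congr rfl fun i hi => ?_
    have h2 : J (adjoint J (v i)) = σ i • v i := by
      simp only [hv, map_smul, he]
      rw [smul_comm]
    rw [mul_apply_eq_comp, inverse_comp_adjoint_add_apply b hJ hl (hσ i) h2, map_smul, comp_apply,
      h2, inner_smul_right, inner_smul_right, hvv i hi i, if_pos rfl, mul_one]
    ring
  · intro i hi
    have : σ i = 0 := not_not.1 (Finset.mem_filter.1 hi).2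
    rw [this, zero_div]

end Trace

/-! ### Whitening -/

section Whitening

variable {ι H : Type*} [NormedAddCommGroup H] [InnerProductSpace ℝ H] (e : HilbertBasis ι ℝ H)

theorem abs_sqrt_le {σ : ι → ℝ} {l : ℝ} {S : H →L[ℝ] H} (he : ∀ i, S (e i) = σ i • e i)
    (i : ι) : |Real.sqrt (σ i + l)| ≤ Real.sqrt (‖S‖ + l) := by
  rw [abs_of_nonneg (by positivity)]
  exact Real.sqrt_le_sqrt (by linarith [eigenvalue_le_norm e he i, le_abs_self (σ i)])

variable [CompleteSpace H] (σ : ι → ℝ) (l : ℝ)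

/-- The operator `(S + l)^(-1/2)`, for `S` with eigenbasis `e` and eigenvalues `σ`. -/
noncomputable def whiten : H →L[ℝ] H := diagOp e fun i => (Real.sqrt (σ i + l))⁻¹

/-- The operator `(S + l)^(1/2)`, for `S` with eigenbasis `e` and eigenvalues `σ`. -/
noncomputable def unwhiten : H →L[ℝ] H := diagOp e fun i => Real.sqrt (σ i + l)

variable {σ l}

theorem abs_inv_sqrt_le (hσ : ∀ i, 0 ≤ σ i) (hl : 0 < l) (i : ι) :
    |(Real.sqrt (σ i + l))⁻¹| ≤ (Real.sqrt l)⁻¹ := by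
  rw [abs_of_nonneg (by positivity)]
  exact inv_anti₀ (Real.sqrt_pos.2 hl) (Real.sqrt_le_sqrt (by linarith [hσ i]))

theorem norm_whiten_le (hσ : ∀ i, 0 ≤ σ i) (hl : 0 < l) (x : H) :
    ‖whiten e σ l x‖ ≤ (Real.sqrt l)⁻¹ * ‖x‖ := by
  have := norm_diagOp_le e (abs_inv_sqrt_le hσ hl) x
  rwa [abs_of_nonneg (by positivity)] at this

theorem hasSum_norm_whiten_sq (hσ : ∀ i, 0 ≤ σ i) (hl : 0 < l) (x : H) :
    HasSum (fun i => (σ i + l)⁻¹ * inner ℝ (e i) x ^ 2) (‖whiten e σ l x‖ ^ 2) := by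
  refine (hasSum_inner_sq e _).congr_fun fun i => ?_
  rw [whiten, inner_diagOp e (abs_inv_sqrt_le hσ hl), mul_pow, inv_pow,
    Real.sq_sqrt (by linarith [hσ i])]

theorem inner_whiten_unwhiten (hσ : ∀ i, 0 ≤ σ i) (hl : 0 < l) {S : H →L[ℝ] H}
    (he : ∀ i, S (e i) = σ i • e i) (x y : H) :
    inner ℝ (whiten e σ l x) (unwhiten e σ l y) = inner ℝ x y := by
  rw [whiten, inner_diagOp_comm e (abs_inv_sqrt_le hσ hl)]
  congr 1
  refine ext_inner_basis e fun i => ?_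
  have : 0 < Real.sqrt (σ i + l) := Real.sqrt_pos.2 (by linarith [hσ i])
  rw [inner_diagOp e (abs_inv_sqrt_le hσ hl), unwhiten, inner_diagOp e (abs_sqrt_le e he),
    inv_mul_cancel_left₀ this.ne']

theorem norm_unwhiten (hσ : ∀ i, 0 ≤ σ i) (hl : 0 < l) {S : H →L[ℝ] H}
    (hS : ∀ x y, inner ℝ (S x) y = inner ℝ x (S y)) (he : ∀ i, S (e i) = σ i • e i) (y : H) :
    ‖unwhiten e σ l y‖ = energyNorm S l y := by
  rw [energyNorm, ← Real.sqrt_sq (norm_nonneg _)]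
  congr 1
  refine (hasSum_inner_sq e _).unique ((hasSum_energy e hS he l y).congr_fun fun i => ?_)
  rw [unwhiten, inner_diagOp e (abs_sqrt_le e he), mul_pow,
    Real.sq_sqrt (by linarith [hσ i])]

end Whitening


/-! ### Moments of the whitened feature map and of the responses -/

section Moments

open ContinuousLinearMap

variable {X : Type*} [MeasurableSpace X] {H : Type*} [NormedAddCommGroup H]
  [InnerProductSpace ℝ H] [CompleteSpace H] [RKHS ℝ H X ℝ] {κ : ℝ}
  (hk : Measurable (Function.uncurry (ker (X := X) H))) (hb : ∀ x : X, ker H x x ≤ κ)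

/-- The second moment of the whitened feature map is bounded by the effective dimension. -/
theorem integral_norm_whiten_feat_sq_le [TopologicalSpace.SeparableSpace H] (ν : Measure X)
    [IsProbabilityMeasure ν] {ι : Type*} (e : HilbertBasis ι ℝ H) {σ : ι → ℝ}
    (he : ∀ i, adjoint (inclusion H hk hb ν) (inclusion H hk hb ν (e i)) = σ i • e i)
    {l T : ℝ} (hl : 0 < l) (hT : ∀ t : Finset ι, ∑ i ∈ t, σ i / (σ i + l) ≤ T) :
    ∫ x, ‖whiten e σ l (feat H x)‖ ^ 2 ∂ν ≤ T := by
  have := countable_of_hilbertBasis e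
  have hint : ∀ i, ∫ x, inner ℝ (e i) (feat H x) ^ 2 ∂ν = σ i := fun i => by
    have h1 : ∫ x, inner ℝ (e i) (feat H x) ^ 2 ∂ν = ∫ x, e i x * e i x ∂ν := by
      simp_rw [inner_feat', sq]
    rw [h1, ← inner_inclusion_inclusion hk hb, ← adjoint_inner_left, he, real_inner_smul_left,
      real_inner_self_eq_norm_sq, e.orthonormal.1 i]
    ring
  have hσ : ∀ i, 0 ≤ σ i := fun i => by
    rw [← hint i]
    exact integral_nonneg fun x => sq_nonneg _
  have hmeas : ∀ i, Measurable fun x => inner ℝ (e i) (feat H x) := fun i => by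
    simp_rw [inner_feat']
    exact measurable_apply hk (e i)
  have hii : ∀ i, Integrable (fun x => (σ i + l)⁻¹ * inner ℝ (e i) (feat H x) ^ 2) ν := fun i => by
    have h1 := (memLp_apply H hk hb ν (e i)).integrable_sq.const_mul (σ i + l)⁻¹
    simpa only [inner_feat'] using h1
  have h0 : ∀ x i, 0 ≤ (σ i + l)⁻¹ * inner ℝ (e i) (feat H x) ^ 2 := fun x i => by
    have := hσ i
    positivity
  refine le_of_tendsto' (tendsto_integral_filter_of_dominated_convergence
    (l := (Filter.atTop : Filter (Finset ι)))
    (F := fun s x => ∑ i ∈ s, (σ i + l)⁻¹ * inner ℝ (e i) (feat H x) ^ 2)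
    (fun x => ((Real.sqrt l)⁻¹ * Real.sqrt κ) ^ 2) ?_ ?_ (integrable_const _) ?_) fun s => ?_
  · refine Filter.Eventually.of_forall fun s => Measurable.aestronglyMeasurable ?_
    exact Finset.measurable_fun_sum _ fun i _ => ((hmeas i).pow_const 2).const_mul _
  · refine Filter.Eventually.of_forall fun s => Filter.Eventually.of_forall fun x => ?_
    rw [Real.norm_of_nonneg (Finset.sum_nonneg fun i _ => h0 x i)]
    refine (sum_le_hasSum s (fun i _ => h0 x i) (hasSum_norm_whiten_sq e hσ hl (feat H x))).trans ?_
    refine pow_le_pow_left₀ (norm_nonneg _) ((norm_whiten_le e hσ hl _).trans ?_) 2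
    exact mul_le_mul_of_nonneg_left (norm_feat_le hb x) (by positivity)
  · exact Filter.Eventually.of_forall fun x => hasSum_norm_whiten_sq e hσ hl (feat H x)
  · rw [integral_finsetSum _ fun i _ => hii i]
    refine le_trans (le_of_eq (Finset.sum_congr rfl fun i _ => ?_)) (hT s)
    rw [integral_const_mul, hint, inv_mul_eq_div]

/-- `E[Y h(X)] = E[f(X) h(X)]` for the regression function `f`. -/
theorem integral_mul_apply_eq (hk : Measurable (Function.uncurry (ker (X := X) H)))
    (hb : ∀ x : X, ker H x x ≤ κ) {P : Measure (X × ℝ)} [IsProbabilityMeasure P] {f : X → ℝ}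
    (hf : IsRegressionFunction P f) (h : H) :
    ∫ z : X × ℝ, z.2 * h z.1 ∂P = ∫ x, f x * h x ∂P.fst := by
  obtain ⟨hf2, hY, hc⟩ := hf
  have hfst : MeasurePreserving (Prod.fst : X × ℝ → X) P P.fst := ⟨measurable_fst, rfl⟩
  have hfi : Integrable f P.fst := hf2.integrable (by norm_num)
  have hfP : Integrable (fun z : X × ℝ => f z.1) P := hfst.integrable_comp_of_integrable hfi
  have hd : Integrable (fun z : X × ℝ => z.2 - f z.1) P := hY.sub hfP
  have hmh := measurable_apply hk h
  have hbd : ∀ z : X × ℝ, ‖h z.1‖ ≤ Real.sqrt κ * ‖h‖ := fun z => abs_apply_le hb h z.1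
  have hmh1 : AEStronglyMeasurable (fun z : X × ℝ => h z.1) P :=
    (hmh.comp measurable_fst).aestronglyMeasurable
  have hi : ∀ {g : X × ℝ → ℝ}, Integrable g P → Integrable (fun z => g z * h z.1) P := fun hg =>
    hg.mul_bdd (c := Real.sqrt κ * ‖h‖) hmh1 (Filter.Eventually.of_forall hbd)
  have hsm : StronglyMeasurable[MeasurableSpace.comap Prod.fst inferInstance]
      fun z : X × ℝ => h z.1 := by
    refine Measurable.stronglyMeasurable ?_
    exact hmh.comp (comap_measurable _)
  have h1 := condExp_mul_of_stronglyMeasurable_right hsm (hi hd) hd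
  have h2 : ∫ z : X × ℝ, (z.2 - f z.1) * h z.1 ∂P = 0 := by
    rw [← integral_condExp (m := MeasurableSpace.comap Prod.fst inferInstance)
      measurable_fst.comap_le]
    rw [← integral_zero (X × ℝ) ℝ (μ := P)]
    refine integral_congr_ae ?_
    filter_upwards [h1, hc] with z h1 h2
    refine h1.trans ?_
    rw [Pi.mul_apply, h2]
    simp
  have h3 : ∫ x, f x * h x ∂P.fst = ∫ z : X × ℝ, f z.1 * h z.1 ∂P := by
    rw [Measure.fst, integral_map measurable_fst.aemeasurable]
    exact hfi.aestronglyMeasurable.mul hmh.aestronglyMeasurable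
  rw [h3, ← sub_eq_zero, ← integral_sub (hi hY) (hi hfP), ← h2]
  refine integral_congr_ae (Filter.Eventually.of_forall fun z => ?_)
  simp only
  ring

end Moments

universe u

/-- There is a Hilbert space containing the elementary tensors `x ⊗ y`, which stand for the rank one
Hilbert-Schmidt operators `⟪x, ·⟫ y`: the completion of the algebraic tensor product. -/
theorem exists_hilbert_tensor (H : Type u) [NormedAddCommGroup H] [InnerProductSpace ℝ H] :
    ∃ (E : Type u) (_ : NormedAddCommGroup E) (_ : InnerProductSpace ℝ E) (_ : CompleteSpace E)
      (B : H → H → E), Continuous (fun p : H × H => B p.1 p.2) ∧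
        (∀ x y x' y', inner ℝ (B x y) (B x' y') = inner ℝ x x' * inner ℝ y y') ∧
        ∀ x y, ‖B x y‖ = ‖x‖ * ‖y‖ := by
  refine ⟨UniformSpace.Completion (TensorProduct ℝ H H), inferInstance, inferInstance,
    inferInstance, fun x y => ((TensorProduct.tmul ℝ x y : TensorProduct ℝ H H) :
      UniformSpace.Completion (TensorProduct ℝ H H)), ?_, fun x y x' y' => ?_, fun x y => ?_⟩
  · exact (UniformSpace.Completion.continuous_coe _).comp TensorProduct.continuous_tmul
  · rw [UniformSpace.Completion.inner_coe, TensorProduct.inner_tmul]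
  · rw [UniformSpace.Completion.norm_coe, TensorProduct.norm_tmul]

/-! ### Concentration of the data and of the empirical covariance operator -/

section Concentration

open ContinuousLinearMap

variable {X : Type*} [MeasurableSpace X] {H : Type*} [NormedAddCommGroup H]
  [InnerProductSpace ℝ H] [CompleteSpace H] [TopologicalSpace.SeparableSpace H] [RKHS ℝ H X ℝ]
  {κ : ℝ} (hk : Measurable (Function.uncurry (ker (X := X) H))) (hb : ∀ x : X, ker H x x ≤ κ)
  (P : Measure (X × ℝ)) [IsProbabilityMeasure P] {ι : Type*} (e : HilbertBasis ι ℝ H) {σ : ι → ℝ}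
  {l T : ℝ}

/-- Concentration of the vector `(1/n) ∑ i < n, Y i k(X i, ·)` around its mean, in the norm dual to
the energy norm of the covariance operator: Bernstein's inequality for
`Y (S + l)^(-1/2) k(X, ·)`. -/
theorem measure_not_dualBound_synth_le {fstar : X → ℝ} (hf : IsRegressionFunction P fstar)
    {g : Lp ℝ 2 P.fst} (hg : fstar =ᵐ[P.fst] g) {M : ℝ} (hM : 0 < M)
    (hY : ∀ᵐ z ∂P, |z.2| ≤ M)
    (he : ∀ i, adjoint (inclusion H hk hb P.fst) (inclusion H hk hb P.fst (e i)) = σ i • e i)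
    (hl : 0 < l) (hT0 : 0 < T) (hT : ∀ t : Finset ι, ∑ i ∈ t, σ i / (σ i + l) ≤ T) {t : ℝ}
    (ht : 0 ≤ t) (hRt : M * ((Real.sqrt l)⁻¹ * Real.sqrt κ) * t ≤ M ^ 2 * T / 5) {n N : ℕ}
    (hn : 0 < n) (hnN : n ≤ N) :
    Measure.pi (fun _ : Fin N => P)
      {z | ¬ DualBound (adjoint (inclusion H hk hb P.fst) ∘L inclusion H hk hb P.fst) l t
        (synth H (fun i => (z i).1) (paddedResponses n fun i => (z i).2) -
          adjoint (inclusion H hk hb P.fst) g)} ≤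
      ENNReal.ofReal (2 * Real.exp (-(5 / 12 * (n * t ^ 2 / (M ^ 2 * T))))) := by
  set J := inclusion H hk hb P.fst with hJ
  have hS : ∀ x y, inner ℝ ((adjoint J ∘L J) x) y = inner ℝ x ((adjoint J ∘L J) y) := fun x y => by
    rw [comp_apply, comp_apply, adjoint_inner_left, adjoint_inner_right]
  have hσ : ∀ i, 0 ≤ σ i := fun i => by
    have h1 : inner ℝ (adjoint J (J (e i))) (e i) = σ i := by
      rw [he, real_inner_smul_left, real_inner_self_eq_norm_sq, e.orthonormal.1 i]; ring
    rw [← h1, adjoint_inner_left]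
    exact real_inner_self_nonneg
  -- Bernstein's inequality asks for a pointwise bound, hence the truncation of the responses.
  set c : ℝ → ℝ := fun y => if |y| ≤ M then y else 0 with hc
  have hcm : Measurable c := by
    refine Measurable.ite ?_ measurable_id measurable_const
    exact measurableSet_le measurable_abs measurable_const
  have hcM : ∀ y, |c y| ≤ M := fun y => by
    simp only [hc]
    split_ifs with h
    · exact h
    · simpa using hM.le
  set ξ : X × ℝ → H := fun z => c z.2 • whiten e σ l (feat H z.1) with hξ
  have hξm : StronglyMeasurable ξ := by
    refine (hcm.comp measurable_snd).stronglyMeasurable.smul ?_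
    exact (whiten e σ l).continuous.comp_stronglyMeasurable
      ((stronglyMeasurable_feat hk).comp_measurable measurable_fst)
  have hφ : ∀ x, ‖whiten e σ l (feat H x)‖ ≤ (Real.sqrt l)⁻¹ * Real.sqrt κ := fun x =>
    (norm_whiten_le e hσ hl _).trans
      (mul_le_mul_of_nonneg_left (norm_feat_le hb x) (by positivity))
  have hφm : StronglyMeasurable fun x => whiten e σ l (feat H x) :=
    (whiten e σ l).continuous.comp_stronglyMeasurable (stronglyMeasurable_feat hk)
  have hξR : ∀ z, ‖ξ z‖ ≤ M * ((Real.sqrt l)⁻¹ * Real.sqrt κ) := fun z => by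
    rw [hξ, norm_smul]
    exact mul_le_mul (hcM _) (hφ _) (norm_nonneg _) hM.le
  have hφi : Integrable (fun x => ‖whiten e σ l (feat H x)‖ ^ 2) P.fst := by
    refine integrable_of_bounded (C := ((Real.sqrt l)⁻¹ * Real.sqrt κ) ^ 2)
      (hφm.norm.pow 2) fun x => ?_
    rw [Real.norm_of_nonneg (by positivity)]
    exact pow_le_pow_left₀ (norm_nonneg _) (hφ x) 2
  have hξV : ∫ z, ‖ξ z‖ ^ 2 ∂P ≤ M ^ 2 * T := by
    have hfst : MeasurePreserving (Prod.fst : X × ℝ → X) P P.fst := ⟨measurable_fst, rfl⟩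
    have h1 : ∫ z, ‖ξ z‖ ^ 2 ∂P ≤
        ∫ z : X × ℝ, M ^ 2 * ‖whiten e σ l (feat H z.1)‖ ^ 2 ∂P := by
      refine integral_mono_of_nonneg (Filter.Eventually.of_forall fun z => sq_nonneg _)
        ((hfst.integrable_comp_of_integrable hφi).const_mul _)
        (Filter.Eventually.of_forall fun z => ?_)
      simp only [hξ]
      rw [norm_smul, mul_pow]
      refine mul_le_mul_of_nonneg_right ?_ (sq_nonneg _)
      exact pow_le_pow_left₀ (norm_nonneg _) (hcM _) 2
    refine h1.trans ?_
    rw [integral_const_mul]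
    refine mul_le_mul_of_nonneg_left ?_ (sq_nonneg M)
    refine le_trans (le_of_eq ?_) (integral_norm_whiten_feat_sq_le hk hb P.fst e he hl hT)
    rw [Measure.fst, integral_map measurable_fst.aemeasurable]
    exact hφi.aestronglyMeasurable
  have hbern := measure_norm_average_sub_ge_le (μ := P) hξm hξR hξV (by positivity) ht hRt hn hnN
  have hYpi : ∀ᵐ z ∂Measure.pi (fun _ : Fin N => P), ∀ i, |(z i).2| ≤ M :=
    ae_all_iff.2 fun i =>
      (measurePreserving_eval (fun _ : Fin N => P) i).quasiMeasurePreserving.ae hY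
  refine (measure_mono_ae ?_).trans hbern
  filter_upwards [hYpi] with z hz hbad
  refine le_of_not_gt fun hlt => hbad fun y => ?_
  have hmean : inner ℝ (∫ ω, ξ ω ∂P) (unwhiten e σ l y) = inner ℝ (adjoint J g) y := by
    rw [real_inner_comm, ← integral_inner (integrable_of_bounded hξm hξR), adjoint_inner_left, hJ,
      inner_inclusion]
    have h1 : ∫ x, g x * y x ∂P.fst = ∫ x, fstar x * y x ∂P.fst := by
      refine integral_congr_ae ?_
      filter_upwards [hg] with x hx
      rw [hx]
    rw [h1, ← integral_mul_apply_eq hk hb hf]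
    refine integral_congr_ae ?_
    filter_upwards [hY] with ω hω
    simp only [hξ, hc]
    rw [if_pos hω, inner_smul_right, real_inner_comm,
      inner_whiten_unwhiten e hσ hl (S := adjoint J ∘L J) he, inner_feat]
  have hemp : inner ℝ ((1 / (n : ℝ)) • ∑ i : Fin N, if (i : ℕ) < n then ξ (z i) else 0)
      (unwhiten e σ l y) =
      inner ℝ (synth H (fun i => (z i).1) (paddedResponses n fun i => (z i).2)) y := by
    rw [inner_synth, real_inner_smul_left, sum_inner, Finset.mul_sum, Finset.mul_sum]
    refine Finset.sum_congr rfl fun i _ => ?_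
    rw [paddedResponses]
    have hN : (N : ℝ) ≠ 0 := by
      have : 0 < N := hn.trans_le hnN
      positivity
    split_ifs with hi
    · simp only [hξ, hc]
      rw [if_pos (hz i), real_inner_smul_left,
        inner_whiten_unwhiten e hσ hl (S := adjoint J ∘L J) he, inner_feat]
      field_simp
    · simp
  rw [inner_sub_left, ← hmean, ← hemp, ← inner_sub_left, ← norm_unwhiten e hσ hl hS he]
  exact (real_inner_le_norm _ _).trans (mul_le_mul_of_nonneg_right hlt.le (norm_nonneg _))

/-- Concentration of the empirical covariance operator: Bernstein's inequality for the
Hilbert-Schmidt operator `k(X, ·) ⊗ (S + l)^(-1/2) k(X, ·)`. -/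
theorem measure_not_empOp_sub_le
    (he : ∀ i, adjoint (inclusion H hk hb P.fst) (inclusion H hk hb P.fst (e i)) = σ i • e i)
    (hκ : 0 < κ) (hl : 0 < l) (hT0 : 0 < T) (hT : ∀ t : Finset ι, ∑ i ∈ t, σ i / (σ i + l) ≤ T)
    {t : ℝ} (ht : 0 ≤ t) (hRt : Real.sqrt κ * ((Real.sqrt l)⁻¹ * Real.sqrt κ) * t ≤ κ * T / 5)
    {N : ℕ} (hN : 0 < N) :
    Measure.pi (fun _ : Fin N => P)
      {z | ¬ ∀ h y : H,
        inner ℝ ((adjoint (inclusion H hk hb P.fst) ∘L inclusion H hk hb P.fst -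
          empOp H fun i => (z i).1) h) y ≤ t * ‖h‖ *
        energyNorm (adjoint (inclusion H hk hb P.fst) ∘L inclusion H hk hb P.fst) l y} ≤
      ENNReal.ofReal (2 * Real.exp (-(5 / 12 * (N * t ^ 2 / (κ * T))))) := by
  set J := inclusion H hk hb P.fst with hJ
  have hS : ∀ x y, inner ℝ ((adjoint J ∘L J) x) y = inner ℝ x ((adjoint J ∘L J) y) := fun x y => by
    rw [comp_apply, comp_apply, adjoint_inner_left, adjoint_inner_right]
  have hσ : ∀ i, 0 ≤ σ i := fun i => by
    have h1 : inner ℝ (adjoint J (J (e i))) (e i) = σ i := by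
      rw [he, real_inner_smul_left, real_inner_self_eq_norm_sq, e.orthonormal.1 i]; ring
    rw [← h1, adjoint_inner_left]
    exact real_inner_self_nonneg
  have hφ : ∀ x, ‖whiten e σ l (feat H x)‖ ≤ (Real.sqrt l)⁻¹ * Real.sqrt κ := fun x =>
    (norm_whiten_le e hσ hl _).trans
      (mul_le_mul_of_nonneg_left (norm_feat_le hb x) (by positivity))
  have hφm : StronglyMeasurable fun x => whiten e σ l (feat H x) :=
    (whiten e σ l).continuous.comp_stronglyMeasurable (stronglyMeasurable_feat hk)
  have hφi : Integrable (fun x => ‖whiten e σ l (feat H x)‖ ^ 2) P.fst := by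
    refine integrable_of_bounded (C := ((Real.sqrt l)⁻¹ * Real.sqrt κ) ^ 2)
      (hφm.norm.pow 2) fun x => ?_
    rw [Real.norm_of_nonneg (by positivity)]
    exact pow_le_pow_left₀ (norm_nonneg _) (hφ x) 2
  obtain ⟨E, _, _, _, B, hBc, hBi, hBn⟩ := exists_hilbert_tensor H
  set ξ : X × ℝ → E := fun z => B (feat H z.1) (whiten e σ l (feat H z.1)) with hξ
  have hnorm : ∀ z, ‖ξ z‖ = ‖feat H z.1‖ * ‖whiten e σ l (feat H z.1)‖ := fun z => by
    rw [hξ, hBn]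
  have hξm : StronglyMeasurable ξ :=
    hBc.comp_stronglyMeasurable
      (((stronglyMeasurable_feat hk).prodMk hφm).comp_measurable measurable_fst)
  have hξR : ∀ z, ‖ξ z‖ ≤ Real.sqrt κ * ((Real.sqrt l)⁻¹ * Real.sqrt κ) := fun z => by
    rw [hnorm]
    exact mul_le_mul (norm_feat_le hb _) (hφ _) (norm_nonneg _) (Real.sqrt_nonneg _)
  have hξV : ∫ z, ‖ξ z‖ ^ 2 ∂P ≤ κ * T := by
    have hfst : MeasurePreserving (Prod.fst : X × ℝ → X) P P.fst := ⟨measurable_fst, rfl⟩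
    have h1 : ∫ z, ‖ξ z‖ ^ 2 ∂P ≤
        ∫ z : X × ℝ, κ * ‖whiten e σ l (feat H z.1)‖ ^ 2 ∂P := by
      refine integral_mono_of_nonneg (Filter.Eventually.of_forall fun z => sq_nonneg _)
        ((hfst.integrable_comp_of_integrable hφi).const_mul _)
        (Filter.Eventually.of_forall fun z => ?_)
      simp only
      rw [hnorm, mul_pow]
      exact mul_le_mul_of_nonneg_right (norm_feat_sq_le hb _) (sq_nonneg _)
    refine h1.trans ?_
    rw [integral_const_mul]
    refine mul_le_mul_of_nonneg_left ?_ hκ.le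
    refine le_trans (le_of_eq ?_) (integral_norm_whiten_feat_sq_le hk hb P.fst e he hl hT)
    rw [Measure.fst, integral_map measurable_fst.aemeasurable]
    exact hφi.aestronglyMeasurable
  refine (measure_mono ?_).trans
    (measure_norm_average_sub_ge_le (μ := P) hξm hξR hξV (by positivity) ht hRt hN le_rfl)
  intro z hbad
  change t ≤ _
  refine le_of_not_gt fun hlt => hbad ?_
  have key : ∀ h y : H, inner ℝ ((empOp H fun i => (z i).1) h) y -
      inner ℝ ((adjoint J ∘L J) h) y ≤ t * ‖h‖ * energyNorm (adjoint J ∘L J) l y := by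
    intro h y
    set p := B h (unwhiten e σ l y) with hp
    have hξp : ∀ ω, inner ℝ (ξ ω) p = h ω.1 * y ω.1 := fun ω => by
      rw [hξ, hp, hBi, inner_whiten_unwhiten e hσ hl (S := adjoint J ∘L J) he, inner_feat,
        inner_feat]
    have hξp' : ∀ ω, inner ℝ p (ξ ω) = h ω.1 * y ω.1 := fun ω => by rw [real_inner_comm, hξp]
    have hmean : inner ℝ (∫ ω, ξ ω ∂P) p = inner ℝ ((adjoint J ∘L J) h) y := by
      rw [real_inner_comm, ← integral_inner (integrable_of_bounded hξm hξR), comp_apply,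
        adjoint_inner_left, hJ, inner_inclusion_inclusion]
      simp_rw [hξp']
      rw [Measure.fst, integral_map measurable_fst.aemeasurable]
      exact ((measurable_apply hk h).mul (measurable_apply hk y)).aestronglyMeasurable
    have hemp : inner ℝ ((1 / (N : ℝ)) • ∑ i : Fin N, if (i : ℕ) < N then ξ (z i) else 0) p =
        inner ℝ ((empOp H fun i => (z i).1) h) y := by
      rw [inner_empOp, real_inner_smul_left, sum_inner]
      congr 1
      refine Finset.sum_congr rfl fun i _ => ?_
      rw [if_pos i.2, hξp]
    have hpn : ‖p‖ = ‖h‖ * energyNorm (adjoint J ∘L J) l y := by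
      rw [hp, hBn, norm_unwhiten e hσ hl hS he]
    rw [← hmean, ← hemp, ← inner_sub_left, mul_assoc, ← hpn]
    exact (real_inner_le_norm _ _).trans (mul_le_mul_of_nonneg_right hlt.le (norm_nonneg _))
  -- The bound is symmetric under `h ↦ -h`.
  intro h y
  have h1 := key (-h) y
  rw [map_neg, map_neg, inner_neg_left, inner_neg_left, norm_neg] at h1
  rw [sub_apply, inner_sub_left]
  linarith

end Concentration


/-! ### The rate on a good sample -/

section Deterministic

open ContinuousLinearMap

variable {ι ι' E H : Type*} [NormedAddCommGroup E] [InnerProductSpace ℝ E]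
  [NormedAddCommGroup H] [InnerProductSpace ℝ H] [CompleteSpace H]
  (b : HilbertBasis ι ℝ E) {ξ : ι → ℝ} {J : H →L[ℝ] E}

theorem norm_le_of_power_image {κ r ρ : ℝ} (hκ : 0 < κ) (hr : 0 ≤ r) (hξ0 : ∀ i, 0 ≤ ξ i)
    (hξκ : ∀ i, ξ i ≤ κ) {u g : E} (hug : ∀ i, inner ℝ (b i) g = ξ i ^ r * inner ℝ (b i) u)
    (hu : ‖u‖ ≤ κ ^ (-r) * ρ) : ‖g‖ ≤ ρ := by
  have h1 : ‖g‖ ≤ ‖κ ^ r • u‖ := norm_le_of_abs_inner_le b b fun i => by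
    rw [hug, inner_smul_right, abs_mul, abs_mul]
    refine mul_le_mul_of_nonneg_right ?_ (abs_nonneg _)
    rw [abs_of_nonneg (Real.rpow_nonneg (hξ0 i) r), abs_of_nonneg (by positivity)]
    exact Real.rpow_le_rpow (hξ0 i) (hξκ i) hr
  rw [norm_smul, Real.norm_of_nonneg (by positivity)] at h1
  have h2 : κ ^ r * ‖u‖ ≤ κ ^ r * (κ ^ (-r) * ρ) := mul_le_mul_of_nonneg_left hu (by positivity)
  rw [← mul_assoc, ← Real.rpow_add hκ, add_neg_cancel, Real.rpow_zero, one_mul] at h2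
  exact h1.trans h2

theorem errorConst_nonneg (j : ℕ) {τ : ℝ} (hτ : 3 / 2 < τ) : 0 ≤ errorConst j τ := by
  rw [errorConst, decayConst]
  have : 0 ≤ τ := by linarith
  positivity

variable [CompleteSpace E]

/-- The rate of the stopped iteration, on samples for which the data and the empirical covariance
operator `A` are close to their population counterparts `J† g` and `J† J`. -/
theorem exists_isLeast_norm_sub_le (hJ : ∀ i, J (adjoint J (b i)) = ξ i • b i) {κ l r ρ M : ℝ}
    (hl : 0 < l) (hlκ : l ≤ κ) (hξκ : ∀ i, ξ i ≤ κ) (hr : 0 ≤ r) (hM : 0 < M) (hρM : ρ ≤ M)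
    {u g : E} (hug : ∀ i, inner ℝ (b i) g = ξ i ^ r * inner ℝ (b i) u)
    (hu : ‖u‖ ≤ κ ^ (-r) * ρ) {A : H →L[ℝ] H} (e : HilbertBasis ι' ℝ H)
    (hA : ∀ x y, inner ℝ (A x) y = inner ℝ x (A y)) (hA0 : ∀ y, 0 ≤ inner ℝ (A y) y)
    {a : ι' → ℝ} (ha : ∀ i, A (e i) = a i • e i) (hfin : {i | a i ≠ 0}.Finite) {d : H}
    (hd : DualBound (adjoint J ∘L J) l (M * (l / κ) ^ r / 5) (d - adjoint J g))
    (hSA : ∀ z y, inner ℝ ((adjoint J ∘L J - A) z) y ≤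
      Real.sqrt l / 5 * (l / κ) ^ max (r - 1 / 2) 0 * ‖z‖ * energyNorm (adjoint J ∘L J) l y)
    (hker : ∀ i, a i = 0 → inner ℝ (e i) d = 0) {τ : ℝ} (hτ : 3 / 2 < τ) {f : ℕ → H}
    (hf : ∀ m, ∃ q ∈ Polynomial.degreeLT ℝ m, f m = Polynomial.aeval A q d)
    (hmin : ∀ m, ∀ q ∈ Polynomial.degreeLT ℝ m,
      ‖A (f m) - d‖ ≤ ‖A (Polynomial.aeval A q d) - d‖) :
    ∃ m, IsLeast {m | ‖A (f m) - d‖ < τ * (M * (l / κ) ^ r) * Real.sqrt l} m ∧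
      ‖J (f m) - g‖ ≤ (2 * errorConst ⌈r⌉₊ τ + 1) * (M * (l / κ) ^ r) := by
  set j := ⌈r⌉₊ with hj
  set S := adjoint J ∘L J with hS
  set δ := Real.sqrt l / 5 * (l / κ) ^ max (r - 1 / 2) 0 with hδ
  set μ := M * (l / κ) ^ r with hμ
  have hκ : 0 < κ := hl.trans_le hlκ
  have hℓ : 0 < l / κ := by positivity
  have hℓ1 : l / κ ≤ 1 := (div_le_one hκ).2 hlκ
  have hμ0 : 0 < μ := by positivity
  have hsl := Real.sqrt_pos.2 hl
  have hρμ : (l / κ) ^ r * ρ ≤ μ := by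
    rw [hμ, mul_comm M]
    exact mul_le_mul_of_nonneg_left hρM (by positivity)
  have hδ5 : δ ≤ Real.sqrt l / 5 := by
    rw [hδ]
    exact mul_le_of_le_one_right (by positivity)
      (Real.rpow_le_one hℓ.le hℓ1 (le_max_right _ _))
  have hδ0 : 0 ≤ δ := by positivity
  have hS0 : ∀ y, 0 ≤ inner ℝ (S y) y := fun y => by
    rw [hS, comp_apply, adjoint_inner_left]
    exact real_inner_self_nonneg
  have hcmp := energyNorm_le_of_perturbation hl hS0 hA0 hδ5 hSA
  obtain ⟨y, hgJ, hgd, hSk, hy⟩ := exists_source_vector b hJ hl hlκ hξκ hr (Nat.le_ceil r) hug hu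
  set h := (S ^ j) y with hh
  -- The bound on `S ^ k y` is `l ^ (k - j)` times the one on `h = S ^ j y`.
  have hpert : ∀ k ≤ j, DualBound S l (μ / 5 * l ^ ((k : ℝ) - j)) ((S - A) ((S ^ k) y)) := by
    intro k hk z
    refine (hSA _ z).trans (mul_le_mul_of_nonneg_right ?_ (energyNorm_nonneg _ _ _))
    have h1 : Real.sqrt l * l ^ ((k : ℝ) - j - 1 / 2) = l ^ ((k : ℝ) - j) := by
      rw [Real.sqrt_eq_rpow, ← Real.rpow_add hl]
      congr 1
      ring
    calc δ * ‖(S ^ k) y‖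
        = Real.sqrt l / 5 * ((l / κ) ^ max (r - 1 / 2) 0 * ‖(S ^ k) y‖) := by rw [hδ]; ring
      _ ≤ Real.sqrt l / 5 * (l ^ ((k : ℝ) - j - 1 / 2) * μ) := by
          refine mul_le_mul_of_nonneg_left ((hSk k hk).trans ?_) (by positivity)
          exact mul_le_mul_of_nonneg_left hρμ (by positivity)
      _ = μ / 5 * (Real.sqrt l * l ^ ((k : ℝ) - j - 1 / 2)) := by ring
      _ = μ / 5 * l ^ ((k : ℝ) - j) := by rw [h1]
  have ha0 : ∀ i, 0 ≤ a i := fun i => by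
    have h1 := hA0 (e i)
    rwa [ha, real_inner_smul_left, real_inner_self_eq_norm_sq, e.orthonormal.1 i, one_pow,
      mul_one] at h1
  -- The terms of the expansion of `S ^ j` around `A`.
  set v : ℕ → H := fun k => if k < j then (S - A) ((S ^ (j - 1 - k)) y) else y with hv
  have hv' : ∀ k ≤ j, DualBound A l (μ / l ^ (k + 1)) (v k) := by
    intro k hk
    rcases lt_or_ge k j with hkj | hkj
    · simp only [hv]
      rw [if_pos hkj]
      have h1 := hpert (j - 1 - k) (by omega)
      refine DualBound.mono (DualBound.of_energyNorm_le h1 (by positivity) hcmp) ?_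
      have h2 : ((j - 1 - k : ℕ) : ℝ) - j = -((k + 1 : ℕ) : ℝ) := by
        rw [Nat.sub_sub, Nat.cast_sub (by omega)]
        push_cast
        ring
      rw [h2, Real.rpow_neg hl.le, Real.rpow_natCast, ← mul_assoc, div_eq_mul_inv μ (l ^ (k + 1))]
      refine mul_le_mul_of_nonneg_right ?_ (by positivity)
      linarith
    · obtain rfl : k = j := le_antisymm hk hkj
      simp only [hv]
      rw [if_neg (lt_irrefl _)]
      refine DualBound.mono (dualBound_of_norm_le hl hA0 hy) ?_
      have h1 : l ^ (-(j : ℝ) - 1 / 2) * ((l / κ) ^ r * ρ) / Real.sqrt l =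
          ((l / κ) ^ r * ρ) / l ^ (j + 1) := by
        have h2 : l ^ (-(j : ℝ) - 1 / 2) * l ^ (j + 1) = Real.sqrt l := by
          rw [← Real.rpow_natCast, ← Real.rpow_add hl, Real.sqrt_eq_rpow]
          congr 1
          push_cast
          ring
        rw [div_eq_div_iff hsl.ne' (by positivity), mul_right_comm, h2, mul_comm]
      rw [h1]
      exact div_le_div_of_nonneg_right hρμ (by positivity)
  have hhv : h = ∑ k ∈ Finset.range (j + 1), (A ^ k) (v k) := by
    rw [Finset.sum_range_succ, hh, pow_apply_eq_sum S A j y, add_comm]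
    congr 1
    · refine Finset.sum_congr rfl fun k hk => ?_
      simp only [hv]
      rw [if_pos (Finset.mem_range.1 hk)]
    · simp [hv]
  have hnoise : DualBound A l (31 / 25 * μ) (d - A h) := by
    have h1 : d - A h = (d - adjoint J g) + adjoint J (g - J h) + (S - A) h := by
      rw [map_sub, sub_apply, hS, comp_apply]
      abel
    have h2 := hpert j le_rfl
    rw [sub_self, Real.rpow_zero, mul_one] at h2
    have h3 := (hd.add hgd).add h2
    rw [h1]
    -- The resulting constant is `1.119 * (1 / 5 + √(1 / 2) + 1 / 5) ≤ 31 / 25`.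
    have hsq : Real.sqrt (1 / 2) ≤ 7072 / 10000 := by
      rw [Real.sqrt_le_left (by norm_num)]
      norm_num
    have h4 : Real.sqrt (1 / 2) * ((l / κ) ^ r * ρ) ≤ 7072 / 10000 * μ :=
      (mul_le_mul_of_nonneg_left hρμ (Real.sqrt_nonneg _)).trans
        (mul_le_mul_of_nonneg_right hsq hμ0.le)
    have h5 : μ / 5 + Real.sqrt (1 / 2) * ((l / κ) ^ r * ρ) + μ / 5 ≤ 11072 / 10000 * μ := by
      linarith
    exact ((h3.mono h5).of_energyNorm_le (by positivity) hcmp).mono (by linarith)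
  obtain ⟨m, hm, hme⟩ := exists_isLeast_energyNorm_le e hA ha ha0 hfin hl hμ0 hv' hhv hnoise hker
    hτ hf hmin
  refine ⟨m, hm, ?_⟩
  have h1 : J (f m) - g = J (f m - h) - (g - J h) := by
    rw [map_sub]
    abel
  have h2 := norm_sub_le (J (f m - h)) (g - J h)
  have h3 := (norm_le_energyNorm hl.le (f m - h)).trans (hcmp (f m - h))
  have h4 := mul_nonneg (errorConst_nonneg j hτ) hμ0.le
  rw [h1]
  linarith

end Deterministic

/-! ### Translation between kernel matrices and operators -/

section Sample

open ContinuousLinearMap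

variable {X : Type*} {H : Type*} [NormedAddCommGroup H]
  [InnerProductSpace ℝ H] [CompleteSpace H] [RKHS ℝ H X ℝ] {N : ℕ}

theorem matNorm_expansion_sub (x : Fin N → X) (α y : Fin N → ℝ) :
    matNorm (gram H x) (fun i => expansion H x α (x i) - y i) =
      ‖empOp H x (synth H x α) - synth H x y‖ := by
  have h1 : (fun i => expansion H x α (x i) - y i) = gram H x *ᵥ α - y := by
    rw [gram_mulVec, synth_coe]
    rfl
  rw [h1, matNorm_gram_eq, map_sub, synth_gram]

theorem matNorm_sub_gram_mulVec (x : Fin N → X) (α y : Fin N → ℝ) :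
    matNorm (gram H x) (y - gram H x *ᵥ α) = ‖empOp H x (synth H x α) - synth H x y‖ := by
  rw [matNorm_gram_eq, map_sub, synth_gram, norm_sub_rev]

/-- The null space of the empirical covariance operator is orthogonal to all kernel expansions. -/
theorem inner_synth_eq_zero (x : Fin N → X) (y : Fin N → ℝ) {h : H} (hh : empOp H x h = 0) :
    inner ℝ h (synth H x y) = 0 := by
  rw [real_inner_comm, inner_synth]
  rcases Nat.eq_zero_or_pos N with rfl | hN
  · simp
  have h1 : ∑ i, h (x i) * h (x i) = 0 := by
    have h2 := inner_empOp x h h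
    rw [hh, inner_zero_left] at h2
    have : (0 : ℝ) < 1 / N := by positivity
    exact (mul_eq_zero.1 h2.symm).resolve_left this.ne'
  have h3 : ∀ i, h (x i) = 0 := fun i =>
    mul_self_eq_zero.1 ((Finset.sum_eq_zero_iff_of_nonneg fun i _ => mul_self_nonneg _).1 h1 i
      (Finset.mem_univ i))
  simp [h3]

theorem norm_synth_paddedResponses_le {κ : ℝ} (hb : ∀ x : X, ker H x x ≤ κ) (x : Fin N → X)
    {y : Fin N → ℝ} {M : ℝ} (hM : 0 ≤ M) (hy : ∀ i, |y i| ≤ M) {n : ℕ} (hn : 0 < n) (hnN : n ≤ N) :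
    ‖synth H x (paddedResponses n y)‖ ≤ M * Real.sqrt κ := by
  have hN : 0 < N := hn.trans_le hnN
  have h1 : ∀ i : Fin N, ‖paddedResponses n y i • feat H (x i)‖ ≤
      if (i : ℕ) < n then (N : ℝ) / n * (M * Real.sqrt κ) else 0 := fun i => by
    rw [norm_smul, paddedResponses]
    split_ifs
    · rw [norm_mul, Real.norm_of_nonneg (by positivity), mul_assoc]
      refine mul_le_mul_of_nonneg_left ?_ (by positivity)
      exact mul_le_mul (hy i) (norm_feat_le hb _) (norm_nonneg _) hM
    · simp
  have hcard : (Finset.univ.filter fun i : Fin N => (i : ℕ) < n).card = n := by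
    rw [Fin.card_filter_val_lt, min_eq_right hnN]
  calc ‖synth H x (paddedResponses n y)‖
      = 1 / N * ‖∑ i, paddedResponses n y i • feat H (x i)‖ := by
        rw [synth_apply, norm_smul, Real.norm_of_nonneg (by positivity)]
    _ ≤ 1 / N * ∑ i : Fin N, if (i : ℕ) < n then (N : ℝ) / n * (M * Real.sqrt κ) else 0 :=
        mul_le_mul_of_nonneg_left (norm_sum_le_of_le _ fun i _ => h1 i) (by positivity)
    _ = M * Real.sqrt κ := by
        rw [← Finset.sum_filter, Finset.sum_const, hcard, nsmul_eq_mul]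
        field_simp

variable [MeasurableSpace X] {κ : ℝ}
  (hk : Measurable (Function.uncurry (ker (X := X) H))) (hb : ∀ x : X, ker H x x ≤ κ)

theorem integral_expansion_sub_sq (ν : Measure X) [IsProbabilityMeasure ν] {f : X → ℝ}
    {g : Lp ℝ 2 ν} (hg : f =ᵐ[ν] g) (x : Fin N → X) (α : Fin N → ℝ) :
    ∫ t, (expansion H x α t - f t) ^ 2 ∂ν = ‖inclusion H hk hb ν (synth H x α) - g‖ ^ 2 := by
  rw [← real_inner_self_eq_norm_sq, L2.inner_def]
  refine integral_congr_ae ?_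
  filter_upwards [hg, inclusion_ae_eq hk hb ν (synth H x α),
    Lp.coeFn_sub (inclusion H hk hb ν (synth H x α)) g] with t h1 h2 h3
  rw [h3, Pi.sub_apply, h2, h1, synth_coe]
  simp [sq]

theorem kernelOp_eq_comp (ν : Measure X) [IsProbabilityMeasure ν] :
    kernelOp H hk hb ν = inclusion H hk hb ν ∘L adjoint (inclusion H hk hb ν) :=
  ContinuousLinearMap.ext fun g => (inclusion_adjoint hk hb ν g).symm

/-- The eigenvalues of the kernel integral operator are at most `κ`. -/
theorem eigenvalue_kernelOp_le (hκ : 0 ≤ κ) (ν : Measure X) [IsProbabilityMeasure ν] {ι : Type*}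
    (b : HilbertBasis ι ℝ (Lp ℝ 2 ν)) {ξ : ι → ℝ}
    (hb' : ∀ i, inclusion H hk hb ν (adjoint (inclusion H hk hb ν) (b i)) = ξ i • b i) (i : ι) :
    ξ i ≤ κ := by
  set J := inclusion H hk hb ν with hJ
  have h1 : ‖J‖ ≤ Real.sqrt κ :=
    J.opNorm_le_bound (Real.sqrt_nonneg κ) (norm_inclusion_le hk hb ν)
  have h2 : ‖adjoint J (b i)‖ ≤ Real.sqrt κ := by
    have := (adjoint J).le_opNorm (b i)
    rw [b.orthonormal.1 i, mul_one, LinearIsometryEquiv.norm_map] at this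
    exact this.trans h1
  have h3 : ξ i = ‖adjoint J (b i)‖ ^ 2 := by
    rw [← real_inner_self_eq_norm_sq, adjoint_inner_left, hb', inner_smul_right,
      real_inner_self_eq_norm_sq, b.orthonormal.1 i]
    ring
  rw [h3, ← Real.sq_sqrt hκ]
  exact pow_le_pow_left₀ (norm_nonneg _) h2 2

end Sample

/-! ### Numerical bounds -/

section Numerics

theorem one_lt_log_six_div {γ : ℝ} (h0 : 0 < γ) (h1 : γ < 1) : 1 < Real.log (6 / γ) := by
  rw [Real.lt_log_iff_exp_lt (by positivity), lt_div_iff₀ h0]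
  have := Real.exp_one_lt_d9
  nlinarith

/-- With `L = log (6 / γ)`, this is `4 / 15 L² - L + log 3 ≥ 0`. -/
theorem two_mul_exp_neg_le {γ E : ℝ} (h0 : 0 < γ) (hE : 16 / 25 * Real.log (6 / γ) ^ 2 ≤ E) :
    2 * Real.exp (-(5 / 12 * E)) ≤ γ := by
  set L := Real.log (6 / γ) with hL
  have h1 : γ = 6 * Real.exp (-L) := by
    rw [hL, ← Real.log_inv, Real.exp_log (by positivity)]
    field_simp
  have h3 : Real.exp 1 ≤ 3 := by
    have := Real.exp_one_lt_d9
    linarith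
  have h2 : Real.exp (-(5 / 12 * E)) ≤ Real.exp 1 * Real.exp (-L) := by
    rw [← Real.exp_add, Real.exp_le_exp]
    nlinarith [sq_nonneg (L - 15 / 8)]
  have h4 : Real.exp 1 * Real.exp (-L) ≤ 3 * Real.exp (-L) :=
    mul_le_mul_of_nonneg_right h3 (Real.exp_pos _).le
  linarith

theorem stopThreshold_eq {τ M ρ κ D γ r s : ℝ} {n : ℕ} (hκ : 0 < κ) (hD : 0 ≤ D)
    (hL : 0 ≤ Real.log (6 / γ)) (hB : 0 < rateBase D γ n) (hp : 0 < 2 * r + s) :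
    stopThreshold τ M ρ κ D γ r s n =
      τ * (max M ρ * (rateBase D γ n ^ (1 / (2 * r + s))) ^ r) *
        Real.sqrt (κ * rateBase D γ n ^ (1 / (2 * r + s))) := by
  have h1 : 4 * D / Real.sqrt n * Real.log (6 / γ) = Real.sqrt (rateBase D γ n) := by
    rw [eq_comm, Real.sqrt_eq_iff_mul_self_eq hB.le (by positivity), rateBase]
    have h2 : Real.sqrt n * Real.sqrt n = n := Real.mul_self_sqrt (Nat.cast_nonneg n)
    symm
    calc 4 * D / Real.sqrt n * Real.log (6 / γ) * (4 * D / Real.sqrt n * Real.log (6 / γ))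
        = 16 * D ^ 2 / (Real.sqrt n * Real.sqrt n) * Real.log (6 / γ) ^ 2 := by
          rw [div_mul_eq_mul_div, div_mul_div_comm, div_mul_eq_mul_div]
          congr 1
          ring
      _ = _ := by rw [h2]
  rw [stopThreshold, h1, Real.sqrt_mul hκ.le, Real.sqrt_eq_rpow (rateBase D γ n),
    Real.sqrt_eq_rpow (_ ^ _), ← Real.rpow_mul hB.le, ← Real.rpow_mul hB.le, ← Real.rpow_mul hB.le]
  have h3 : rateBase D γ n ^ (1 / 2 * ((2 * r + 1) / (2 * r + s))) =
      rateBase D γ n ^ (1 / (2 * r + s) * r) * rateBase D γ n ^ (1 / (2 * r + s) * (1 / 2)) := by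
    rw [← Real.rpow_add hB]
    congr 1
    field_simp
  rw [h3]
  ring

end Numerics


/-! ### The stopped iteration on a sample -/

section Iterates

variable {X : Type*} {H : Type*} [NormedAddCommGroup H]
  [InnerProductSpace ℝ H] [CompleteSpace H] [RKHS ℝ H X ℝ] {N : ℕ}

/-- If the responses are already below the threshold, then the iteration stops at `0`. -/
theorem isStoppingIndex_zero {x : Fin N → X} {y : Fin N → ℝ} {α : ℕ → Fin N → ℝ}
    (hα : ∀ m, IsCGIterate (gram H x) y m (α m)) {t : ℝ} (ht : ‖synth H x y‖ < t) :
    synth H x (α 0) = 0 ∧ IsStoppingIndex H x y α t 0 := by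
  obtain ⟨q, hq, h0⟩ := exists_polynomial_of_mem_krylov x y 0 (hα 0).1
  have hq0 : q = 0 := by
    rw [Polynomial.mem_degreeLT] at hq
    exact Polynomial.degree_eq_bot.1 (Nat.WithBot.lt_zero_iff.1 (by simpa using hq))
  rw [hq0, map_zero] at h0
  have h0' : synth H x (α 0) = 0 := h0
  refine ⟨h0', ?_, fun _ _ => Nat.zero_le _⟩
  rw [Set.mem_ofPred_eq, matNorm_expansion_sub, h0', map_zero, zero_sub, norm_neg]
  exact ht

open ContinuousLinearMap in
/-- The rate of the stopped conjugate gradient iteration on a good sample. -/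
theorem exists_isStoppingIndex {E ι : Type*} [NormedAddCommGroup E] [InnerProductSpace ℝ E]
    [CompleteSpace E] (b : HilbertBasis ι ℝ E) {ξ : ι → ℝ} {J : H →L[ℝ] E}
    (hJ : ∀ i, J (adjoint J (b i)) = ξ i • b i) {κ l r ρ M : ℝ}
    (hl : 0 < l) (hlκ : l ≤ κ) (hξκ : ∀ i, ξ i ≤ κ) (hr : 0 ≤ r) (hM : 0 < M) (hρM : ρ ≤ M)
    {u g : E} (hug : ∀ i, inner ℝ (b i) g = ξ i ^ r * inner ℝ (b i) u)
    (hu : ‖u‖ ≤ κ ^ (-r) * ρ) (x : Fin N → X) (y : Fin N → ℝ)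
    (hd : DualBound (adjoint J ∘L J) l (M * (l / κ) ^ r / 5) (synth H x y - adjoint J g))
    (hSA : ∀ h h', inner ℝ ((adjoint J ∘L J - empOp H x) h) h' ≤
      Real.sqrt l / 5 * (l / κ) ^ max (r - 1 / 2) 0 * ‖h‖ * energyNorm (adjoint J ∘L J) l h')
    {τ : ℝ} (hτ : 3 / 2 < τ) {α : ℕ → Fin N → ℝ} (hα : ∀ m, IsCGIterate (gram H x) y m (α m)) :
    ∃ m, IsStoppingIndex H x y α (τ * (M * (l / κ) ^ r) * Real.sqrt l) m ∧
      ‖J (synth H x (α m)) - g‖ ≤ (2 * errorConst ⌈r⌉₊ τ + 1) * (M * (l / κ) ^ r) := by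
  obtain ⟨w, e, a, ha, hfin⟩ := exists_eigenbasis_empOp (H := H) x
  have h0 : ∀ h : H, 0 ≤ inner ℝ (empOp H x h) h := fun h => by
    rw [inner_empOp]
    exact mul_nonneg (by positivity) (Finset.sum_nonneg fun i _ => mul_self_nonneg _)
  obtain ⟨m, hm, hme⟩ := exists_isLeast_norm_sub_le b hJ hl hlκ hξκ hr hM hρM hug hu e
    (empOp_symm x) h0 ha hfin hd hSA
    (fun i hi => inner_synth_eq_zero x y (by rw [ha, hi, zero_smul])) hτ
    (f := fun m => synth H x (α m)) (fun m => exists_polynomial_of_mem_krylov x y m (hα m).1)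
    (fun m q hq => by
      obtain ⟨β, hβ, hβq⟩ := exists_mem_krylov_of_polynomial (H := H) x y m hq
      rw [← hβq, ← matNorm_sub_gram_mulVec (H := H), ← matNorm_sub_gram_mulVec (H := H)]
      exact (hα m).2 β hβ)
  refine ⟨m, ?_, hme⟩
  rw [IsStoppingIndex]
  simp_rw [matNorm_expansion_sub]
  exact hm

end Iterates

/-! ### Probabilities of the bad events -/

section Events

open ContinuousLinearMap

variable {X : Type*} [MeasurableSpace X] {H : Type*} [NormedAddCommGroup H]
  [InnerProductSpace ℝ H] [CompleteSpace H] [TopologicalSpace.SeparableSpace H] [RKHS ℝ H X ℝ]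
  {κ : ℝ} (hk : Measurable (Function.uncurry (ker (X := X) H))) (hb : ∀ x : X, ker H x x ≤ κ)
  (P : Measure (X × ℝ)) [IsProbabilityMeasure P] {ι : Type*} (e : HilbertBasis ι ℝ H) {σ : ι → ℝ}
  {q r s D γ : ℝ} {n N : ℕ}

/-- The noise level `M q ^ r / 5` is exceeded with probability at most `γ`, for the spectral cutoff
`κ q` given by `q ^ (2 r + s) = rateBase D γ n`. -/
theorem measure_not_dualBound_le {fstar : X → ℝ} (hf : IsRegressionFunction P fstar)
    {g : Lp ℝ 2 P.fst} (hg : fstar =ᵐ[P.fst] g) {M : ℝ} (hM : 0 < M)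
    (hY : ∀ᵐ z ∂P, |z.2| ≤ M) (hκ : 0 < κ)
    (he : ∀ i, adjoint (inclusion H hk hb P.fst) (inclusion H hk hb P.fst (e i)) = σ i • e i)
    (hq0 : 0 < q) (hq1 : q ≤ 1) (hD : 1 ≤ D) (hrs : 1 / 2 ≤ r + s) (hγ : 0 < γ)
    (hT : ∀ t : Finset ι, ∑ i ∈ t, σ i / (σ i + κ * q) ≤ D ^ 2 * q ^ (-s))
    (hn : 0 < n) (hnN : n ≤ N) (hq : q ^ (2 * r + s) = rateBase D γ n) :
    Measure.pi (fun _ : Fin N => P)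
      {z | ¬ DualBound (adjoint (inclusion H hk hb P.fst) ∘L inclusion H hk hb P.fst) (κ * q)
        (M * q ^ r / 5) (synth H (fun i => (z i).1) (paddedResponses n fun i => (z i).2) -
          adjoint (inclusion H hk hb P.fst) g)} ≤ ENNReal.ofReal γ := by
  have hκq : 0 < κ * q := by positivity
  have hs2 : 0 < Real.sqrt κ := Real.sqrt_pos.2 hκ
  refine (measure_not_dualBound_synth_le hk hb P e hf hg hM hY he hκq (by positivity) hT
    (by positivity) ?_ hn hnN).trans (ENNReal.ofReal_le_ofReal (two_mul_exp_neg_le hγ ?_))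
  · have h1 : (Real.sqrt (κ * q))⁻¹ * Real.sqrt κ = q ^ (-(1 / 2) : ℝ) := by
      rw [Real.sqrt_mul hκ.le, mul_inv, mul_right_comm, inv_mul_cancel₀ hs2.ne', one_mul,
        Real.sqrt_eq_rpow, Real.rpow_neg hq0.le]
    have h2 : q ^ (-(1 / 2) : ℝ) * q ^ r ≤ D ^ 2 * q ^ (-s) := by
      rw [← Real.rpow_add hq0]
      calc q ^ (-(1 / 2) + r) ≤ q ^ (-s) :=
            Real.rpow_le_rpow_of_exponent_ge hq0 hq1 (by linarith)
        _ ≤ D ^ 2 * q ^ (-s) := le_mul_of_one_le_left (by positivity) (one_le_pow₀ hD)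
    rw [h1]
    calc M * q ^ (-(1 / 2) : ℝ) * (M * q ^ r / 5)
        = M ^ 2 * (q ^ (-(1 / 2) : ℝ) * q ^ r) / 5 := by ring
      _ ≤ M ^ 2 * (D ^ 2 * q ^ (-s)) / 5 := by gcongr
  · refine le_of_eq ?_
    have h3 : (q ^ r) ^ 2 = q ^ (2 * r + s) * q ^ (-s) := by
      rw [← Real.rpow_natCast, ← Real.rpow_mul hq0.le, ← Real.rpow_add hq0]
      congr 1
      push_cast
      ring
    have h4 : (0 : ℝ) < n := by exact_mod_cast hn
    have h5 : 0 < q ^ (-s) := by positivity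
    have h6 : 0 < D := by linarith
    rw [div_pow, mul_pow, h3, hq, rateBase]
    field_simp
    ring

/-- The empirical covariance operator is far from the population one with probability at most `γ`.
For `r < 1/2` this uses the number of unlabeled points. -/
theorem measure_not_empOp_sub_le_rate (hκ : 0 < κ)
    (he : ∀ i, adjoint (inclusion H hk hb P.fst) (inclusion H hk hb P.fst (e i)) = σ i • e i)
    (hq0 : 0 < q) (hq1 : q ≤ 1) (hD : 1 ≤ D) (hs : 0 ≤ s) (hγ : 0 < γ)
    (hT : ∀ t : Finset ι, ∑ i ∈ t, σ i / (σ i + κ * q) ≤ D ^ 2 * q ^ (-s))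
    (hn : 0 < n) (hnN : n ≤ N) (hq : q ^ (2 * r + s) = rateBase D γ n)
    (hN : q ^ (-max (1 - 2 * r) 0) ≤ (N : ℝ) / n) :
    Measure.pi (fun _ : Fin N => P)
      {z | ¬ ∀ h y : H,
        inner ℝ ((adjoint (inclusion H hk hb P.fst) ∘L inclusion H hk hb P.fst -
          empOp H fun i => (z i).1) h) y ≤
        Real.sqrt (κ * q) / 5 * q ^ max (r - 1 / 2) 0 * ‖h‖ *
        energyNorm (adjoint (inclusion H hk hb P.fst) ∘L inclusion H hk hb P.fst) (κ * q) y} ≤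
      ENNReal.ofReal γ := by
  have hκq : 0 < κ * q := by positivity
  have hs2 : 0 < Real.sqrt (κ * q) := Real.sqrt_pos.2 hκq
  refine (measure_not_empOp_sub_le hk hb P e he hκ hκq (by positivity) hT (by positivity) ?_
    (hn.trans_le hnN)).trans (ENNReal.ofReal_le_ofReal (two_mul_exp_neg_le hγ ?_))
  · have h1 : q ^ max (r - 1 / 2) 0 ≤ D ^ 2 * q ^ (-s) := by
      calc q ^ max (r - 1 / 2) 0 ≤ 1 := Real.rpow_le_one hq0.le hq1 (le_max_right _ _)
        _ ≤ D ^ 2 * q ^ (-s) := one_le_mul_of_one_le_of_one_le (one_le_pow₀ hD)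
            (Real.one_le_rpow_of_pos_of_le_one_of_nonpos hq0 hq1 (by linarith))
    calc Real.sqrt κ * ((Real.sqrt (κ * q))⁻¹ * Real.sqrt κ) *
          (Real.sqrt (κ * q) / 5 * q ^ max (r - 1 / 2) 0)
        = (Real.sqrt κ * Real.sqrt κ) * ((Real.sqrt (κ * q))⁻¹ * Real.sqrt (κ * q)) *
          q ^ max (r - 1 / 2) 0 / 5 := by ring
      _ = κ * q ^ max (r - 1 / 2) 0 / 5 := by
          rw [Real.mul_self_sqrt hκ.le, inv_mul_cancel₀ hs2.ne', mul_one]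
      _ ≤ κ * (D ^ 2 * q ^ (-s)) / 5 := by gcongr
  · have h4 : (0 : ℝ) < n := by exact_mod_cast hn
    have h5 : 0 < q ^ (-s) := by positivity
    have h6 : 0 < D := by linarith
    have h7 : n * q ^ (-max (1 - 2 * r) 0) ≤ N := by
      rw [le_div_iff₀ h4] at hN
      linarith
    have h8 : q ^ (-max (1 - 2 * r) 0) * (q * (q ^ max (r - 1 / 2) 0) ^ 2) =
        q ^ (2 * r + s) * q ^ (-s) := by
      rw [← Real.rpow_natCast, ← Real.rpow_mul hq0.le, ← Real.rpow_add hq0]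
      nth_rewrite 2 [← Real.rpow_one q]
      rw [← Real.rpow_add hq0, ← Real.rpow_add hq0]
      congr 1
      push_cast
      rcases le_total r (1 / 2) with h | h
      · rw [max_eq_left (by linarith), max_eq_right (by linarith)]
        ring
      · rw [max_eq_right (by linarith), max_eq_left (by linarith)]
        ring
    calc 16 / 25 * Real.log (6 / γ) ^ 2
        = κ * (n * (q ^ (-max (1 - 2 * r) 0) * (q * (q ^ max (r - 1 / 2) 0) ^ 2))) / 25 /
          (κ * (D ^ 2 * q ^ (-s))) := by
          rw [h8, hq, rateBase]
          field_simp
      _ = n * q ^ (-max (1 - 2 * r) 0) * (κ * q / 25 * (q ^ max (r - 1 / 2) 0) ^ 2) /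
          (κ * (D ^ 2 * q ^ (-s))) := by ring
      _ ≤ N * (κ * q / 25 * (q ^ max (r - 1 / 2) 0) ^ 2) / (κ * (D ^ 2 * q ^ (-s))) := by gcongr
      _ = N * (Real.sqrt (κ * q) / 5 * q ^ max (r - 1 / 2) 0) ^ 2 / (κ * (D ^ 2 * q ^ (-s))) := by
          rw [mul_pow, div_pow, Real.sq_sqrt hκq.le]
          norm_num

end Events

end KernelCG

theorem theorem3 (r τ' : ℝ) (hr : 0 ≤ r) (hτ : 3 / 2 < τ') :
    ∃ c : ℝ, 0 < c ∧
      ∀ (X : Type*) [MeasurableSpace X]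
        (H : Type*) [NormedAddCommGroup H] [InnerProductSpace ℝ H] [CompleteSpace H]
        [TopologicalSpace.SeparableSpace H] [RKHS ℝ H X ℝ]
        (κ : ℝ) (_hκ : 0 < κ)
        (hk : Measurable (Function.uncurry (KernelCG.ker (X := X) H)))
        (hb : ∀ x : X, KernelCG.ker H x x ≤ κ)
        (P : Measure (X × ℝ)) [IsProbabilityMeasure P]
        (fstar : X → ℝ) (_hf : KernelCG.IsRegressionFunction P fstar)
        (M ρ s D γ : ℝ) (n N : ℕ)
        (_hMρ : 0 < max M ρ) (_hs : 0 ≤ s) (_hD : 1 ≤ D) (_hγ0 : 0 < γ) (_hγ1 : γ < 1)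
        (_hn : 0 < n) (_hnN : n ≤ N)
        (_hbounded : ∀ᵐ z ∂P, |z.2| ≤ M)
        (_hSC : KernelCG.SourceCondition (KernelCG.kernelOp H hk hb P.fst) κ r ρ fstar)
        (_hID : KernelCG.IntrinsicDim (KernelCG.kernelOp H hk hb P.fst) κ s D
          (max 1 (min κ (κ * KernelCG.rateBase D γ n ^ (1 / (2 * r + s))))))
        (_hrs : 1 / 2 ≤ r + s)
        (_hunlabeled : KernelCG.rateBase D γ n ^ (-(max (1 - 2 * r) 0 / (2 * r + s))) ≤
          (N : ℝ) / n),
        Measure.pi (fun _ : Fin N => P)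
          {z : Fin N → X × ℝ | ¬ ∀ α : ℕ → Fin N → ℝ,
            (∀ m, KernelCG.IsCGIterate (KernelCG.gram H fun i => (z i).1)
              (KernelCG.paddedResponses n fun i => (z i).2) m (α m)) →
            ∃ m : ℕ,
              KernelCG.IsStoppingIndex H (fun i => (z i).1)
                (KernelCG.paddedResponses n fun i => (z i).2) α
                (KernelCG.stopThreshold τ' M ρ κ D γ r s n) m ∧
              ∫ x, (KernelCG.expansion H (fun i => (z i).1) (α m) x - fstar x) ^ 2 ∂P.fst ≤
                c * (M + ρ) ^ 2 * KernelCG.rateBase D γ n ^ (2 * r / (2 * r + s))}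
          ≤ ENNReal.ofReal (3 * γ) := by
  have hC := KernelCG.errorConst_nonneg ⌈r⌉₊ hτ
  refine ⟨(2 * KernelCG.errorConst ⌈r⌉₊ τ' + 1) ^ 2, by positivity, ?_⟩
  intro X _ H _ _ _ _ _ κ hκ hk hb P _ fstar hf M ρ s D γ n N hMρ hs hD hγ0 hγ1 hn hnN hbd hSC hID
    hrs hun
  obtain ⟨u, g, hfg, ⟨w, b, ξ, hKb, hug⟩, hu⟩ := hSC
  set J := KernelCG.inclusion H hk hb P.fst with hJdef
  rw [KernelCG.kernelOp_eq_comp hk hb] at hKb hID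
  have hJ : ∀ i, J (ContinuousLinearMap.adjoint J (b i)) = ξ i • b i := hKb
  have hξκ := KernelCG.eigenvalue_kernelOp_le hk hb hκ.le P.fst b hJ
  have hL := KernelCG.one_lt_log_six_div hγ0 hγ1
  have hn' : (0 : ℝ) < n := by exact_mod_cast hn
  have hB : 0 < KernelCG.rateBase D γ n := by
    rw [KernelCG.rateBase]
    positivity
  have hp : 0 < 2 * r + s := by linarith
  have hthr := KernelCG.stopThreshold_eq (τ := τ') (M := M) (ρ := ρ) (r := r) (s := s) hκ
    (by linarith) (by linarith) hB hp
  have hM0 : 0 ≤ M := by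
    obtain ⟨z, hz⟩ := hbd.exists
    exact (abs_nonneg _).trans hz
  have hρ0 : 0 ≤ ρ :=
    nonneg_of_mul_nonneg_right ((norm_nonneg u).trans hu) (Real.rpow_pos_of_pos hκ _)
  have hmax : max M ρ ≤ M + ρ := max_le (by linarith) (by linarith)
  have hbd' : ∀ᵐ z ∂P, |z.2| ≤ max M ρ := hbd.mono fun z hz => hz.trans (le_max_left _ _)
  have hrate : KernelCG.rateBase D γ n ^ (2 * r / (2 * r + s)) =
      ((KernelCG.rateBase D γ n ^ (1 / (2 * r + s))) ^ r) ^ 2 := by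
    rw [← Real.rpow_natCast, ← Real.rpow_mul hB.le, ← Real.rpow_mul hB.le]
    congr 1
    push_cast
    ring
  have hunq : KernelCG.rateBase D γ n ^ (-(max (1 - 2 * r) 0 / (2 * r + s))) =
      (KernelCG.rateBase D γ n ^ (1 / (2 * r + s))) ^ (-max (1 - 2 * r) 0) := by
    rw [← Real.rpow_mul hB.le]
    congr 1
    ring
  have hqB : (KernelCG.rateBase D γ n ^ (1 / (2 * r + s))) ^ (2 * r + s) =
      KernelCG.rateBase D γ n := by
    rw [← Real.rpow_mul hB.le, one_div_mul_cancel hp.ne', Real.rpow_one]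
  have hq0 : 0 < KernelCG.rateBase D γ n ^ (1 / (2 * r + s)) := Real.rpow_pos_of_pos hB _
  rw [hthr, hrate]
  rw [hunq] at hun
  generalize KernelCG.rateBase D γ n ^ (1 / (2 * r + s)) = q at *
  -- `q` is the spectral cut-off relative to `κ`.
  rcases le_or_gt 1 q with hq1 | hq1
  · -- The error bound exceeds `ρ ^ 2` and the responses are below the threshold.
    have hpi : ∀ᵐ z ∂Measure.pi (fun _ : Fin N => P), ∀ i, |(z i).2| ≤ max M ρ :=
      ae_all_iff.2 fun i =>
        (measurePreserving_eval (fun _ : Fin N => P) i).quasiMeasurePreserving.ae hbd'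
    refine le_trans (le_of_eq ?_) zero_le
    refine measure_mono_null ?_ (ae_iff.1 hpi)
    intro z hz hz'
    refine hz fun α hα => ⟨0, ?_⟩
    have hqr : 1 ≤ q ^ r := Real.one_le_rpow hq1 hr
    have hlt : ‖KernelCG.synth H (fun i => (z i).1)
        (KernelCG.paddedResponses n fun i => (z i).2)‖ <
        τ' * (max M ρ * q ^ r) * Real.sqrt (κ * q) := by
      refine (KernelCG.norm_synth_paddedResponses_le hb _ hMρ.le hz' hn hnN).trans_lt ?_
      have hsκ := Real.sqrt_pos.2 hκ
      have h1 : Real.sqrt κ ≤ Real.sqrt (κ * q) :=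
        Real.sqrt_le_sqrt (le_mul_of_one_le_right hκ.le hq1)
      have h2 : max M ρ < τ' * (max M ρ * q ^ r) := by
        have : max M ρ ≤ max M ρ * q ^ r := le_mul_of_one_le_right hMρ.le hqr
        nlinarith
      exact mul_lt_mul h2 h1 hsκ (by positivity)
    obtain ⟨h0, hidx⟩ := KernelCG.isStoppingIndex_zero hα hlt
    refine ⟨hidx, ?_⟩
    rw [KernelCG.integral_expansion_sub_sq hk hb P.fst hfg, h0, map_zero, zero_sub, norm_neg]
    have hgρ := KernelCG.norm_le_of_power_image b hκ hr (KernelCG.eigen_nonneg b hJ) hξκ hug hu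
    rw [← mul_pow, ← mul_pow]
    refine pow_le_pow_left₀ (norm_nonneg _) ?_ 2
    calc ‖g‖ ≤ 1 * (M + ρ) * 1 := by linarith
      _ ≤ (2 * KernelCG.errorConst ⌈r⌉₊ τ' + 1) * (M + ρ) * q ^ r := by
        gcongr
        linarith
  · have hl : 0 < κ * q := by positivity
    have hlκ : κ * q ≤ κ := mul_le_of_le_one_right hκ.le hq1.le
    have hlq : κ * q / κ = q := mul_div_cancel_left₀ q hκ.ne'
    obtain ⟨w', e, σ, he⟩ := KernelCG.exists_hilbertBasis_eigen b ξ (ContinuousLinearMap.adjoint J)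
      (fun i => by rw [ContinuousLinearMap.adjoint_adjoint, hJ])
    rw [ContinuousLinearMap.adjoint_adjoint] at he
    have hT := KernelCG.sum_eigen_div_le b hJ hID hl
      ((le_min hlκ le_rfl).trans (le_max_right _ _)) hκ e he
    rw [inv_mul_cancel_left₀ hκ.ne'] at hT
    have h1 := KernelCG.measure_not_dualBound_le hk hb P e hf hfg hMρ hbd' hκ he hq0 hq1.le hD hrs
      hγ0 hT hn hnN hqB
    have h2 := KernelCG.measure_not_empOp_sub_le_rate hk hb P e hκ he hq0 hq1.le hD hs hγ0 hT hn
      hnN hqB hun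
    have h3 : ENNReal.ofReal γ + ENNReal.ofReal γ ≤ ENNReal.ofReal (3 * γ) := by
      rw [← ENNReal.ofReal_add hγ0.le hγ0.le]
      exact ENNReal.ofReal_le_ofReal (by linarith)
    refine le_trans (measure_mono ?_) ((measure_union_le _ _).trans ((add_le_add h1 h2).trans h3))
    intro z hz
    by_contra hgood
    rw [Set.mem_union, not_or, Set.mem_ofPred_eq, Set.mem_ofPred_eq, not_not, not_not] at hgood
    refine hz fun α hα => ?_
    obtain ⟨m, hm, hme⟩ := KernelCG.exists_isStoppingIndex b hJ hl hlκ hξκ hr hMρ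
      (le_max_right M ρ) hug hu (fun i => (z i).1) (KernelCG.paddedResponses n fun i => (z i).2)
      (by rw [hlq]; exact hgood.1) (by rw [hlq]; exact hgood.2) hτ hα
    rw [hlq] at hm hme
    refine ⟨m, hm, ?_⟩
    rw [KernelCG.integral_expansion_sub_sq hk hb P.fst hfg, ← mul_pow, ← mul_pow]
    refine pow_le_pow_left₀ (norm_nonneg _) (hme.trans ?_) 2
    rw [← mul_assoc]
    gcongr
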